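/- Let $(X,g)$ be a (second countable, smooth) Riemannian manifold without boundary, with Riemannian measure $\mathrm dg$. For an open set $U\subset X$ let $H^1_0(U)$ be the closure of $C_c^\infty(U)$ in the energy norm $\|u\|_{H^1(U)}^2=\int_U(|u|^2+|du|_g^2)\,\mathrm dg$ (functions are complex valued), let the Dirichlet energy form of $U$ be $\mathfrak d_U(u,v)=\int_U\langle du,dv\rangle_g\,\mathrm dg$ on $H^1_0(U)$, let $\Delta_U\ge 0$ be the associated operator (the Dirichlet Laplacian), and let $H^2(U)$ be the space of $f\in L^2(U)$ with weak covariant derivatives $\nabla f,\nabla^2 f\in L^2$, with norm $\|f\|_{H^2(U)}^2=\|f\|^2+\|\nabla f\|^2+\|\nabla^2 f\|^2$. **Assumptions.** Let $S\subset X$ and $B_\varepsilon\subset S$ $(0<\varepsilon\le\varepsilon_0)$ be closed, put $X_0=X\setminus S$ and $X_\varepsilon=X\setminus B_\varepsilon$, and assume that $\partial S\setminus B_\varepsilon$ has measure zero. Suppose that $(B_\varepsilon)_\varepsilon$ is *Dirichlet-asymptotically solidifying* towards $S$, i.e. there are Lipschitz functions $\chi_\varepsilon:X\to[0,1]$ such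 that, with $A_\varepsilon:=X_0\cap\operatorname{supp}(d\chi_\varepsilon)$, one has $\chi_\varepsilon=0$ on $S$ and $\chi_\varepsilon=1$ on $X_0\setminus A_\varepsilon$, and there are $\delta'_\varepsilon,\delta''_\varepsilon\ge0$, $\bar\delta_\varepsilon\in\mathbb R$, all tending to $0$ as $\varepsilon\to0$, and a constant $C\ge1$ with the following properties for all $\varepsilon\in(0,\varepsilon_0]$: 1. (non-concentration) $\|u\|_{L^2(A_\varepsilon)}\le\delta'_\varepsilon\|u\|_{H^1(X_\varepsilon)}$ for all $u\in H^1_0(X_\varepsilon)$, and $\|df\|_{L^2(A_\varepsilon)}\le\delta''_\varepsilon\|f\|_{H^2(X_0)}$ for all $f\in H^2(X_0)$; 2. (elliptic regularity) $\operatorname{dom}\Delta_{X_0}\subset H^2(X_0)$ and $\|f\|_{H^2(X_0)}\le C\|(\Delta_{X_0}+1)f\|_{L^2(X_0)}$ for all $f\in\operatorname{dom}\Delta_{X_0}$; 3. (spectral solidification) $\|u\|_{L^2(\operatorname{int}S\setminus B_\varepsilon)}\le\bar\delta_\varepsilon\|u\|_{H^1(X_\varepsilon)}$ for all $u\in H^1_0(X_\varepsilon)$;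 4. (moderate decay) $\delta_\varepsilon^+:=\delta'_\varepsilon\,\delta''_\varepsilon\,\|d\chi_\varepsilon\|_\infty\to0$ as $\varepsilon\to0$. **Conclusion.** For every $\varepsilon\in(0,\varepsilon_0]$ the forms $\mathfrak d=\mathfrak d_{X_0}$ and $\tilde{\mathfrak d}=\mathfrak d_{X_\varepsilon}$ are $\delta_\varepsilon$-quasi-unitarily equivalent of order $2$ with $$\delta_\varepsilon=\max\{\bar\delta_\varepsilon,\ \delta'_\varepsilon,\ C(\delta''_\varepsilon+\delta^+_\varepsilon)\}.$$ That is, with $\delta=\delta_\varepsilon\ge0$ there are bounded linear operators $J:L^2(X_0)\to L^2(X_\varepsilon)$, $J':L^2(X_\varepsilon)\to L^2(X_0)$, $J^1:H^1_0(X_0)\to H^1_0(X_\varepsilon)$, $J'^1:H^1_0(X_\varepsilon)\to H^1_0(X_0)$ such that $\|Jf\|\le(1+\delta)\|f\|$ and $|\langle Jf,u\rangle-\langle f,J'u\rangle|\le\delta\|f\|\|u\|$ for $f\in L^2(X_0)$, $u\in L^2(X_\varepsilon)$; $\|f-J'Jf\|\le\delta\|f\|_{H^1}$, $\|u-JJ'u\|\le\delta\|u\|_{H^1}$,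 $\|J^1f-Jf\|\le\delta\|f\|_{H^1}$, $\|J'^1u-J'u\|\le\delta\|u\|_{H^1}$ for $f\in H^1_0(X_0)$, $u\in H^1_0(X_\varepsilon)$; and $|\tilde{\mathfrak d}(J^1f,u)-\mathfrak d(f,J'^1u)|\le\delta\,\|(\Delta_{X_0}+1)f\|\,\|u\|_{H^1}$ for $f\in\operatorname{dom}\Delta_{X_0}$, $u\in H^1_0(X_\varepsilon)$. -/

import Mathlib

open MeasureTheory Bundle Set Filter
open scoped Manifold ContDiff ENNReal NNReal Topology

noncomputable section

/-! ### Energy forms and quasi-unitary equivalence -/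

section Abstract

/-- A closed non-negative quadratic form in the Hilbert space `H`, presented by its domain `V`,
which is a Hilbert space for the energy norm, `‖f‖_V ^ 2 = ‖ι f‖_H ^ 2 + form f f`, and by the
inclusion `ι` of the domain into `H` (density of the range and injectivity of `ι` are not used in
the definitions below). As in Mathlib, sesquilinear forms are conjugate linear in the first
argument. -/
structure EnergyForm (V H : Type*) [NormedAddCommGroup V] [InnerProductSpace ℂ V]
    [CompleteSpace V] [NormedAddCommGroup H] [InnerProductSpace ℂ H] where
  /-- the inclusion of the form domain -/
  ι : V →L[ℂ] H
  /-- the sesquilinear form -/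
  form : V →L⋆[ℂ] V →L[ℂ] ℂ
  inner_eq : ∀ f g : V, inner ℂ f g = inner ℂ (ι f) (ι g) + form f g
  nonneg : ∀ f : V, 0 ≤ (form f f).re

variable {V H V' H' : Type*}
  [NormedAddCommGroup V] [InnerProductSpace ℂ V] [CompleteSpace V]
  [NormedAddCommGroup H] [InnerProductSpace ℂ H]
  [NormedAddCommGroup V'] [InnerProductSpace ℂ V'] [CompleteSpace V']
  [NormedAddCommGroup H'] [InnerProductSpace ℂ H']

/-- `f` is in the domain of the self-adjoint operator `Δ` associated with the energy form `d`,
and `Δ f = h`. -/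
def EnergyForm.IsOperatorValue (d : EnergyForm V H) (f : V) (h : H) : Prop :=
  ∀ v : V, d.form f v = inner ℂ h (d.ι v)

/-- `δ`-quasi-unitary equivalence of order `2` of two energy forms. The norm of order `1` is the
energy norm, i.e. the norm of the form domain, and the norm of order `2` of `f` in the domain of
`Δ` is `‖(Δ + 1) f‖`. -/
def QuasiUnitarilyEquivalentOfOrderTwo (d : EnergyForm V H) (d' : EnergyForm V' H') (δ : ℝ) :
    Prop :=
  0 ≤ δ ∧
  ∃ (J : H →L[ℂ] H') (J' : H' →L[ℂ] H) (J₁ : V →L[ℂ] V') (J₁' : V' →L[ℂ] V),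
    -- `J` is `δ`-quasi-unitary with `δ`-quasi-adjoint `J'`
    (∀ f : H, ‖J f‖ ≤ (1 + δ) * ‖f‖) ∧
    (∀ (f : H) (u : H'), ‖inner ℂ (J f) u - inner ℂ f (J' u)‖ ≤ δ * ‖f‖ * ‖u‖) ∧
    (∀ f : V, ‖d.ι f - J' (J (d.ι f))‖ ≤ δ * ‖f‖) ∧
    (∀ u : V', ‖d'.ι u - J (J' (d'.ι u))‖ ≤ δ * ‖u‖) ∧
    -- `J₁` and `J₁'` are `δ`-compatible with `J` and `J'`
    (∀ f : V, ‖d'.ι (J₁ f) - J (d.ι f)‖ ≤ δ * ‖f‖) ∧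
    (∀ u : V', ‖d.ι (J₁' u) - J' (d'.ι u)‖ ≤ δ * ‖u‖) ∧
    -- the energy forms are `δ`-close of order `2`
    (∀ (f : V) (h : H), d.IsOperatorValue f h →
      ∀ u : V', ‖d'.form (J₁ f) u - d.form f (J₁' u)‖ ≤ δ * ‖h + d.ι f‖ * ‖u‖)

end Abstract

/-! ### The Riemannian measure and an orthonormal frame

Throughout, `X` is a Riemannian manifold of dimension `m`. -/

section Manifold


variable (m : ℕ) {X : Type*}

section Charts

variable [TopologicalSpace X] [ChartedSpace (EuclideanSpace ℝ (Fin m)) X]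
  [IsManifold (𝓡 m) ∞ X]

/-- The `i`-th coordinate vector field `∂_i` of the chart centred at `p`, at a point `x` of the
domain of this chart. -/
def coordVec (p x : X) (i : Fin m) : TangentSpace (𝓡 m) x :=
  (trivializationAt (EuclideanSpace ℝ (Fin m)) (TangentSpace (𝓡 m) : X → Type _) p).symmL ℝ x
    (EuclideanSpace.single i 1)

/-- There is a countably valued measurable choice of charts covering the manifold. -/
theorem exists_measurable_chart_choice [SecondCountableTopology X] [MeasurableSpace X]
    [BorelSpace X] :
    ∃ c : X → X, (∀ x, x ∈ (chartAt (EuclideanSpace ℝ (Fin m)) (c x)).source) ∧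
      (range c).Countable ∧ ∀ p, MeasurableSet (c ⁻¹' {p}) := by
  classical
  rcases isEmpty_or_nonempty X with hX | hX
  · exact ⟨id, fun x => (hX.false x).elim, Set.to_countable _, fun p => (hX.false p).elim⟩
  obtain ⟨s, hs, hsU⟩ := TopologicalSpace.countable_cover_nhds
    (fun x : X => chart_source_mem_nhds (EuclideanSpace ℝ (Fin m)) x)
  have hne : s.Nonempty := by
    obtain ⟨x⟩ := hX
    have hx : x ∈ ⋃ p ∈ s, (chartAt (EuclideanSpace ℝ (Fin m)) p).source := by
      rw [hsU]; trivial
    simp only [mem_iUnion] at hx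
    obtain ⟨p, hp, -⟩ := hx
    exact ⟨p, hp⟩
  obtain ⟨q, hq⟩ := hs.exists_eq_range hne
  have hcov : ∀ x, ∃ n, x ∈ (chartAt (EuclideanSpace ℝ (Fin m)) (q n)).source := by
    intro x
    have hx : x ∈ ⋃ p ∈ s, (chartAt (EuclideanSpace ℝ (Fin m)) p).source := by
      rw [hsU]; trivial
    simp only [mem_iUnion] at hx
    obtain ⟨p, hp, hxp⟩ := hx
    rw [hq] at hp
    obtain ⟨n, rfl⟩ := hp
    exact ⟨n, hxp⟩
  refine ⟨fun x => q (Nat.find (hcov x)), fun x => Nat.find_spec (hcov x),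
    (countable_range q).mono ?_, fun p => ?_⟩
  · rintro _ ⟨x, rfl⟩
    exact mem_range_self _
  · have hN : Measurable fun x => Nat.find (hcov x) :=
      measurable_find hcov fun n =>
        (chartAt (EuclideanSpace ℝ (Fin m)) (q n)).open_source.measurableSet
    exact hN (Set.to_countable (q ⁻¹' {p})).measurableSet

/-- A countably valued measurable choice of a chart around each point. -/
def chartChoice [SecondCountableTopology X] [MeasurableSpace X] [BorelSpace X] : X → X :=
  (exists_measurable_chart_choice m (X := X)).choose

variable [RiemannianBundle (fun x : X => TangentSpace (𝓡 m) x)]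

/-- The matrix `g_ij = ⟨∂_i, ∂_j⟩` of the metric in the chart centred at `p`. -/
def metricMatrix (p x : X) : Matrix (Fin m) (Fin m) ℝ :=
  Matrix.of fun i j => inner ℝ (coordVec m p x i) (coordVec m p x j)

/-- The metric matrix as a function of the coordinates. -/
def metricInChart (p : X) (y : EuclideanSpace ℝ (Fin m)) : Matrix (Fin m) (Fin m) ℝ :=
  metricMatrix m p ((chartAt (EuclideanSpace ℝ (Fin m)) p).symm y)

/-- The Riemannian measure of the domain of the chart centred at `p`:
`√(det g_ij) dy` in the coordinates. -/
def chartVolume [MeasurableSpace X] (p : X) : Measure X :=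
  ((volume.restrict (chartAt (EuclideanSpace ℝ (Fin m)) p).target).withDensity
    fun y => ENNReal.ofReal (Real.sqrt (metricInChart m p y).det)).map
      (chartAt (EuclideanSpace ℝ (Fin m)) p).symm

/-- The Riemannian measure of `X`, glued together from its restrictions to the chart domains
(these coincide on overlaps, so that their supremum restricts to each of them). -/
def riemannianVolume [MeasurableSpace X] : Measure X := ⨆ p : X, chartVolume m p

/-- The partial derivative `∂_l g_ij`. -/
def metricPartial (p : X) (l i j : Fin m) (y : EuclideanSpace ℝ (Fin m)) : ℝ :=
  fderiv ℝ (fun z => metricInChart m p z i j) y (EuclideanSpace.single l 1)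

/-- The Christoffel symbols `Γ^k_ij` of the Levi-Civita connection. -/
def christoffel (p : X) (k i j : Fin m) (y : EuclideanSpace ℝ (Fin m)) : ℝ :=
  (1 / 2) * ∑ l, (metricInChart m p y)⁻¹ k l *
    (metricPartial m p i j l y + metricPartial m p j i l y - metricPartial m p l i j y)

variable [SecondCountableTopology X] [MeasurableSpace X] [BorelSpace X]

/-- A measurable orthonormal frame: Gram-Schmidt applied to the coordinate vector fields. -/
def frame (x : X) : Fin m → TangentSpace (𝓡 m) x :=
  InnerProductSpace.gramSchmidtNormed ℝ (coordVec m (chartChoice m x) x)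

/-- The components of a complex covector in the orthonormal frame. Their Euclidean norm is the
norm of the covector with respect to the metric. -/
def covectorComponents (x : X) (w : TangentSpace (𝓡 m) x →L[ℝ] ℂ) : EuclideanSpace ℂ (Fin m) :=
  WithLp.toLp 2 fun i => w (frame m x i)

/-- The components of a complex `2`-tensor in the orthonormal frame. Their Euclidean norm is the
norm of the tensor with respect to the metric. -/
def tensorComponents (x : X) (t : TangentSpace (𝓡 m) x →L[ℝ] TangentSpace (𝓡 m) x →L[ℝ] ℂ) :
    EuclideanSpace ℂ (Fin m × Fin m) :=
  WithLp.toLp 2 fun i => t (frame m x i.1) (frame m x i.2)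

/-- The differential `dφ` of a function. -/
def differential (φ : X → ℂ) (x : X) : TangentSpace (𝓡 m) x →L[ℝ] ℂ :=
  mfderiv (𝓡 m) 𝓘(ℝ, ℂ) φ x

/-- The differential in the orthonormal frame. -/
def differentialComponents (φ : X → ℂ) (x : X) : EuclideanSpace ℂ (Fin m) :=
  covectorComponents m x (differential m φ x)

/-! ### The Dirichlet energy form -/

/-- Smooth functions with compact support in `U`. -/
structure IsTestFunction (U : Set X) (φ : X → ℂ) : Prop where
  smooth : ContMDiff (𝓡 m) 𝓘(ℝ, ℂ) ∞ φ
  compact : HasCompactSupport φ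
  supp : tsupport φ ⊆ U

theorem IsTestFunction.mdifferentiableAt {U : Set X} {φ : X → ℂ} (h : IsTestFunction m U φ)
    (x : X) : MDifferentiableAt (𝓡 m) 𝓘(ℝ, ℂ) φ x :=
  h.smooth.mdifferentiableAt (by simp)

theorem differentialComponents_zero (x : X) :
    differentialComponents m (fun _ : X => (0 : ℂ)) x = 0 := by
  ext i
  simp only [differentialComponents, covectorComponents, differential, mfderiv_const]
  rfl

theorem differentialComponents_add {φ ψ : X → ℂ} {x : X}
    (h : MDifferentiableAt (𝓡 m) 𝓘(ℝ, ℂ) φ x) (h' : MDifferentiableAt (𝓡 m) 𝓘(ℝ, ℂ) ψ x) :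
    differentialComponents m (φ + ψ) x =
      differentialComponents m φ x + differentialComponents m ψ x := by
  ext i
  simp only [differentialComponents, covectorComponents, differential, PiLp.add_apply]
  rw [mfderiv_add h h']
  rfl

theorem differentialComponents_const_smul (c : ℂ) {φ : X → ℂ} {x : X}
    (h : MDifferentiableAt (𝓡 m) 𝓘(ℝ, ℂ) φ x) :
    differentialComponents m (c • φ) x = c • differentialComponents m φ x := by
  ext i
  have key : HasMFDerivAt (𝓡 m) 𝓘(ℝ, ℂ) (c • φ) x
      (((c • ContinuousLinearMap.id ℝ ℂ : ℂ →L[ℝ] ℂ)).comp (mfderiv (𝓡 m) 𝓘(ℝ, ℂ) φ x)) :=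
    HasMFDerivAt.comp (I' := 𝓘(ℝ, ℂ)) (g := fun z : ℂ => c • z) x
      (((c • ContinuousLinearMap.id ℝ ℂ : ℂ →L[ℝ] ℂ)).hasFDerivAt.hasMFDerivAt) h.hasMFDerivAt
  simp only [differentialComponents, covectorComponents, differential, PiLp.smul_apply]
  rw [key.mfderiv]
  rfl

/-- `L²(U)`. -/
abbrev L2 (U : Set X) : Type _ := Lp ℂ 2 ((riemannianVolume m (X := X)).restrict U)

/-- `L²(T*U)`, in terms of the components in the orthonormal frame. -/
abbrev L2Form (U : Set X) : Type _ :=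
  Lp (EuclideanSpace ℂ (Fin m)) 2 ((riemannianVolume m (X := X)).restrict U)

/-- The Hilbert space sum of `L²(U)` and `L²(T*U)`. -/
abbrev L2Pair (U : Set X) : Type _ := WithLp 2 (L2 m U × L2Form m U)

/-- The space of all pairs `(φ, dφ)` with a test function `φ`. The norm of such a pair is the
energy norm `(‖φ‖² + ‖dφ‖²)^(1/2)`. -/
def testPairs (U : Set X) : Submodule ℂ (L2Pair m U) where
  carrier := {z | ∃ φ : X → ℂ, IsTestFunction m U φ ∧
    z.fst =ᵐ[(riemannianVolume m).restrict U] φ ∧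
    z.snd =ᵐ[(riemannianVolume m).restrict U] differentialComponents m φ}
  zero_mem' := by
    refine ⟨fun _ => 0, ⟨contMDiff_const, HasCompactSupport.zero, ?_⟩, ?_, ?_⟩
    · have : tsupport (fun _ : X => (0 : ℂ)) = ∅ := tsupport_eq_empty_iff.2 rfl
      rw [this]; exact empty_subset _
    · exact Lp.coeFn_zero _ _ _
    · refine (Lp.coeFn_zero _ _ _).trans (Eventually.of_forall fun x => ?_)
      exact (differentialComponents_zero m x).symm
  add_mem' := by
    rintro z z' ⟨φ, hφ, h1, h2⟩ ⟨ψ, hψ, h1', h2'⟩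
    refine ⟨φ + ψ, ⟨hφ.smooth.add hψ.smooth, hφ.compact.add hψ.compact, ?_⟩, ?_, ?_⟩
    · exact (tsupport_add φ ψ).trans (union_subset hφ.supp hψ.supp)
    · exact (Lp.coeFn_add _ _).trans (h1.add h1')
    · refine (Lp.coeFn_add _ _).trans ((h2.add h2').trans (Eventually.of_forall fun x => ?_))
      exact (differentialComponents_add m (hφ.mdifferentiableAt m x)
        (hψ.mdifferentiableAt m x)).symm
  smul_mem' := by
    rintro c z ⟨φ, hφ, h1, h2⟩
    refine ⟨c • φ, ⟨?_, ?_, ?_⟩, ?_, ?_⟩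
    · exact ((c • ContinuousLinearMap.id ℝ ℂ : ℂ →L[ℝ] ℂ)).contDiff.contMDiff.comp hφ.smooth
    · exact hφ.compact.smul_left (f := fun _ => c)
    · exact (tsupport_smul_subset_right (fun _ => c) φ).trans hφ.supp
    · exact (Lp.coeFn_smul _ _).trans (h1.const_smul c)
    · refine (Lp.coeFn_smul _ _).trans ((h2.const_smul c).trans (Eventually.of_forall fun x => ?_))
      exact (differentialComponents_const_smul m c (hφ.mdifferentiableAt m x)).symm

/-- The Sobolev space `H¹₀(U)`: the closure of the smooth functions with compact support in `U`
with respect to the energy norm. An element is a function together with its differential. -/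
def sobolevZero (U : Set X) : Submodule ℂ (L2Pair m U) := (testPairs m U).topologicalClosure

instance (U : Set X) : CompleteSpace (sobolevZero m U) :=
  (Submodule.isClosed_topologicalClosure (testPairs m U)).completeSpace_coe

/-- The inclusion of `H¹₀(U)` into `L²(U)`. -/
def sobolevInclusion (U : Set X) : sobolevZero m U →L[ℂ] L2 m U :=
  (WithLp.fstL 2 ℂ (L2 m U) (L2Form m U)).comp (sobolevZero m U).subtypeL

/-- The differential on `H¹₀(U)`. -/
def sobolevDifferential (U : Set X) : sobolevZero m U →L[ℂ] L2Form m U :=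
  (WithLp.sndL 2 ℂ (L2 m U) (L2Form m U)).comp (sobolevZero m U).subtypeL

/-- The Dirichlet energy form of `U`, i.e. `(u, v) ↦ ∫_U ⟨du, dv⟩` on `H¹₀(U)`. -/
def dirichletForm (U : Set X) : EnergyForm (sobolevZero m U) (L2 m U) where
  ι := sobolevInclusion m U
  form := (innerSL ℂ : L2Form m U →L⋆[ℂ] L2Form m U →L[ℂ] ℂ).bilinearComp
    (sobolevDifferential m U) (sobolevDifferential m U)
  inner_eq f g := WithLp.prod_inner_apply f.1 g.1
  nonneg f := inner_self_nonneg (𝕜 := ℂ) (x := sobolevDifferential m U f)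

/-! ### The Sobolev space of order two -/

/-- `v` is the `i`-th weak partial derivative of `u` on the open subset `V` of `ℝ^m`. -/
def HasWeakPartial (V : Set (EuclideanSpace ℝ (Fin m))) (i : Fin m)
    (u v : EuclideanSpace ℝ (Fin m) → ℂ) : Prop :=
  LocallyIntegrableOn u V ∧ LocallyIntegrableOn v V ∧
  ∀ ψ : EuclideanSpace ℝ (Fin m) → ℝ, ContDiff ℝ ∞ ψ → HasCompactSupport ψ → tsupport ψ ⊆ V →
    ∫ y, fderiv ℝ ψ y (EuclideanSpace.single i 1) • u y = -∫ y, ψ y • v y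

/-- On the open set `U`, the function `u` has the weak differential `w` and the weak second
covariant derivative `t = ∇ w`. In charts, `w_i = ∂_i u` and
`t_ij = ∂_i w_j - ∑_k Γ^k_ij w_k`. -/
def HasWeakHessian (U : Set X) (u : X → ℂ) (w : ∀ x : X, TangentSpace (𝓡 m) x →L[ℝ] ℂ)
    (t : ∀ x : X, TangentSpace (𝓡 m) x →L[ℝ] TangentSpace (𝓡 m) x →L[ℝ] ℂ) : Prop :=
  ∀ p : X,
    let e := chartAt (EuclideanSpace ℝ (Fin m)) p
    let V := e.target ∩ e.symm ⁻¹' U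
    let wc : Fin m → EuclideanSpace ℝ (Fin m) → ℂ :=
      fun i y => w (e.symm y) (coordVec m p (e.symm y) i)
    let tc : Fin m → Fin m → EuclideanSpace ℝ (Fin m) → ℂ :=
      fun i j y => t (e.symm y) (coordVec m p (e.symm y) i) (coordVec m p (e.symm y) j)
    (∀ i, HasWeakPartial m V i (fun y => u (e.symm y)) (wc i)) ∧
    ∀ i j, HasWeakPartial m V i (wc j)
      (fun y => tc i j y + ∑ k, (christoffel m p k i j y : ℂ) * wc k y)

/-- The norm of `H²(U)`, `(‖u‖² + ‖∇u‖² + ‖∇²u‖²)^(1/2)`. -/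
def sobolevTwoNorm (U : Set X) (u : X → ℂ) (w : ∀ x : X, TangentSpace (𝓡 m) x →L[ℝ] ℂ)
    (t : ∀ x : X, TangentSpace (𝓡 m) x →L[ℝ] TangentSpace (𝓡 m) x →L[ℝ] ℂ) : ℝ≥0∞ :=
  (eLpNorm u 2 ((riemannianVolume m).restrict U) ^ 2 +
    eLpNorm (fun x => covectorComponents m x (w x)) 2 ((riemannianVolume m).restrict U) ^ 2 +
    eLpNorm (fun x => tensorComponents m x (t x)) 2 ((riemannianVolume m).restrict U) ^ 2) ^
    (1 / 2 : ℝ)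

/-- `u` is in `H²(U)`, with weak covariant derivatives `∇u = w` and `∇²u = t`. -/
def IsSobolevTwo (U : Set X) (u : X → ℂ) (w : ∀ x : X, TangentSpace (𝓡 m) x →L[ℝ] ℂ)
    (t : ∀ x : X, TangentSpace (𝓡 m) x →L[ℝ] TangentSpace (𝓡 m) x →L[ℝ] ℂ) : Prop :=
  HasWeakHessian m U u w t ∧ sobolevTwoNorm m U u w t < ⊤

/-! ### Solidifying obstacles -/

/-- `‖u‖_{L²(A)} ≤ δ ‖u‖_{H¹(U)}` for all `u ∈ H¹₀(U)`. -/
def NonConcentrating (A U : Set X) (δ : ℝ) : Prop :=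
  ∀ u : sobolevZero m U,
    eLpNorm (sobolevInclusion m U u) 2 ((riemannianVolume m).restrict A) ≤
      ENNReal.ofReal (δ * ‖u‖)

/-- `‖df‖_{L²(A)} ≤ δ ‖f‖_{H²(U)}` for all `f ∈ H²(U)`. -/
def NonConcentratingOfOrderTwo (A U : Set X) (δ : ℝ) : Prop :=
  ∀ (f : X → ℂ) (w : ∀ x : X, TangentSpace (𝓡 m) x →L[ℝ] ℂ)
    (t : ∀ x : X, TangentSpace (𝓡 m) x →L[ℝ] TangentSpace (𝓡 m) x →L[ℝ] ℂ),
    IsSobolevTwo m U f w t →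
      eLpNorm (fun x => covectorComponents m x (w x)) 2 ((riemannianVolume m).restrict A) ≤
        ENNReal.ofReal δ * sobolevTwoNorm m U f w t

/-- Elliptic regularity of `U` with constant `C`: every `f` in the domain of the Dirichlet
Laplacian `Δ` of `U` is in `H²(U)`, and `‖f‖_{H²(U)} ≤ C ‖(Δ + 1) f‖_{L²(U)}`. -/
def EllipticallyRegular (U : Set X) (C : ℝ) : Prop :=
  ∀ (f : sobolevZero m U) (h : L2 m U), (dirichletForm m U).IsOperatorValue f h →
    ∃ (w : ∀ x : X, TangentSpace (𝓡 m) x →L[ℝ] ℂ)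
      (t : ∀ x : X, TangentSpace (𝓡 m) x →L[ℝ] TangentSpace (𝓡 m) x →L[ℝ] ℂ),
      IsSobolevTwo m U (sobolevInclusion m U f) w t ∧
      sobolevTwoNorm m U (sobolevInclusion m U f) w t ≤
        ENNReal.ofReal (C * ‖h + sobolevInclusion m U f‖)

/-- The differential of a real function, in the orthonormal frame. -/
def realDifferential (χ : X → ℝ) : X → EuclideanSpace ℂ (Fin m) :=
  differentialComponents m fun x => (χ x : ℂ)

/-- The support of the almost everywhere defined `1`-form `dχ`. -/
def differentialSupport (χ : X → ℝ) : Set X :=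
  ((riemannianVolume m).restrict {x | realDifferential m χ x ≠ 0}).support

/-- The norm `‖dχ‖_∞`. -/
def differentialSupNorm (χ : X → ℝ) : ℝ :=
  (eLpNorm (realDifferential m χ) ⊤ (riemannianVolume m)).toReal

/-- The annulus region of the cut-off function `χ` outside `S`. -/
def annulus (S : Set X) (χ : X → ℝ) : Set X := differentialSupport m χ \ S

end Charts

variable [EMetricSpace X] [ChartedSpace (EuclideanSpace ℝ (Fin m)) X] [IsManifold (𝓡 m) ∞ X]
  [RiemannianBundle (fun x : X => TangentSpace (𝓡 m) x)]
  [SecondCountableTopology X] [MeasurableSpace X] [BorelSpace X]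

/-- The obstacles `B ε`, `0 < ε ≤ ε₀`, are Dirichlet-asymptotically solidifying towards `S`, with
cut-off functions `χ ε`, non-concentration rates `δ' ε` and `δ'' ε`, spectral rate `δbar ε` and
constant `C` of elliptic regularity. Here `X ∖ S` is `Sᶜ`, and `X ∖ B ε` is `(B ε)ᶜ`. -/
structure IsDirichletSolidifying (ε₀ : ℝ) (B : ℝ → Set X) (S : Set X) (χ : ℝ → X → ℝ)
    (δ' δ'' δbar : ℝ → ℝ) (C : ℝ) : Prop where
  isClosed_obstacle : ∀ ε ∈ Ioc 0 ε₀, IsClosed (B ε)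
  isClosed_limit : IsClosed S
  -- the cut-off functions
  lipschitz : ∀ ε ∈ Ioc 0 ε₀, ∃ K : ℝ≥0, LipschitzWith K (χ ε)
  range_cutoff : ∀ ε ∈ Ioc 0 ε₀, ∀ x, χ ε x ∈ Icc (0 : ℝ) 1
  cutoff_eq_zero : ∀ ε ∈ Ioc 0 ε₀, ∀ x ∈ S, χ ε x = 0
  cutoff_eq_one : ∀ ε ∈ Ioc 0 ε₀, ∀ x ∉ S, x ∉ annulus m S (χ ε) → χ ε x = 1
  -- the non-concentrating property
  rate_nonneg : ∀ ε ∈ Ioc 0 ε₀, 0 ≤ δ' ε ∧ 0 ≤ δ'' ε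
  nonConcentrating : ∀ ε ∈ Ioc 0 ε₀,
    NonConcentrating m (annulus m S (χ ε)) (B ε)ᶜ (δ' ε)
  tendsto_rate : Tendsto δ' (𝓝[>] 0) (𝓝 0)
  nonConcentrating_two : ∀ ε ∈ Ioc 0 ε₀,
    NonConcentratingOfOrderTwo m (annulus m S (χ ε)) Sᶜ (δ'' ε)
  tendsto_rate_two : Tendsto δ'' (𝓝[>] 0) (𝓝 0)
  -- elliptic regularity
  one_le_const : 1 ≤ C
  ellipticallyRegular : EllipticallyRegular m Sᶜ C
  -- the obstacles are spectrally solidifying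
  obstacle_subset : ∀ ε ∈ Ioc 0 ε₀, B ε ⊆ S
  null_boundary : ∀ ε ∈ Ioc 0 ε₀, riemannianVolume m (frontier S \ B ε) = 0
  spectral : ∀ ε ∈ Ioc 0 ε₀, NonConcentrating m (interior S \ B ε) (B ε)ᶜ (δbar ε)
  tendsto_spectral : Tendsto δbar (𝓝[>] 0) (𝓝 0)
  -- the cut-off functions have moderate decay
  moderate_decay :
    Tendsto (fun ε => δ' ε * δ'' ε * differentialSupNorm m (χ ε)) (𝓝[>] 0) (𝓝 0)

end Manifold

end

/-!
A function on `X ∖ S` is transplanted to `X ∖ B` by extension by zero, and transplanted back by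
restriction. On the level of `H¹₀`, extension by zero still works, but the way back is the
multiplication by the cut-off function `χ`. All errors are then supported where one of the
assumptions controls them: `u - JJ'u` lives on `S ∖ B`, which up to a null set is `int S ∖ B`, and
`χu - u` lives on the annulus. The difference of the energy forms is
`∫ ⟨df, (1 - χ) du - u dχ⟩` over the annulus. There, `df` is small of order `δ''` by elliptic
regularity, the first term of the other factor is bounded by the energy norm of `u`, and in the
second one the possibly large `dχ` is compensated by the factor `δ'` from `u`.

Multiplication by `χ` maps into `H¹₀(X ∖ S)` because `(χ - η)⁺ φ` has compact support in `X ∖ S`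
and can be mollified in charts, with convergence to `χφ` in the energy norm as `η → 0`. In order
to identify `df` for `f` in `H¹₀` with the weak differential in charts, one integrates by parts.
-/

noncomputable section

local notation "𝔼" m:max => EuclideanSpace ℝ (Fin m)

variable (m : ℕ)

section GramSchmidt

open InnerProductSpace

variable {𝕜 ι Ω : Type*} [RCLike 𝕜] [Fintype ι] [MeasurableSpace Ω] {V : Ω → Type*}
  [∀ x, NormedAddCommGroup (V x)] [∀ x, InnerProductSpace 𝕜 (V x)] {v : ∀ x, ι → V x}

theorem measurable_inner_sum_smul (hv : ∀ i j, Measurable fun x => inner 𝕜 (v x i) (v x j))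
    {a b : ι → Ω → 𝕜} (ha : ∀ i, Measurable (a i)) (hb : ∀ i, Measurable (b i)) :
    Measurable fun x => inner 𝕜 (∑ i, a i x • v x i) (∑ j, b j x • v x j) := by
  simp only [sum_inner, inner_sum, inner_smul_left, inner_smul_right]
  exact Finset.measurable_sum _ fun j _ => (hb j).mul (Finset.measurable_sum _ fun i _ =>
    (RCLike.continuous_conj.measurable.comp (ha i)).mul (hv i j))

theorem measurable_norm_sum_smul (hv : ∀ i j, Measurable fun x => inner 𝕜 (v x i) (v x j))
    {a : ι → Ω → 𝕜} (ha : ∀ i, Measurable (a i)) :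
    Measurable fun x => ‖∑ i, a i x • v x i‖ := by
  simp only [norm_eq_sqrt_re_inner (𝕜 := 𝕜)]
  exact (RCLike.measurable_re.comp (measurable_inner_sum_smul hv ha ha)).sqrt

variable [LinearOrder ι] [LocallyFiniteOrderBot ι] [WellFoundedLT ι]

theorem exists_measurable_gramSchmidt_coeff
    (hv : ∀ i j, Measurable fun x => inner 𝕜 (v x i) (v x j)) (n : ι) :
    ∃ a : ι → Ω → 𝕜, (∀ j, Measurable (a j)) ∧
      ∀ x, gramSchmidt 𝕜 (v x) n = ∑ j, a j x • v x j := by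
  induction n using WellFoundedLT.induction with
  | ind n ih =>
  choose! a ha hav using ih
  let c : ι → Ω → 𝕜 := fun i x =>
    inner 𝕜 (gramSchmidt 𝕜 (v x) i) (v x n) / ((‖gramSchmidt 𝕜 (v x) i‖ ^ 2 : ℝ) : 𝕜)
  have hc : ∀ i < n, Measurable (c i) := fun i hi => by
    have hinner := measurable_inner_sum_smul hv (ha i hi)
      (b := fun j _ => if j = n then 1 else 0) fun _ => measurable_const
    have hnorm := measurable_norm_sum_smul hv (ha i hi)
    simp only [ite_smul, one_smul, zero_smul, Finset.sum_ite_eq', Finset.mem_univ, if_true,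
      ← hav i hi] at hinner hnorm
    exact hinner.div (RCLike.measurable_ofReal.comp (hnorm.pow_const 2))
  refine ⟨fun j x => (if j = n then 1 else 0) - ∑ i ∈ Finset.Iio n, c i x * a i j x,
    fun j => measurable_const.sub (Finset.measurable_sum _ fun i hi =>
      (hc i (Finset.mem_Iio.1 hi)).mul (ha i (Finset.mem_Iio.1 hi) j)), fun x => ?_⟩
  rw [gramSchmidt_def]
  simp only [sub_smul, Finset.sum_sub_distrib, ite_smul, one_smul, zero_smul,
    Finset.sum_ite_eq', Finset.mem_univ, if_true, Finset.sum_smul, mul_smul]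
  rw [Finset.sum_comm]
  refine congrArg _ (Finset.sum_congr rfl fun i hi => ?_)
  rw [Submodule.starProjection_singleton, ← Finset.smul_sum, ← hav i (Finset.mem_Iio.1 hi)]

theorem exists_measurable_gramSchmidtNormed_coeff
    (hv : ∀ i j, Measurable fun x => inner 𝕜 (v x i) (v x j)) (n : ι) :
    ∃ a : ι → Ω → 𝕜, (∀ j, Measurable (a j)) ∧
      ∀ x, gramSchmidtNormed 𝕜 (v x) n = ∑ j, a j x • v x j := by
  obtain ⟨a, ha, hav⟩ := exists_measurable_gramSchmidt_coeff hv n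
  have hnorm := measurable_norm_sum_smul hv ha
  simp only [← hav] at hnorm
  refine ⟨fun j x => (‖gramSchmidt 𝕜 (v x) n‖ : 𝕜)⁻¹ * a j x, fun j =>
    (RCLike.measurable_ofReal.comp hnorm).inv.mul (ha j), fun x => ?_⟩
  simp only [mul_smul, ← Finset.smul_sum, ← hav, gramSchmidtNormed]

end GramSchmidt

section ChartCoordinates

variable {X : Type*} [TopologicalSpace X] [ChartedSpace (𝔼 m) X] [IsManifold (𝓡 m) ∞ X]

/-- The tangent vector at `x` with given coordinates in the chart centred at `p`; it is `0` if `x`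
is outside the domain of this chart. -/
def coordMap (p x : X) : 𝔼 m →L[ℝ] TangentSpace (𝓡 m) x :=
  (trivializationAt (𝔼 m) (TangentSpace (𝓡 m) : X → Type _) p).symmL ℝ x

/-- The coordinates of a tangent vector at `x` in the chart centred at `p`. -/
def coordMapInv (p x : X) : TangentSpace (𝓡 m) x →L[ℝ] 𝔼 m :=
  (trivializationAt (𝔼 m) (TangentSpace (𝓡 m) : X → Type _) p).continuousLinearMapAt ℝ x

theorem coordMap_single (p x : X) (i : Fin m) :
    coordMap m p x (EuclideanSpace.single i 1) = coordVec m p x i := rfl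

theorem coordMap_eq_sum (p x : X) (v : 𝔼 m) : coordMap m p x v = ∑ i, v i • coordVec m p x i := by
  conv_lhs => rw [← (EuclideanSpace.basisFun (Fin m) ℝ).sum_repr v]
  simp [coordMap_single]

theorem coordVec_of_notMem_source {p x : X} (hx : x ∉ (chartAt (𝔼 m) p).source) (i : Fin m) :
    coordVec m p x i = 0 :=
  (trivializationAt (𝔼 m) (TangentSpace (𝓡 m) : X → Type _) p).symmL_apply_of_notMem
    (by simpa using hx) _

theorem coordMapInv_coordMap {p x : X} (hx : x ∈ (chartAt (𝔼 m) p).source) (v : 𝔼 m) :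
    coordMapInv m p x (coordMap m p x v) = v :=
  (trivializationAt (𝔼 m) (TangentSpace (𝓡 m) : X → Type _) p).continuousLinearMapAt_symmL
    (by simpa using hx) v

theorem coordMap_coordMapInv {p x : X} (hx : x ∈ (chartAt (𝔼 m) p).source)
    (v : TangentSpace (𝓡 m) x) : coordMap m p x (coordMapInv m p x v) = v :=
  (trivializationAt (𝔼 m) (TangentSpace (𝓡 m) : X → Type _) p).symmL_continuousLinearMapAt
    (by simpa using hx) v

theorem linearIndependent_coordVec {p x : X} (hx : x ∈ (chartAt (𝔼 m) p).source) :
    LinearIndependent ℝ (coordVec m p x) := by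
  have hinj : Function.Injective (coordMap m p x) :=
    Function.LeftInverse.injective (coordMapInv_coordMap m hx)
  have h := (EuclideanSpace.basisFun (Fin m) ℝ).toBasis.linearIndependent.map'
    (coordMap m p x).toLinearMap (LinearMap.ker_eq_bot.2 hinj)
  have heq : coordVec m p x = coordMap m p x ∘ (EuclideanSpace.basisFun (Fin m) ℝ).toBasis :=
    funext fun i => by simp [← coordMap_single]
  rw [heq]
  exact h

theorem span_range_coordVec {p x : X} (hx : x ∈ (chartAt (𝔼 m) p).source) :
    Submodule.span ℝ (range (coordVec m p x)) = ⊤ := by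
  refine eq_top_iff.2 fun v _ => ?_
  rw [← coordMap_coordMapInv m hx v, coordMap_eq_sum]
  exact Submodule.sum_mem _ fun i _ => Submodule.smul_mem _ _ (Submodule.subset_span ⟨i, rfl⟩)

theorem hasMFDerivAt_chartAt_symm {p : X} {y : 𝔼 m} (hy : y ∈ (chartAt (𝔼 m) p).target) :
    HasMFDerivAt 𝓘(ℝ, 𝔼 m) (𝓡 m) (chartAt (𝔼 m) p).symm y
      (coordMap m p ((chartAt (𝔼 m) p).symm y)) := by
  have h : coordMap m p ((chartAt (𝔼 m) p).symm y) =
      mfderiv 𝓘(ℝ, 𝔼 m) (𝓡 m) (chartAt (𝔼 m) p).symm y := by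
    have h := TangentBundle.symmL_trivializationAt (I := 𝓡 m) (𝕜 := ℝ)
      ((chartAt (𝔼 m) p).map_target hy)
    simp only [mfld_simps, mfderivWithin_univ] at h
    rwa [(chartAt (𝔼 m) p).right_inv hy] at h
  rw [h]
  exact (mdifferentiableAt_atlas_symm (I := 𝓡 m) (chart_mem_atlas _ p) hy).hasMFDerivAt

theorem hasMFDerivAt_chartAt {p x : X} (hx : x ∈ (chartAt (𝔼 m) p).source) :
    HasMFDerivAt (𝓡 m) 𝓘(ℝ, 𝔼 m) (chartAt (𝔼 m) p) x (coordMapInv m p x) := by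
  have h : coordMapInv m p x = mfderiv (𝓡 m) 𝓘(ℝ, 𝔼 m) (chartAt (𝔼 m) p) x :=
    TangentBundle.continuousLinearMapAt_trivializationAt hx
  rw [h]
  exact (mdifferentiableAt_atlas (I := 𝓡 m) (chart_mem_atlas _ p) hx).hasMFDerivAt

variable {F : Type*} [NormedAddCommGroup F] [NormedSpace ℝ F]

theorem eq_of_forall_coordVec_eq {p x : X} (hx : x ∈ (chartAt (𝔼 m) p).source)
    {w w' : TangentSpace (𝓡 m) x →L[ℝ] F}
    (h : ∀ i, w (coordVec m p x i) = w' (coordVec m p x i)) : w = w' :=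
  ContinuousLinearMap.coe_injective
    (LinearMap.ext_on_range (span_range_coordVec m hx) h)

theorem mdifferentiableAt_chartAt_symm_iff {p : X} {y : 𝔼 m} (hy : y ∈ (chartAt (𝔼 m) p).target)
    (f : X → F) :
    MDifferentiableAt (𝓡 m) 𝓘(ℝ, F) f ((chartAt (𝔼 m) p).symm y) ↔
      DifferentiableAt ℝ (f ∘ (chartAt (𝔼 m) p).symm) y := by
  set e := chartAt (𝔼 m) p
  have hx := e.map_target hy
  refine ⟨fun hf => (hf.comp y (hasMFDerivAt_chartAt_symm m hy).mdifferentiableAt).differentiableAt,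
    fun hf => ?_⟩
  have hcomp : MDifferentiableAt (𝓡 m) 𝓘(ℝ, F) ((f ∘ e.symm) ∘ e) (e.symm y) := by
    refine MDifferentiableAt.comp _ ?_ (hasMFDerivAt_chartAt m hx).mdifferentiableAt
    rw [e.right_inv hy]
    exact hf.mdifferentiableAt
  refine hcomp.congr_of_eventuallyEq ?_
  filter_upwards [e.open_source.mem_nhds hx] with z hz
  simp [e.left_inv hz]

theorem mfderiv_coordMap {p : X} {y : 𝔼 m} (hy : y ∈ (chartAt (𝔼 m) p).target) (f : X → F)
    (v : 𝔼 m) :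
    mfderiv (𝓡 m) 𝓘(ℝ, F) f ((chartAt (𝔼 m) p).symm y)
        (coordMap m p ((chartAt (𝔼 m) p).symm y) v) =
      fderiv ℝ (f ∘ (chartAt (𝔼 m) p).symm) y v := by
  by_cases hf : MDifferentiableAt (𝓡 m) 𝓘(ℝ, F) f ((chartAt (𝔼 m) p).symm y)
  · rw [← mfderiv_eq_fderiv,
      (hf.hasMFDerivAt.comp y (hasMFDerivAt_chartAt_symm m hy)).mfderiv]
    rfl
  · rw [mfderiv_zero_of_not_mdifferentiableAt hf, fderiv_zero_of_not_differentiableAt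
      (by rwa [← mdifferentiableAt_chartAt_symm_iff m hy])]
    rfl

theorem coordMap_eq_coordMap_fderiv {p q : X} {y : 𝔼 m} (hy : y ∈ (chartAt (𝔼 m) p).target)
    (hq : (chartAt (𝔼 m) p).symm y ∈ (chartAt (𝔼 m) q).source) (v : 𝔼 m) :
    coordMap m p ((chartAt (𝔼 m) p).symm y) v =
      coordMap m q ((chartAt (𝔼 m) p).symm y)
        (fderiv ℝ (chartAt (𝔼 m) q ∘ (chartAt (𝔼 m) p).symm) y v) := by
  rw [← mfderiv_coordMap m hy (chartAt (𝔼 m) q) v, (hasMFDerivAt_chartAt m hq).mfderiv]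
  exact (coordMap_coordMapInv m hq _).symm

end ChartCoordinates

section ChartChoice

variable {X : Type*} [TopologicalSpace X] [ChartedSpace (𝔼 m) X] [IsManifold (𝓡 m) ∞ X]
  [SecondCountableTopology X] [MeasurableSpace X] [BorelSpace X]

theorem mem_source_chartChoice (x : X) : x ∈ (chartAt (𝔼 m) (chartChoice m x)).source :=
  (exists_measurable_chart_choice m (X := X)).choose_spec.1 x

theorem measurable_of_chartChoice {β : Type*} [MeasurableSpace β] {f : X → β} {g : X → X → β}
    (hg : ∀ p, Measurable (g p)) (hfg : ∀ x, f x = g (chartChoice m x) x) : Measurable f := by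
  obtain ⟨-, hcountable, hmeas⟩ := (exists_measurable_chart_choice m (X := X)).choose_spec
  intro s hs
  have hpre : f ⁻¹' s = ⋃ p ∈ range (chartChoice m (X := X)),
      (chartChoice m (X := X) ⁻¹' {p}) ∩ (g p ⁻¹' s) := by
    ext x
    simp only [mem_preimage, hfg, mem_iUnion, mem_inter_iff, mem_singleton_iff, exists_prop]
    exact ⟨fun h => ⟨_, mem_range_self x, rfl, h⟩, fun ⟨_, _, hp, h⟩ => hp ▸ h⟩
  rw [hpre]
  exact MeasurableSet.biUnion hcountable fun p _ => (hmeas p).inter (hg p hs)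

end ChartChoice

section MeasurableFrame

variable {X : Type*} [TopologicalSpace X] [ChartedSpace (𝔼 m) X] [IsManifold (𝓡 m) ∞ X]

theorem continuousOn_mk_coordVec (p : X) (i : Fin m) :
    ContinuousOn (fun x => (⟨x, coordVec m p x i⟩ : TangentBundle (𝓡 m) X))
      (chartAt (𝔼 m) p).source := by
  set t := trivializationAt (𝔼 m) (TangentSpace (𝓡 m) : X → Type _) p
  have hsymm : ContinuousOn (fun x : X => t.toOpenPartialHomeomorph.symm
      (x, EuclideanSpace.single i (1 : ℝ))) (chartAt (𝔼 m) p).source := by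
    refine t.toOpenPartialHomeomorph.continuousOn_symm.comp (by fun_prop) fun x hx => ?_
    rw [t.target_eq]
    exact ⟨by simpa [t] using hx, trivial⟩
  refine hsymm.congr fun x hx => ?_
  have hx' : x ∈ t.baseSet := by simpa [t] using hx
  refine Eq.trans ?_ (t.mk_symm hx' (EuclideanSpace.single i (1 : ℝ)))
  rw [← t.symmL_apply (R := ℝ) hx']
  rfl

theorem measurable_differential_coordVec [MeasurableSpace X] [BorelSpace X] (φ : X → ℂ)
    (p : X) (i : Fin m) : Measurable fun x => differential m φ x (coordVec m p x i) := by
  classical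
  set e := chartAt (𝔼 m) p
  have he : Measurable (e.source.piecewise e fun _ => 0) :=
    e.continuousOn.measurable_piecewise continuousOn_const e.open_source.measurableSet
  have hd : Measurable fun x => fderiv ℝ (φ ∘ e.symm) (e.source.piecewise e (fun _ => 0) x)
      (EuclideanSpace.single i 1) := (measurable_fderiv_apply_const ℝ _ _).comp he
  refine (congrArg Measurable (funext fun x => ?_)).mp (hd.indicator e.open_source.measurableSet)
  by_cases hx : x ∈ e.source
  · have hderiv := mfderiv_coordMap m (e.map_source hx) φ (EuclideanSpace.single i 1)
    rw [e.left_inv hx] at hderiv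
    rw [indicator_of_mem hx, piecewise_eq_of_mem _ _ _ hx]
    exact hderiv.symm
  · rw [indicator_of_notMem hx, coordVec_of_notMem_source m hx]
    exact (map_zero _).symm

variable [RiemannianBundle (fun x : X => TangentSpace (𝓡 m) x)]

theorem metricMatrix_posDef {p x : X} (hx : x ∈ (chartAt (𝔼 m) p).source) :
    (metricMatrix m p x).PosDef :=
  Matrix.posDef_gram_of_linearIndependent (linearIndependent_coordVec m hx)

section ContinuousMetric

variable [IsContinuousRiemannianBundle (𝔼 m) (fun x : X => TangentSpace (𝓡 m) x)]

theorem continuousOn_inner_coordVec (p q : X) (i j : Fin m) :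
    ContinuousOn (fun x => inner ℝ (coordVec m p x i) (coordVec m q x j))
      ((chartAt (𝔼 m) p).source ∩ (chartAt (𝔼 m) q).source) :=
  ((continuousOn_mk_coordVec m p i).mono inter_subset_left).inner_bundle
    ((continuousOn_mk_coordVec m q j).mono inter_subset_right)

theorem continuousOn_metricMatrix (p : X) :
    ContinuousOn (metricMatrix m p) (chartAt (𝔼 m) p).source :=
  continuousOn_pi.2 fun i => continuousOn_pi.2 fun j =>
    (continuousOn_inner_coordVec m p p i j).mono (inter_self _).ge

theorem continuousOn_metricInChart (p : X) :
    ContinuousOn (metricInChart m p) (chartAt (𝔼 m) p).target :=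
  (continuousOn_metricMatrix m p).comp (chartAt (𝔼 m) p).continuousOn_symm
    (chartAt (𝔼 m) p).mapsTo_symm

theorem measurable_inner_coordVec [MeasurableSpace X] [BorelSpace X] (p q : X) (i j : Fin m) :
    Measurable fun x => inner ℝ (coordVec m p x i) (coordVec m q x j) := by
  classical
  convert (continuousOn_inner_coordVec m p q i j).measurable_piecewise
    (continuousOn_const (c := (0 : ℝ))) ((chartAt (𝔼 m) p).open_source.inter
      (chartAt (𝔼 m) q).open_source).measurableSet using 1
  ext x
  by_cases hp : x ∈ (chartAt (𝔼 m) p).source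
  · by_cases hq : x ∈ (chartAt (𝔼 m) q).source
    · simp [hp, hq]
    · simp [hq, coordVec_of_notMem_source m hq]
  · simp [hp, coordVec_of_notMem_source m hp]

end ContinuousMetric

variable [SecondCountableTopology X] [MeasurableSpace X] [BorelSpace X]

section ContinuousMetric

variable [IsContinuousRiemannianBundle (𝔼 m) (fun x : X => TangentSpace (𝓡 m) x)]

theorem exists_measurable_frame_coeff (i : Fin m) :
    ∃ a : X → Fin m → X → ℝ, (∀ p j, Measurable (a p j)) ∧
      ∀ x, frame m x i = ∑ j, a (chartChoice m x) j x • coordVec m (chartChoice m x) x j := by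
  choose a ha hav using fun p : X =>
    exists_measurable_gramSchmidtNormed_coeff (measurable_inner_coordVec m p p) i
  exact ⟨a, ha, fun x => hav _ x⟩

theorem measurable_inner_frame_coordVec (p : X) (i j : Fin m) :
    Measurable fun x => inner ℝ (frame m x i) (coordVec m p x j) := by
  obtain ⟨a, ha, haf⟩ := exists_measurable_frame_coeff m (X := X) i
  refine measurable_of_chartChoice m (g := fun q x => ∑ k, a q k x *
    inner ℝ (coordVec m q x k) (coordVec m p x j)) (fun q => ?_) fun x => ?_
  · exact Finset.measurable_sum _ fun k _ => (ha q k).mul (measurable_inner_coordVec m q p k j)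
  · simp only [haf, sum_inner, real_inner_smul_left]

theorem measurable_differentialComponents (φ : X → ℂ) :
    Measurable (differentialComponents m φ) := by
  refine (PiLp.continuous_toLp 2 fun _ : Fin m => ℂ).measurable.comp
    (measurable_pi_iff.2 fun i => ?_)
  obtain ⟨a, ha, haf⟩ := exists_measurable_frame_coeff m (X := X) i
  refine measurable_of_chartChoice m (g := fun q x => ∑ k, (a q k x : ℂ) *
    differential m φ x (coordVec m q x k)) (fun q => ?_) fun x => ?_
  · exact Finset.measurable_sum _ fun k _ =>
      (Complex.measurable_ofReal.comp (ha q k)).mul (measurable_differential_coordVec m φ q k)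
  · simp only [haf, map_sum]
    exact Finset.sum_congr rfl fun k _ => (map_smul _ _ _).trans Complex.real_smul

end ContinuousMetric

theorem orthonormal_frame (x : X) : Orthonormal ℝ (frame m x) :=
  InnerProductSpace.gramSchmidtNormed_orthonormal
    (linearIndependent_coordVec m (mem_source_chartChoice m x))

theorem span_range_frame (x : X) : Submodule.span ℝ (range (frame m x)) = ⊤ := by
  unfold frame
  rw [InnerProductSpace.span_gramSchmidtNormed_range, InnerProductSpace.span_gramSchmidt,
    span_range_coordVec m (mem_source_chartChoice m x)]

theorem sum_inner_smul_frame (x : X) (v : TangentSpace (𝓡 m) x) :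
    ∑ i, inner ℝ (frame m x i) v • frame m x i = v := by
  simpa using
    (OrthonormalBasis.mk (orthonormal_frame m x) (span_range_frame m x).ge).sum_repr' v

theorem apply_eq_sum_frame (x : X) (w : TangentSpace (𝓡 m) x →L[ℝ] ℂ)
    (v : TangentSpace (𝓡 m) x) :
    w v = ∑ i, (inner ℝ (frame m x i) v : ℂ) * covectorComponents m x w i := by
  conv_lhs => rw [← sum_inner_smul_frame m x v]
  simp [covectorComponents]

theorem norm_covectorComponents_le (x : X) (w : TangentSpace (𝓡 m) x →L[ℝ] ℂ) {K : ℝ}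
    (hK : 0 ≤ K) (hw : ∀ v, ‖w v‖ ≤ K * ‖v‖) : ‖covectorComponents m x w‖ ≤ √m * K := by
  have hcomp : ∀ i, ‖covectorComponents m x w i‖ ≤ K := fun i => by
    simpa [(orthonormal_frame m x).1 i, covectorComponents] using hw (frame m x i)
  rw [EuclideanSpace.norm_eq, ← Real.sqrt_sq hK, ← Real.sqrt_mul (Nat.cast_nonneg m)]
  refine Real.sqrt_le_sqrt ((Finset.sum_le_sum fun i _ =>
    pow_le_pow_left₀ (norm_nonneg _) (hcomp i) 2).trans_eq ?_)
  simp

end MeasurableFrame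

section RestrictWithDensity

theorem measurableSet_inter_preimage_of_continuousOn {α β : Type*} [TopologicalSpace α]
    [MeasurableSpace α] [OpensMeasurableSpace α] [TopologicalSpace β] [MeasurableSpace β]
    [BorelSpace β] {f : α → β} {s : Set α} (hf : ContinuousOn f s) (hs : MeasurableSet s)
    {A : Set β} (hA : MeasurableSet A) : MeasurableSet (s ∩ f ⁻¹' A) := by
  rw [← Subtype.image_preimage_coe]
  exact hs.subtype_image (hf.domRestrict.measurable hA)

theorem exists_restrict_le_smul_withDensity {α : Type*} [TopologicalSpace α] [T2Space α]
    [MeasurableSpace α] [OpensMeasurableSpace α] (μ : Measure α) {K : Set α} (hK : IsCompact K)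
    {ρ : α → ℝ} (hρ : ContinuousOn ρ K) (hpos : ∀ y ∈ K, 0 < ρ y) :
    ∃ c : ℝ≥0∞, c ≠ ⊤ ∧
      μ.restrict K ≤ c • (μ.restrict K).withDensity fun y => ENNReal.ofReal (ρ y) := by
  rcases K.eq_empty_or_nonempty with rfl | hne
  · exact ⟨1, by simp, by simp⟩
  obtain ⟨y₀, hy₀, hmin⟩ := hK.exists_isMinOn hne hρ
  have hy₀pos : ENNReal.ofReal (ρ y₀) ≠ 0 := by simpa using hpos y₀ hy₀
  have hle : ENNReal.ofReal (ρ y₀) • μ.restrict K ≤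
      (μ.restrict K).withDensity fun y => ENNReal.ofReal (ρ y) := by
    rw [← withDensity_const]
    refine withDensity_mono ?_
    filter_upwards [ae_restrict_mem hK.measurableSet] with y hy
    exact ENNReal.ofReal_le_ofReal (hmin hy)
  refine ⟨(ENNReal.ofReal (ρ y₀))⁻¹, ENNReal.inv_ne_top.2 hy₀pos, ?_⟩
  calc μ.restrict K = (ENNReal.ofReal (ρ y₀))⁻¹ • (ENNReal.ofReal (ρ y₀) • μ.restrict K) := by
        rw [smul_smul, ENNReal.inv_mul_cancel hy₀pos ENNReal.ofReal_ne_top, one_smul]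
    _ ≤ _ := by gcongr

end RestrictWithDensity

section RiemannianMeasure

variable {X : Type*} [TopologicalSpace X] [ChartedSpace (𝔼 m) X]

theorem measurableSet_source_inter_preimage [MeasurableSpace X] [BorelSpace X] (p : X)
    {K : Set (𝔼 m)} (hK : MeasurableSet K) :
    MeasurableSet ((chartAt (𝔼 m) p).source ∩ chartAt (𝔼 m) p ⁻¹' K) :=
  measurableSet_inter_preimage_of_continuousOn (chartAt (𝔼 m) p).continuousOn
    (chartAt (𝔼 m) p).open_source.measurableSet hK

theorem aemeasurable_chartAt_symm [MeasurableSpace X] [BorelSpace X] (p : X)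
    {K : Set (𝔼 m)} (hKt : K ⊆ (chartAt (𝔼 m) p).target) (ρ : 𝔼 m → ℝ≥0∞) :
    AEMeasurable (chartAt (𝔼 m) p).symm ((volume.restrict K).withDensity ρ) :=
  (((chartAt (𝔼 m) p).continuousOn_symm.aemeasurable
    (chartAt (𝔼 m) p).open_target.measurableSet).mono_measure
      (Measure.restrict_mono hKt le_rfl)).mono_ac (withDensity_absolutelyContinuous _ _)

variable [IsManifold (𝓡 m) ∞ X] [RiemannianBundle (fun x : X => TangentSpace (𝓡 m) x)]

/-- The density `√(det g_ij)` of the Riemannian measure in the chart centred at `p`, as a function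
of the coordinates. -/
def chartDensity (p : X) (y : 𝔼 m) : ℝ := √(metricInChart m p y).det

theorem chartDensity_pos {p : X} {y : 𝔼 m} (hy : y ∈ (chartAt (𝔼 m) p).target) :
    0 < chartDensity m p y :=
  Real.sqrt_pos.2 (metricMatrix_posDef m ((chartAt (𝔼 m) p).map_target hy)).det_pos

theorem metricInChart_eq_transpose_mul_mul {p q : X} {y : 𝔼 m}
    (hy : y ∈ (chartAt (𝔼 m) q).target)
    (hp : (chartAt (𝔼 m) q).symm y ∈ (chartAt (𝔼 m) p).source) {A : Matrix (Fin m) (Fin m) ℝ}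
    (hA : ∀ k i, A k i = fderiv ℝ (chartAt (𝔼 m) p ∘ (chartAt (𝔼 m) q).symm) y
      (EuclideanSpace.single i 1) k) :
    metricInChart m q y =
      A.transpose * metricInChart m p (chartAt (𝔼 m) p ((chartAt (𝔼 m) q).symm y)) * A := by
  have hcoord : ∀ i, coordVec m q ((chartAt (𝔼 m) q).symm y) i =
      ∑ k, A k i • coordVec m p ((chartAt (𝔼 m) q).symm y) k := fun i => by
    rw [← coordMap_single, coordMap_eq_coordMap_fderiv m hy hp, coordMap_eq_sum]
    simp only [hA]
  ext i j
  simp only [metricInChart, metricMatrix, hcoord, sum_inner, inner_sum, real_inner_smul_left,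
    real_inner_smul_right, Matrix.mul_apply, Matrix.transpose_apply, Matrix.of_apply,
    Finset.sum_mul]
  rw [(chartAt (𝔼 m) p).left_inv hp]
  exact Finset.sum_congr rfl fun k _ => Finset.sum_congr rfl fun l _ => by ring

theorem chartDensity_eq_abs_det_mul {p q : X} {y : 𝔼 m} (hy : y ∈ (chartAt (𝔼 m) q).target)
    (hp : (chartAt (𝔼 m) q).symm y ∈ (chartAt (𝔼 m) p).source) :
    chartDensity m q y = |(fderiv ℝ (chartAt (𝔼 m) p ∘ (chartAt (𝔼 m) q).symm) y).det| *
      chartDensity m p (chartAt (𝔼 m) p ((chartAt (𝔼 m) q).symm y)) := by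
  set D := fderiv ℝ (chartAt (𝔼 m) p ∘ (chartAt (𝔼 m) q).symm) y
  set b := (EuclideanSpace.basisFun (Fin m) ℝ).toBasis
  have hdet : (LinearMap.toMatrix b b D.toLinearMap).det = D.det := LinearMap.det_toMatrix _ _
  rw [chartDensity, metricInChart_eq_transpose_mul_mul m hy hp
    (A := LinearMap.toMatrix b b D.toLinearMap) fun k i => by simp [LinearMap.toMatrix_apply, b, D],
    Matrix.det_mul, Matrix.det_mul, Matrix.det_transpose, hdet, mul_right_comm, ← sq,
    Real.sqrt_mul (sq_nonneg _), Real.sqrt_sq_eq_abs, chartDensity]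

theorem continuousOn_chartDensity
    [IsContinuousRiemannianBundle (𝔼 m) (fun x : X => TangentSpace (𝓡 m) x)] (p : X) :
    ContinuousOn (chartDensity m p) (chartAt (𝔼 m) p).target :=
  Continuous.comp_continuousOn (g := fun M : Matrix (Fin m) (Fin m) ℝ => √M.det) (by fun_prop)
    (continuousOn_metricInChart m p)

variable [MeasurableSpace X] [BorelSpace X]

theorem chartVolume_restrict (p : X) {A : Set X} (hA : MeasurableSet A) :
    (chartVolume m p).restrict A =
      ((volume.restrict ((chartAt (𝔼 m) p).target ∩ (chartAt (𝔼 m) p).symm ⁻¹' A)).withDensity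
        fun y => ENNReal.ofReal (chartDensity m p y)).map (chartAt (𝔼 m) p).symm := by
  have h := Measure.restrict_map_of_aemeasurable (aemeasurable_chartAt_symm m p Subset.rfl
    fun y => ENNReal.ofReal (chartDensity m p y)) hA
  rw [restrict_withDensity', Measure.restrict_restrict'
    (chartAt (𝔼 m) p).open_target.measurableSet, inter_comm] at h
  exact h

theorem chartVolume_apply (p : X) {A : Set X} (hA : MeasurableSet A) :
    chartVolume m p A = ∫⁻ y in (chartAt (𝔼 m) p).target ∩ (chartAt (𝔼 m) p).symm ⁻¹' A,
      ENNReal.ofReal (chartDensity m p y) := by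
  have h := Measure.map_apply_of_aemeasurable (aemeasurable_chartAt_symm m p Subset.rfl
    fun y => ENNReal.ofReal (chartDensity m p y)) hA
  rw [withDensity_apply', Measure.restrict_restrict'
    (chartAt (𝔼 m) p).open_target.measurableSet, inter_comm] at h
  exact h

theorem chartVolume_eq_of_subset_source {p q : X} {A : Set X} (hA : MeasurableSet A)
    (hp : A ⊆ (chartAt (𝔼 m) p).source) (hq : A ⊆ (chartAt (𝔼 m) q).source) :
    chartVolume m p A = chartVolume m q A := by
  rw [chartVolume_apply m p hA, chartVolume_apply m q hA]
  set e := chartAt (𝔼 m) p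
  set e' := chartAt (𝔼 m) q
  have himage : e.target ∩ e.symm ⁻¹' A = (e ∘ e'.symm) '' (e'.target ∩ e'.symm ⁻¹' A) := by
    rw [← e.image_eq_target_inter_inv_preimage hp, ← e'.image_eq_target_inter_inv_preimage hq,
      image_comp]
    exact congrArg (e '' ·) (e'.toPartialEquiv.symm_image_image_of_subset_source hq).symm
  have hmeas : MeasurableSet (e'.target ∩ e'.symm ⁻¹' A) :=
    measurableSet_inter_preimage_of_continuousOn e'.continuousOn_symm e'.open_target.measurableSet
      hA
  have hderiv : ∀ y ∈ e'.target ∩ e'.symm ⁻¹' A, HasFDerivWithinAt (e ∘ e'.symm)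
      (fderiv ℝ (e ∘ e'.symm) y) (e'.target ∩ e'.symm ⁻¹' A) y := fun y hy =>
    ((mdifferentiableAt_chartAt_symm_iff m hy.1 e).1
      (hasMFDerivAt_chartAt m (hp hy.2)).mdifferentiableAt).hasFDerivAt.hasFDerivWithinAt
  have hinj : InjOn (e ∘ e'.symm) (e'.target ∩ e'.symm ⁻¹' A) := fun y hy z hz hyz =>
    e'.symm.injOn hy.1 hz.1 (e.injOn (hp hy.2) (hp hz.2) hyz)
  rw [himage, lintegral_image_eq_lintegral_abs_det_fderiv_mul volume hmeas hderiv hinj]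
  refine setLIntegral_congr_fun hmeas fun y hy => ?_
  rw [chartDensity_eq_abs_det_mul m hy.1 (hp hy.2), ENNReal.ofReal_mul (abs_nonneg _)]
  rfl

theorem chartVolume_compl_source (p : X) : chartVolume m p (chartAt (𝔼 m) p).sourceᶜ = 0 := by
  rw [chartVolume_apply m p (chartAt (𝔼 m) p).open_source.measurableSet.compl, preimage_compl,
    ← sdiff_eq, sdiff_eq_empty.2 (show (chartAt (𝔼 m) p).target ⊆
      (chartAt (𝔼 m) p).symm ⁻¹' (chartAt (𝔼 m) p).source from (chartAt (𝔼 m) p).mapsTo_symm)]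
  simp

theorem chartVolume_restrict_source_le (p q : X) :
    (chartVolume m q).restrict (chartAt (𝔼 m) p).source ≤ chartVolume m p := by
  set e := chartAt (𝔼 m) p
  set e' := chartAt (𝔼 m) q
  refine Measure.le_iff.2 fun A hA => ?_
  rw [Measure.restrict_apply hA]
  calc chartVolume m q (A ∩ e.source)
      = chartVolume m q (A ∩ e.source ∩ e'.source) :=
        (measure_inter_conull (chartVolume_compl_source m q)).symm
    _ = chartVolume m p (A ∩ e.source ∩ e'.source) :=
        chartVolume_eq_of_subset_source m ((hA.inter e.open_source.measurableSet).inter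
          e'.open_source.measurableSet) inter_subset_right fun x hx => hx.1.2
    _ ≤ chartVolume m p A := measure_mono fun x hx => hx.1.1

theorem riemannianVolume_restrict_source (p : X) :
    (riemannianVolume m).restrict (chartAt (𝔼 m) p).source = chartVolume m p := by
  set e := chartAt (𝔼 m) p
  have hs := e.open_source.measurableSet
  apply le_antisymm
  · have hle : riemannianVolume m (X := X) ≤
        chartVolume m p + (riemannianVolume m).restrict e.sourceᶜ := by
      refine iSup_le fun q => ?_
      rw [← Measure.restrict_add_restrict_compl (μ := chartVolume m q) hs]
      exact add_le_add (chartVolume_restrict_source_le m p q)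
        (Measure.restrict_mono le_rfl (le_iSup (chartVolume m) q))
    refine (Measure.restrict_mono le_rfl hle).trans ?_
    rw [Measure.restrict_add, Measure.restrict_restrict hs, inter_compl_self,
      Measure.restrict_empty, add_zero]
    exact Measure.restrict_le_self
  · rw [← Measure.restrict_eq_self_of_ae_mem (μ := chartVolume m p) (s := e.source)
      (chartVolume_compl_source m p)]
    exact Measure.restrict_mono le_rfl (le_iSup (chartVolume m) p)

theorem riemannianVolume_restrict_preimage (p : X) {K : Set (𝔼 m)} (hK : MeasurableSet K)
    (hKt : K ⊆ (chartAt (𝔼 m) p).target) :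
    (riemannianVolume m).restrict ((chartAt (𝔼 m) p).source ∩ chartAt (𝔼 m) p ⁻¹' K) =
      ((volume.restrict K).withDensity fun y => ENNReal.ofReal (chartDensity m p y)).map
        (chartAt (𝔼 m) p).symm := by
  set e := chartAt (𝔼 m) p
  have hA : MeasurableSet (e.source ∩ e ⁻¹' K) := measurableSet_source_inter_preimage m p hK
  have hset : e.target ∩ e.symm ⁻¹' (e.source ∩ e ⁻¹' K) = K := by
    rw [← e.image_source_inter_eq, e.image_source_inter_eq', e.target_inter_inv_preimage_preimage,
      inter_eq_right.2 hKt]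
  have h := chartVolume_restrict m p hA
  rw [hset, ← riemannianVolume_restrict_source, Measure.restrict_restrict hA,
    inter_eq_left.2 inter_subset_left] at h
  exact h

theorem ae_restrict_source_of_chart (p : X) {P : X → Prop}
    (h : ∀ᵐ y ∂volume.restrict (chartAt (𝔼 m) p).target, P ((chartAt (𝔼 m) p).symm y)) :
    ∀ᵐ x ∂(riemannianVolume m).restrict (chartAt (𝔼 m) p).source, P x := by
  set e := chartAt (𝔼 m) p
  have hsource := e.open_source.measurableSet
  have hmap : ((riemannianVolume m).restrict e.source).map e ≪ volume.restrict e.target := by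
    refine Measure.AbsolutelyContinuous.mk fun N hN hN0 => ?_
    rw [Measure.map_apply_of_aemeasurable (e.continuousOn.aemeasurable hsource) hN,
      Measure.restrict_apply' hsource, inter_comm,
      ← inter_eq_left.2 (inter_subset_left (s := e.source) (t := e ⁻¹' N)),
      ← Measure.restrict_apply (measurableSet_source_inter_preimage m p hN),
      riemannianVolume_restrict_source,
      chartVolume_apply m p (measurableSet_source_inter_preimage m p hN),
      ← e.image_source_inter_eq, e.image_source_inter_eq', e.target_inter_inv_preimage_preimage]
    refine setLIntegral_measure_zero _ _ ?_
    rwa [inter_comm, ← Measure.restrict_apply hN]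
  filter_upwards [ae_of_ae_map (e.continuousOn.aemeasurable hsource) (hmap.ae_le h),
    ae_restrict_mem hsource] with x hx hxs
  rwa [e.left_inv hxs] at hx

theorem ae_riemannianVolume_of_chart [SecondCountableTopology X] {P : X → Prop}
    (h : ∀ p : X, ∀ᵐ y ∂volume.restrict (chartAt (𝔼 m) p).target,
      P ((chartAt (𝔼 m) p).symm y)) :
    ∀ᵐ x ∂riemannianVolume m, P x := by
  obtain ⟨s, hs, hsU⟩ := TopologicalSpace.countable_cover_nhds
    (fun x : X => chart_source_mem_nhds (𝔼 m) x)
  rw [← Measure.restrict_univ (μ := riemannianVolume m), ← hsU, ae_restrict_biUnion_iff _ hs]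
  exact fun p _ => ae_restrict_source_of_chart m p (h p)

variable [IsContinuousRiemannianBundle (𝔼 m) (fun x : X => TangentSpace (𝓡 m) x)]

theorem isLocallyFiniteMeasure_riemannianVolume :
    IsLocallyFiniteMeasure (riemannianVolume m (X := X)) := by
  refine ⟨fun p => ?_⟩
  set e := chartAt (𝔼 m) p
  obtain ⟨K, hK, hKt, hKc⟩ :=
    local_compact_nhds (e.open_target.mem_nhds (mem_chart_target (𝔼 m) p))
  refine ⟨e.source ∩ e ⁻¹' K, inter_mem (chart_source_mem_nhds _ p)
    ((e.continuousAt (mem_chart_source _ p)).preimage_mem_nhds hK), ?_⟩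
  obtain ⟨C, hC⟩ := hKc.bddAbove_image ((continuousOn_chartDensity m p).mono hKt)
  rw [← Measure.restrict_apply_univ, riemannianVolume_restrict_preimage m p hKc.measurableSet hKt,
    Measure.map_apply_of_aemeasurable (aemeasurable_chartAt_symm m p hKt _) .univ,
    preimage_univ, withDensity_apply _ .univ, Measure.restrict_univ]
  calc ∫⁻ y in K, ENNReal.ofReal (chartDensity m p y)
      ≤ ∫⁻ _ in K, ENNReal.ofReal C := setLIntegral_mono measurable_const fun _ hy =>
        ENNReal.ofReal_le_ofReal (hC (mem_image_of_mem _ hy))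
    _ < ⊤ := by
        rw [setLIntegral_const]
        exact ENNReal.mul_lt_top ENNReal.ofReal_lt_top hKc.measure_lt_top

theorem ae_chart_of_ae_restrict (p : X) {P : X → Prop} {U : Set X} (hU : MeasurableSet U)
    (h : ∀ᵐ x ∂(riemannianVolume m).restrict U, P x) :
    ∀ᵐ y ∂volume.restrict ((chartAt (𝔼 m) p).target ∩ (chartAt (𝔼 m) p).symm ⁻¹' U),
      P ((chartAt (𝔼 m) p).symm y) := by
  set e := chartAt (𝔼 m) p
  have hV : MeasurableSet (e.target ∩ e.symm ⁻¹' U) :=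
    measurableSet_inter_preimage_of_continuousOn e.continuousOn_symm e.open_target.measurableSet hU
  have hρ : AEMeasurable (fun y => ENNReal.ofReal (chartDensity m p y))
      (volume.restrict (e.target ∩ e.symm ⁻¹' U)) :=
    (((continuousOn_chartDensity m p).mono inter_subset_left).aemeasurable hV).ennreal_ofReal
  have hle : (chartVolume m p).restrict U ≤ (riemannianVolume m).restrict U :=
    Measure.restrict_mono le_rfl (le_iSup (chartVolume m) p)
  have hchart := ae_mono hle h
  rw [chartVolume_restrict m p hU] at hchart
  have hae := aemeasurable_chartAt_symm m p (inter_subset_left (t := e.symm ⁻¹' U))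
    fun y => ENNReal.ofReal (chartDensity m p y)
  filter_upwards [(ae_withDensity_iff' hρ).1 (ae_of_ae_map hae hchart), ae_restrict_mem hV]
    with y hy hyV
  exact hy (by simpa using chartDensity_pos m hyV.1)

end RiemannianMeasure

section LipschitzInCharts

theorem ae_differentiableAt_of_locallyLipschitzOn {E F : Type*} [NormedAddCommGroup E]
    [NormedSpace ℝ E] [FiniteDimensional ℝ E] [MeasurableSpace E] [BorelSpace E]
    [NormedAddCommGroup F] [NormedSpace ℝ F] [FiniteDimensional ℝ F] (μ : Measure E)
    [μ.IsAddHaarMeasure] {f : E → F} {s : Set E} (hs : IsOpen s) (hf : LocallyLipschitzOn s f) :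
    ∀ᵐ y ∂μ.restrict s, DifferentiableAt ℝ f y := by
  have hlocal : ∀ y ∈ s, ∃ t ∈ 𝓝[s] y, ∀ᵐ z ∂μ.restrict t, DifferentiableAt ℝ f z := by
    intro y hy
    obtain ⟨K, t, ht, hK⟩ := hf hy
    rw [hs.nhdsWithin_eq hy] at ht ⊢
    obtain ⟨u, hut, huo, hyu⟩ := mem_nhds_iff.1 ht
    refine ⟨u, huo.mem_nhds hyu, ?_⟩
    rw [ae_restrict_iff' huo.measurableSet]
    filter_upwards [(hK.mono hut).ae_differentiableWithinAt_of_mem (μ := μ)] with z hz hzu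
    exact (hz hzu).differentiableAt (huo.mem_nhds hzu)
  choose! t ht hae using hlocal
  obtain ⟨c, hcs, hc, hcover⟩ := TopologicalSpace.countable_cover_nhdsWithin ht
  exact ae_restrict_of_ae_restrict_of_subset hcover
    ((ae_restrict_biUnion_iff t hc _).2 fun y hy => hae y (hcs hy))

theorem differential_apply_eq_fderiv {X : Type*} [TopologicalSpace X] [ChartedSpace (𝔼 m) X]
    [IsManifold (𝓡 m) ∞ X] {p x : X} (hx : x ∈ (chartAt (𝔼 m) p).source) (f : X → ℂ)
    (v : TangentSpace (𝓡 m) x) :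
    differential m f x v =
      fderiv ℝ (f ∘ (chartAt (𝔼 m) p).symm) (chartAt (𝔼 m) p x) (coordMapInv m p x v) := by
  have h := mfderiv_coordMap m ((chartAt (𝔼 m) p).map_source hx) f (coordMapInv m p x v)
  rwa [(chartAt (𝔼 m) p).left_inv hx, coordMap_coordMapInv m hx] at h

/-- A function on a manifold which is locally Lipschitz in the coordinates of every preferred
chart. Such functions have a differential almost everywhere, and no metric on the manifold is
needed. -/
def LocallyLipschitzInCharts {X F : Type*} [TopologicalSpace X] [ChartedSpace (𝔼 m) X]
    [PseudoEMetricSpace F] (f : X → F) : Prop :=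
  ∀ p : X, LocallyLipschitzOn (chartAt (𝔼 m) p).target (f ∘ (chartAt (𝔼 m) p).symm)

section LocallyLipschitzInCharts

variable {m} {X : Type*} [TopologicalSpace X] [ChartedSpace (𝔼 m) X]

theorem LocallyLipschitzInCharts.mul {A : Type*} [NormedRing A] [NormedAlgebra ℝ A] {f g : X → A}
    (hf : LocallyLipschitzInCharts m f) (hg : LocallyLipschitzInCharts m g) :
    LocallyLipschitzInCharts m (f * g) := fun p =>
  locallyLipschitzOn_iff_restrict.2
    ((contDiff_mul (𝕜 := ℝ)).locallyLipschitz.comp ((hf p).restrict.prodMk (hg p).restrict))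

variable {F : Type*} [NormedAddCommGroup F] [NormedSpace ℝ F] [IsManifold (𝓡 m) ∞ X] {f : X → F}

theorem LocallyLipschitzInCharts.of_contMDiff (hf : ContMDiff (𝓡 m) 𝓘(ℝ, F) 1 f) :
    LocallyLipschitzInCharts m f := fun p y hy => by
  have hsmooth : ContDiffOn ℝ 1 (f ∘ (chartAt (𝔼 m) p).symm) (chartAt (𝔼 m) p).target :=
    (hf.comp_contMDiffOn (contMDiffOn_chart_symm (I := 𝓡 m) (x := p))).contDiffOn
  obtain ⟨K, t, ht, hK⟩ :=
    (hsmooth.contDiffAt ((chartAt (𝔼 m) p).open_target.mem_nhds hy)).exists_lipschitzOnWith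
  exact ⟨K, t, mem_nhdsWithin_of_mem_nhds ht, hK⟩

theorem LocallyLipschitzInCharts.ae_mdifferentiableAt
    [RiemannianBundle (fun x : X => TangentSpace (𝓡 m) x)] [FiniteDimensional ℝ F]
    [SecondCountableTopology X] [MeasurableSpace X] [BorelSpace X]
    (hf : LocallyLipschitzInCharts m f) :
    ∀ᵐ x ∂riemannianVolume m, MDifferentiableAt (𝓡 m) 𝓘(ℝ, F) f x := by
  refine ae_riemannianVolume_of_chart m fun p => ?_
  have htarget := (chartAt (𝔼 m) p).open_target
  filter_upwards [ae_differentiableAt_of_locallyLipschitzOn volume htarget (hf p),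
    ae_restrict_mem htarget.measurableSet] with y hy hyt
  exact (mdifferentiableAt_chartAt_symm_iff m hyt f).2 hy

end LocallyLipschitzInCharts

section CoordMap

variable {X : Type*} [TopologicalSpace X] [ChartedSpace (𝔼 m) X]
  [IsManifold (𝓡 m) ∞ X] [RiemannianBundle (fun x : X => TangentSpace (𝓡 m) x)]
  [IsContinuousRiemannianBundle (𝔼 m) (fun x : X => TangentSpace (𝓡 m) x)]

theorem continuousOn_norm_coordMap (p : X) (v : 𝔼 m) :
    ContinuousOn (fun x => ‖coordMap m p x v‖) (chartAt (𝔼 m) p).source := by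
  simp only [norm_eq_sqrt_real_inner, coordMap_eq_sum, sum_inner, inner_sum, real_inner_smul_left,
    real_inner_smul_right]
  exact (continuousOn_finsetSum _ fun i _ => continuousOn_finsetSum _ fun j _ =>
    continuousOn_const.mul (continuousOn_const.mul
      ((continuousOn_inner_coordVec m p p _ _).mono (inter_self _).ge))).sqrt

theorem continuousOn_norm_coordMap_chartAt_symm (p : X) (v : 𝔼 m) :
    ContinuousOn (fun y => ‖coordMap m p ((chartAt (𝔼 m) p).symm y) v‖)
      (chartAt (𝔼 m) p).target :=
  (continuousOn_norm_coordMap m p v).comp (chartAt (𝔼 m) p).continuousOn_symm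
    (chartAt (𝔼 m) p).mapsTo_symm

theorem exists_eventually_norm_coordMap_le {p : X} {y : 𝔼 m}
    (hy : y ∈ (chartAt (𝔼 m) p).target) :
    ∃ L : ℝ≥0, ∀ᶠ z in 𝓝 y, ∀ v, ‖coordMap m p ((chartAt (𝔼 m) p).symm z) v‖ ≤ L * ‖v‖ := by
  set e := chartAt (𝔼 m) p
  have hcont : ContinuousAt (fun z => ∑ i, ‖coordVec m p (e.symm z) i‖) y :=
    (continuousOn_finsetSum _ fun i _ => continuousOn_norm_coordMap_chartAt_symm m p
      (EuclideanSpace.single i 1)).continuousAt (e.open_target.mem_nhds hy)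
  refine ⟨Real.toNNReal (∑ i, ‖coordVec m p (e.symm y) i‖ + 1), ?_⟩
  filter_upwards [hcont.eventually (gt_mem_nhds (lt_add_one _))] with z hz v
  calc ‖coordMap m p (e.symm z) v‖ ≤ ∑ i, ‖v i • coordVec m p (e.symm z) i‖ := by
        rw [coordMap_eq_sum]
        exact norm_sum_le _ _
    _ ≤ ∑ i, ‖coordVec m p (e.symm z) i‖ * ‖v‖ := by
        gcongr with i
        rw [norm_smul, mul_comm]
        gcongr
        exact PiLp.norm_apply_le v i
    _ ≤ _ := by
        rw [← Finset.sum_mul]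
        gcongr
        exact hz.le.trans (Real.le_coe_toNNReal _)

end CoordMap

variable {X : Type*} [PseudoEMetricSpace X] [ChartedSpace (𝔼 m) X]
  [IsManifold (𝓡 m) ∞ X] [RiemannianBundle (fun x : X => TangentSpace (𝓡 m) x)]
  [IsRiemannianManifold (𝓡 m) X]

theorem edist_chartAt_symm_le {p : X} {y z : 𝔼 m} {L : ℝ≥0}
    (h : segment ℝ y z ⊆ (chartAt (𝔼 m) p).target)
    (hL : ∀ w ∈ segment ℝ y z, ‖coordMap m p ((chartAt (𝔼 m) p).symm w) (z - y)‖ ≤ L) :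
    edist ((chartAt (𝔼 m) p).symm y) ((chartAt (𝔼 m) p).symm z) ≤ L := by
  set e := chartAt (𝔼 m) p
  let γ : ℝ → 𝔼 m := AffineMap.lineMap y z
  have hγ : MapsTo γ (Icc 0 1) (segment ℝ y z) := fun t ht =>
    segment_eq_image_lineMap ℝ y z ▸ mem_image_of_mem _ ht
  have hsmooth : ContMDiffOn 𝓘(ℝ, ℝ) (𝓡 m) 1 (e.symm ∘ γ) (Icc 0 1) :=
    (contMDiffOn_chart_symm (I := 𝓡 m) (n := 1)).comp
      (AffineMap.contDiff_lineMap y z).contMDiff.contMDiffOn fun t ht => h (hγ ht)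
  rw [IsRiemannianManifold.out (I := 𝓡 m)]
  refine (Manifold.riemannianEDist_le_pathELength hsmooth (by simp [γ]) (by simp [γ])
    zero_le_one).trans ?_
  rw [Manifold.pathELength_eq_lintegral_mfderiv_Icc]
  calc _ ≤ ∫⁻ _ in Icc (0 : ℝ) 1, (L : ℝ≥0∞) := by
        refine setLIntegral_mono measurable_const fun t ht => ?_
        have hderiv := (hasMFDerivAt_chartAt_symm m (h (hγ ht))).comp t
          (AffineMap.hasDerivAt_lineMap (a := y) (b := z)).hasFDerivAt.hasMFDerivAt
        have hone : mfderiv 𝓘(ℝ, ℝ) (𝓡 m) (e.symm ∘ γ) t (1 : ℝ) =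
            coordMap m p (e.symm (γ t)) (z - y) := by
          rw [hderiv.mfderiv]
          exact congrArg (coordMap m p (e.symm (γ t))) (one_smul ℝ (z - y))
        exact (congrArg enorm hone).trans_le (enorm_le_coe.2 (hL _ (hγ ht)))
    _ = L := by simp

variable [IsContinuousRiemannianBundle (𝔼 m) (fun x : X => TangentSpace (𝓡 m) x)]

theorem locallyLipschitzOn_chartAt_symm (p : X) :
    LocallyLipschitzOn (chartAt (𝔼 m) p).target (chartAt (𝔼 m) p).symm := by
  intro y hy
  set e := chartAt (𝔼 m) p
  obtain ⟨L, hL⟩ := exists_eventually_norm_coordMap_le m hy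
  obtain ⟨r, hr, hball⟩ := Metric.mem_nhds_iff.1 (inter_mem hL (e.open_target.mem_nhds hy))
  refine ⟨L, Metric.ball y r, mem_nhdsWithin_of_mem_nhds (Metric.ball_mem_nhds y hr), ?_⟩
  intro z hz z' hz'
  have hsegment := (convex_ball y r).segment_subset hz hz'
  refine (edist_chartAt_symm_le m (L := L * ‖z' - z‖₊) (fun w hw => (hball (hsegment hw)).2)
    fun w hw => ?_).trans_eq ?_
  · simpa using (hball (hsegment hw)).1 (z' - z)
  · rw [edist_comm z z', edist_eq_enorm_sub, ENNReal.coe_mul, enorm_eq_nnnorm]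

theorem eventually_edist_chartAt_symm_le {p : X} {y : 𝔼 m} (hy : y ∈ (chartAt (𝔼 m) p).target)
    {v : 𝔼 m} {L : ℝ≥0} (hL : ‖coordMap m p ((chartAt (𝔼 m) p).symm y) v‖ < L) :
    ∀ᶠ t : ℝ in 𝓝 0, edist ((chartAt (𝔼 m) p).symm y) ((chartAt (𝔼 m) p).symm (y + t • v)) ≤
      ‖t‖₊ * L := by
  set e := chartAt (𝔼 m) p
  have hcont := (continuousOn_norm_coordMap_chartAt_symm m p v).continuousAt
    (e.open_target.mem_nhds hy)
  obtain ⟨r, hr, hball⟩ := Metric.mem_nhds_iff.1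
    (inter_mem (hcont.eventually (gt_mem_nhds hL)) (e.open_target.mem_nhds hy))
  have hline : ∀ᶠ t : ℝ in 𝓝 0, y + t • v ∈ Metric.ball y r :=
    (by fun_prop : ContinuousAt (fun t : ℝ => y + t • v) 0).eventually_mem
      (by simpa using Metric.ball_mem_nhds y hr)
  filter_upwards [hline] with t ht
  have hsegment := (convex_ball y r).segment_subset (Metric.mem_ball_self hr) ht
  rw [← ENNReal.coe_mul]
  refine edist_chartAt_symm_le m (fun w hw => (hball (hsegment hw)).2) fun w hw => ?_
  rw [add_sub_cancel_left, map_smul, norm_smul, NNReal.coe_mul, coe_nnnorm]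
  exact mul_le_mul_of_nonneg_left (hball (hsegment hw)).1.le (norm_nonneg _)

theorem locallyLipschitzInCharts_of_lipschitzWith {F : Type*} [PseudoEMetricSpace F] {f : X → F}
    {K : ℝ≥0} (hf : LipschitzWith K f) : LocallyLipschitzInCharts m f := fun p _ hy => by
  obtain ⟨L, t, ht, hL⟩ := locallyLipschitzOn_chartAt_symm m p hy
  exact ⟨K * L, t, ht, hf.comp_lipschitzOnWith hL⟩

theorem norm_fderiv_comp_chartAt_symm_le {F : Type*} [NormedAddCommGroup F] [NormedSpace ℝ F]
    {f : X → F} {K : ℝ≥0} (hf : LipschitzWith K f) {p : X} {y : 𝔼 m}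
    (hy : y ∈ (chartAt (𝔼 m) p).target) (v : 𝔼 m) :
    ‖fderiv ℝ (f ∘ (chartAt (𝔼 m) p).symm) y v‖ ≤
      K * ‖coordMap m p ((chartAt (𝔼 m) p).symm y) v‖ := by
  set e := chartAt (𝔼 m) p
  by_cases hd : DifferentiableAt ℝ (f ∘ e.symm) y
  swap
  · rw [fderiv_zero_of_not_differentiableAt hd, zero_apply, norm_zero]
    positivity
  have hlt : ∀ L > ‖coordMap m p (e.symm y) v‖, ‖fderiv ℝ (f ∘ e.symm) y v‖ ≤ K * L := by
    intro L hL
    lift L to ℝ≥0 using (norm_nonneg _).trans hL.le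
    have hline : HasDerivAt (fun t : ℝ => y + t • v) v 0 := by
      simpa using ((hasDerivAt_id (0 : ℝ)).smul_const v).const_add y
    have hderiv : HasDerivAt (fun t : ℝ => (f ∘ e.symm) (y + t • v))
        (fderiv ℝ (f ∘ e.symm) y v) 0 :=
      HasFDerivAt.comp_hasDerivAt (0 : ℝ) (by simpa using hd.hasFDerivAt) hline
    refine hderiv.le_of_lip' (by positivity) ?_
    filter_upwards [eventually_edist_chartAt_symm_le m hy hL] with t ht
    have hft := (hf (e.symm y) (e.symm (y + t • v))).trans (mul_le_mul_right ht (K : ℝ≥0∞))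
    rw [edist_comm, edist_eq_enorm_sub, ← ENNReal.coe_mul, ← ENNReal.coe_mul, enorm_le_coe,
      ← NNReal.coe_le_coe] at hft
    simpa [mul_assoc, mul_comm, mul_left_comm] using hft
  exact ge_of_tendsto ((tendsto_id.const_mul (K : ℝ)).mono_left
    (nhdsWithin_le_nhds (s := Ioi ‖coordMap m p (e.symm y) v‖)))
    (eventually_mem_nhdsWithin.mono hlt)

theorem norm_differential_le_of_lipschitzWith {f : X → ℂ} {K : ℝ≥0} (hf : LipschitzWith K f)
    (x : X) (v : TangentSpace (𝓡 m) x) : ‖differential m f x v‖ ≤ K * ‖v‖ := by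
  have hx := mem_chart_source (𝔼 m) x
  have h := norm_fderiv_comp_chartAt_symm_le m hf (mem_chart_target (𝔼 m) x) (coordMapInv m x x v)
  rwa [(chartAt (𝔼 m) x).left_inv hx, coordMap_coordMapInv m hx,
    ← differential_apply_eq_fderiv m hx] at h

theorem norm_differentialComponents_le_of_lipschitzWith [SecondCountableTopology X]
    [MeasurableSpace X] [BorelSpace X] {f : X → ℂ} {K : ℝ≥0} (hf : LipschitzWith K f) (x : X) :
    ‖differentialComponents m f x‖ ≤ √m * K :=
  norm_covectorComponents_le m x _ K.2 (norm_differential_le_of_lipschitzWith m hf x)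

end LipschitzInCharts

section DominatedConvergence

variable {α G : Type*} [MeasurableSpace α] {μ : Measure α} [NormedAddCommGroup G] {p : ℝ≥0∞}
  {f : ℕ → α → G} {g : α → G} {b : α → ℝ}

theorem ae_norm_le_of_tendsto (hbound : ∀ n, ∀ᵐ x ∂μ, ‖f n x‖ ≤ b x)
    (hlim : ∀ᵐ x ∂μ, Tendsto (fun n => f n x) atTop (𝓝 (g x))) : ∀ᵐ x ∂μ, ‖g x‖ ≤ b x := by
  filter_upwards [hlim, ae_all_iff.2 hbound] with x hx hbx
  exact le_of_tendsto hx.norm (.of_forall hbx)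

theorem memLp_of_tendsto_of_dominated (hb : MemLp b p μ) (hf : ∀ n, AEStronglyMeasurable (f n) μ)
    (hbound : ∀ n, ∀ᵐ x ∂μ, ‖f n x‖ ≤ b x)
    (hlim : ∀ᵐ x ∂μ, Tendsto (fun n => f n x) atTop (𝓝 (g x))) : MemLp g p μ :=
  hb.of_le (aestronglyMeasurable_of_tendsto_ae _ hf hlim)
    ((ae_norm_le_of_tendsto hbound hlim).mono fun _ hx => hx.trans (le_abs_self _))

theorem tendsto_eLpNorm_sub_of_dominated (hp : p ≠ 0) (hp_top : p ≠ ⊤) (hb : MemLp b p μ)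
    (hf : ∀ n, AEStronglyMeasurable (f n) μ) (hbound : ∀ n, ∀ᵐ x ∂μ, ‖f n x‖ ≤ b x)
    (hlim : ∀ᵐ x ∂μ, Tendsto (fun n => f n x) atTop (𝓝 (g x))) :
    Tendsto (fun n => eLpNorm (f n - g) p μ) atTop (𝓝 0) := by
  have hp_pos : 0 < p.toReal := ENNReal.toReal_pos hp hp_top
  have hg : AEStronglyMeasurable g μ := aestronglyMeasurable_of_tendsto_ae _ hf hlim
  have hlintegral : Tendsto (fun n => ∫⁻ x, ‖(f n - g) x‖ₑ ^ p.toReal ∂μ) atTop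
      (𝓝 (∫⁻ _, 0 ∂μ)) := by
    refine tendsto_lintegral_of_dominated_convergence' (fun x => ‖(2 : ℝ) * b x‖ₑ ^ p.toReal)
      (fun n => ((hf n).sub hg).enorm.pow_const _) (fun n => ?_)
      ((eLpNorm_lt_top_iff_lintegral_rpow_enorm_lt_top hp hp_top).1 (hb.const_mul 2).2).ne ?_
    · filter_upwards [hbound n, ae_norm_le_of_tendsto hbound hlim] with x hfx hgx
      refine ENNReal.rpow_le_rpow (enorm_le_iff_norm_le.2 ?_) hp_pos.le
      calc ‖f n x - g x‖ ≤ 2 * b x := (norm_sub_le _ _).trans (by linarith)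
        _ ≤ ‖2 * b x‖ := le_abs_self _
    · filter_upwards [hlim] with x hx
      simpa [ENNReal.zero_rpow_of_pos hp_pos, Function.comp_def] using
        ((ENNReal.continuous_rpow_const (y := p.toReal)).tendsto _).comp
          (tendsto_sub_nhds_zero_iff.2 hx).enorm
  rw [lintegral_zero] at hlintegral
  simp only [eLpNorm_eq_lintegral_rpow_enorm_toReal hp hp_top]
  simpa [ENNReal.zero_rpow_of_pos (inv_pos.2 hp_pos), Function.comp_def] using
    ((ENNReal.continuous_rpow_const (y := 1 / p.toReal)).tendsto _).comp hlintegral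

end DominatedConvergence

section EuclideanApproximation

theorem exists_lipschitzWith_of_hasCompactSupport {α G : Type*} [PseudoMetricSpace α]
    [ProperSpace α] [NormedAddCommGroup G] {g : α → G} (hg : LocallyLipschitz g)
    (hc : HasCompactSupport g) : ∃ L, LipschitzWith L g := by
  obtain ⟨C, hC⟩ := (hg.locallyLipschitzOn (s := Metric.cthickening 1 (tsupport g))
    ).exists_lipschitzOnWith_of_compact hc.cthickening
  obtain ⟨M, hM⟩ := hc.exists_bound_of_continuous hg.continuous
  have hsupport : ∀ x y, x ∈ tsupport g → ‖g x - g y‖ ≤ max C (Real.toNNReal M) * dist x y := by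
    intro x y hx
    by_cases hy : y ∈ Metric.cthickening 1 (tsupport g)
    · have hxy := hC.dist_le_mul x (Metric.self_subset_cthickening _ hx) y hy
      rw [dist_eq_norm] at hxy
      exact hxy.trans (by gcongr; exact le_max_left _ _)
    · have hdist : 1 ≤ dist x y := by
        by_contra! h
        exact hy (Metric.mem_cthickening_of_dist_le y x 1 _ hx (dist_comm x y ▸ h.le))
      have hgy : g y = 0 := image_eq_zero_of_notMem_tsupport fun h =>
        hy (Metric.self_subset_cthickening _ h)
      calc ‖g x - g y‖ = ‖g x‖ := by rw [hgy, sub_zero]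
        _ ≤ M := hM x
        _ ≤ max C (Real.toNNReal M) := (Real.le_coe_toNNReal M).trans (le_max_right _ _)
        _ ≤ max C (Real.toNNReal M) * dist x y := le_mul_of_one_le_right (by positivity) hdist
  refine ⟨max C (Real.toNNReal M), LipschitzWith.of_dist_le_mul fun x y => ?_⟩
  rw [dist_eq_norm]
  by_cases hx : x ∈ tsupport g
  · exact hsupport x y hx
  by_cases hy : y ∈ tsupport g
  · rw [norm_sub_rev, dist_comm]
    exact hsupport y x hy
  · rw [image_eq_zero_of_notMem_tsupport hx, image_eq_zero_of_notMem_tsupport hy, sub_zero,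
      norm_zero]
    positivity

open scoped Convolution

open ContinuousLinearMap (lsmul)

variable {E : Type*} [NormedAddCommGroup E] {r : ℝ}

theorem exists_seq_contDiffBump (hr : 0 < r) :
    ∃ ρ : ℕ → ContDiffBump (0 : E), Tendsto (fun n => (ρ n).rOut) atTop (𝓝 0) ∧
      ∀ n, (ρ n).rOut ≤ r ∧ (ρ n).rOut ≤ 2 * (ρ n).rIn := by
  have hlt : ∀ n : ℕ, r / (n + 1) / 2 < r / (n + 1) := fun n => half_lt_self (by positivity)
  refine ⟨fun n => ⟨r / (n + 1) / 2, r / (n + 1), by positivity, hlt n⟩, ?_, fun n =>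
    ⟨div_le_self hr.le (by simp), (mul_div_cancel₀ _ two_ne_zero).ge⟩⟩
  simpa [div_eq_mul_inv] using (tendsto_one_div_add_atTop_nhds_zero_nat (𝕜 := ℝ)).const_mul r

variable {F : Type*} [NormedSpace ℝ E] [NormedAddCommGroup F] [NormedSpace ℝ F] {g : E → F}
  {L : ℝ≥0}

variable [FiniteDimensional ℝ E] [MeasurableSpace E] [BorelSpace E] (μ : Measure E)
  [μ.IsAddHaarMeasure] (ρ : ContDiffBump (0 : E))

theorem norm_convolution_normed_le {C : ℝ} (hC : ∀ y, ‖g y‖ ≤ C) (y : E) :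
    ‖(ρ.normed μ ⋆[lsmul ℝ ℝ, μ] g) y‖ ≤ C := by
  have h : ‖∫ t, ρ.normed μ t • g (y - t) ∂μ‖ ≤ ∫ t, ρ.normed μ t * C ∂μ := by
    refine norm_integral_le_of_norm_le (ρ.integrable_normed.mul_const C) (.of_forall fun t => ?_)
    rw [norm_smul, Real.norm_of_nonneg (ρ.nonneg_normed t)]
    exact mul_le_mul_of_nonneg_left (hC _) (ρ.nonneg_normed t)
  rwa [integral_mul_const, ρ.integral_normed, one_mul] at h

theorem tsupport_convolution_normed_subset :
    tsupport (ρ.normed μ ⋆[lsmul ℝ ℝ, μ] g) ⊆ Metric.cthickening ρ.rOut (tsupport g) := by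
  refine closure_minimal ((support_convolution_subset_swap (lsmul ℝ ℝ)).trans ?_)
    Metric.isClosed_cthickening
  rintro _ ⟨a, ha, b, hb, rfl⟩
  rw [ρ.support_normed_eq, mem_ball_zero_iff] at hb
  refine Metric.mem_cthickening_of_dist_le _ a _ _ (subset_tsupport _ ha) ?_
  simpa [dist_eq_norm] using hb.le

theorem hasFDerivAt_convolution_normed [FiniteDimensional ℝ F] (hg : LipschitzWith L g) (y : E) :
    HasFDerivAt (ρ.normed μ ⋆[lsmul ℝ ℝ, μ] g) ((ρ.normed μ ⋆[lsmul ℝ ℝ, μ] fderiv ℝ g) y) y := by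
  have hdiff : ∀ᵐ t ∂μ, DifferentiableAt ℝ g (y - t) :=
    (Measure.measurePreserving_sub_left μ y).quasiMeasurePreserving.ae hg.ae_differentiableAt
  have hcont : ∀ z, Continuous fun t => ρ.normed μ t • g (z - t) := fun z =>
    ρ.continuous_normed.smul (hg.continuous.comp (by fun_prop))
  have hlip : ∀ t, LipschitzWith (Real.nnabs (ρ.normed μ t * L))
      fun z => ρ.normed μ t • g (z - t) := fun t => by
    refine LipschitzWith.of_dist_le_mul fun z z' => ?_
    rw [dist_smul₀, map_mul, NNReal.coe_mul, Real.coe_nnabs, Real.coe_nnabs, ← Real.norm_eq_abs,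
      NNReal.abs_eq, mul_assoc]
    gcongr
    simpa using hg.dist_le_mul (z - t) (z' - t)
  refine (hasFDerivAt_integral_of_dominated_loc_of_lip (s := univ)
    (F := fun z t => ρ.normed μ t • g (z - t))
    (F' := fun t => ρ.normed μ t • fderiv ℝ g (y - t)) univ_mem
    (.of_forall fun z => (hcont z).aestronglyMeasurable)
    ((hcont y).integrable_of_hasCompactSupport ρ.hasCompactSupport_normed.smul_right)
    (ρ.continuous_normed.aestronglyMeasurable.smul
      ((measurable_fderiv ℝ g).comp (measurable_const_sub y)).aestronglyMeasurable)
    (.of_forall fun t => (hlip t).lipschitzOnWith) (ρ.integrable_normed.mul_const _) ?_).2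
  filter_upwards [hdiff] with t ht
  have hcomp := ht.hasFDerivAt.comp y ((hasFDerivAt_id y).sub_const t)
  rw [ContinuousLinearMap.comp_id] at hcomp
  exact hcomp.const_smul _

theorem exists_contDiff_approx_of_lipschitzWith [FiniteDimensional ℝ F] (hg : LipschitzWith L g)
    (hc : HasCompactSupport g) (hr : 0 < r) :
    ∃ h : ℕ → E → F, (∀ n, ContDiff ℝ ∞ (h n)) ∧
      (∀ n, tsupport (h n) ⊆ Metric.cthickening r (tsupport g)) ∧
      (∀ y, Tendsto (fun n => h n y) atTop (𝓝 (g y))) ∧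
      (∀ᵐ y ∂μ, Tendsto (fun n => fderiv ℝ (h n) y) atTop (𝓝 (fderiv ℝ g y))) ∧
      (∀ n y, ‖fderiv ℝ (h n) y‖ ≤ L) ∧ ∃ M, ∀ n y, ‖h n y‖ ≤ M := by
  have := FiniteDimensional.complete ℝ F
  obtain ⟨ρ, hρ, hρr⟩ := exists_seq_contDiffBump (E := E) hr
  have hfderiv_le : ∀ y, ‖fderiv ℝ g y‖ ≤ L := fun y => norm_fderiv_le_of_lipschitz ℝ hg
  have hlocal : LocallyIntegrable (fderiv ℝ g) μ :=
    (locallyIntegrable_const (L : ℝ)).mono (measurable_fderiv ℝ g).aestronglyMeasurable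
      (.of_forall fun y => by simpa using hfderiv_le y)
  have hfderiv : ∀ n y, fderiv ℝ ((ρ n).normed μ ⋆[lsmul ℝ ℝ, μ] g) y =
      ((ρ n).normed μ ⋆[lsmul ℝ ℝ, μ] fderiv ℝ g) y := fun n y =>
    (hasFDerivAt_convolution_normed μ (ρ n) hg y).fderiv
  obtain ⟨M, hM⟩ := hc.exists_bound_of_continuous hg.continuous
  refine ⟨fun n => (ρ n).normed μ ⋆[lsmul ℝ ℝ, μ] g, fun n => ?_, fun n => ?_, fun y => ?_, ?_,
    fun n y => ?_, M, fun n => norm_convolution_normed_le μ (ρ n) hM⟩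
  · exact (ρ n).hasCompactSupport_normed.contDiff_convolution_left _ (ρ n).contDiff_normed
      hg.continuous.locallyIntegrable
  · exact (tsupport_convolution_normed_subset μ (ρ n)).trans
      (Metric.cthickening_mono (hρr n).1 _)
  · exact ContDiffBump.convolution_tendsto_right_of_continuous hρ hg.continuous y
  · simp only [hfderiv]
    exact ContDiffBump.ae_convolution_tendsto_right_of_locallyIntegrable hρ
      (.of_forall fun n => (hρr n).2) hlocal
  · rw [hfderiv]
    exact norm_convolution_normed_le μ (ρ n) hfderiv_le y

theorem exists_contDiff_approx_of_locallyLipschitz [FiniteDimensional ℝ F] {g : E → F}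
    (hg : LocallyLipschitz g) (hc : HasCompactSupport g) {V : Set E} (hV : IsOpen V)
    (hgV : tsupport g ⊆ V) :
    ∃ K ⊆ V, IsCompact K ∧ ∃ h : ℕ → E → F, (∀ n, ContDiff ℝ ∞ (h n)) ∧
      (∀ n, tsupport (h n) ⊆ K) ∧ (∀ y, Tendsto (fun n => h n y) atTop (𝓝 (g y))) ∧
      (∀ᵐ y ∂μ, Tendsto (fun n => fderiv ℝ (h n) y) atTop (𝓝 (fderiv ℝ g y))) ∧
      (∃ L : ℝ, ∀ n y, ‖fderiv ℝ (h n) y‖ ≤ L) ∧ ∃ M, ∀ n y, ‖h n y‖ ≤ M := by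
  obtain ⟨L, hL⟩ := exists_lipschitzWith_of_hasCompactSupport hg hc
  obtain ⟨r, hr, hrV⟩ := hc.isCompact.exists_cthickening_subset_open hV hgV
  obtain ⟨h, hsmooth, hsupport, hlim, hdlim, hdL, hM⟩ :=
    exists_contDiff_approx_of_lipschitzWith μ hL hc hr
  exact ⟨_, hrV, hc.isCompact.cthickening, h, hsmooth, hsupport, hlim, hdlim, ⟨L, hdL⟩, hM⟩

end EuclideanApproximation

theorem exists_forall_of_forall_exists_eventually {α ι : Type*} [TopologicalSpace α]
    [SemilatticeSup ι] [Nonempty ι] {K : Set α} (hK : IsCompact K) {P : ι → α → Prop}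
    (hmono : ∀ x, Monotone fun C => P C x) (h : ∀ x ∈ K, ∃ C, ∀ᶠ y in 𝓝 x, P C y) :
    ∃ C, ∀ x ∈ K, P C x := by
  refine hK.induction_on (p := fun K => ∃ C, ∀ x ∈ K, P C x) ⟨Classical.arbitrary ι, by simp⟩
    (fun s t hst ⟨C, hC⟩ => ⟨C, fun x hx => hC x (hst hx)⟩) ?_ fun x hx => ?_
  · rintro s t ⟨C, hC⟩ ⟨C', hC'⟩
    exact ⟨C ⊔ C', fun x hx => hx.elim (fun h => hmono x le_sup_left (hC x h))
      fun h => hmono x le_sup_right (hC' x h)⟩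
  · obtain ⟨C, hC⟩ := h x hx
    exact ⟨_, mem_nhdsWithin_of_mem_nhds hC, C, fun y hy => hy⟩

section DifferentialBound

variable {X : Type*} [TopologicalSpace X] [ChartedSpace (𝔼 m) X]
  [IsManifold (𝓡 m) ∞ X] [RiemannianBundle (fun x : X => TangentSpace (𝓡 m) x)]

section Continuous

variable [IsContinuousRiemannianBundle (𝔼 m) (fun x : X => TangentSpace (𝓡 m) x)]

theorem exists_eventually_norm_coordMapInv_le {p x : X} (hx : x ∈ (chartAt (𝔼 m) p).source) :
    ∃ C : ℝ≥0, ∀ᶠ y in 𝓝 x, ∀ v, ‖coordMapInv m p y v‖ ≤ C * ‖v‖ := by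
  set tx := trivializationAt (𝔼 m) (TangentSpace (𝓡 m) : X → Type _) x
  set tp := trivializationAt (𝔼 m) (TangentSpace (𝓡 m) : X → Type _) p
  obtain ⟨C, hC, hCx⟩ :=
    eventually_norm_trivializationAt_lt (𝔼 m) (fun y : X => TangentSpace (𝓡 m) y) x
  have hbase : tx.baseSet ∩ tp.baseSet ∈ 𝓝 x :=
    (tx.open_baseSet.inter tp.open_baseSet).mem_nhds
      ⟨FiberBundle.mem_baseSet_trivializationAt' x, hx⟩
  have hcoord : ContinuousAt
      (fun y => (tx.coordChangeL ℝ tp y : 𝔼 m →L[ℝ] 𝔼 m)) x :=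
    (continuousOn_coordChange ℝ tx tp).continuousAt hbase
  set D := ‖(tx.coordChangeL ℝ tp x : 𝔼 m →L[ℝ] 𝔼 m)‖ + 1
  refine ⟨Real.toNNReal (D * C), ?_⟩
  filter_upwards [hCx, hcoord.norm.eventually (gt_mem_nhds (lt_add_one _)), hbase]
    with y hCy hDy hy v
  have hchange : coordMapInv m p y v = tx.coordChangeL ℝ tp y (coordMapInv m x y v) := by
    have hsymm : tx.symm y (coordMapInv m x y v) = v :=
      (tx.symmL_apply (R := ℝ) hy.1 _).symm.trans (tx.symmL_continuousLinearMapAt hy.1 v)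
    rw [tx.coordChangeL_apply tp hy, hsymm]
    exact tp.continuousLinearMapAt_apply_of_mem ℝ hy.2 v
  rw [hchange, Real.coe_toNNReal _ (by positivity), mul_assoc]
  exact (ContinuousLinearMap.le_of_opNorm_le
    (tx.coordChangeL ℝ tp y : 𝔼 m →L[ℝ] 𝔼 m) hDy.le _).trans
      (mul_le_mul_of_nonneg_left (ContinuousLinearMap.le_of_opNorm_le _ hCy.le v) (by positivity))

theorem memLp_indicator_const_of_isCompact [MeasurableSpace X] [BorelSpace X] {G : Type*}
    [NormedAddCommGroup G] {K : Set X} (hK : IsCompact K) (hKm : MeasurableSet K) (c : G)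
    (p : ℝ≥0∞) (U : Set X) :
    MemLp (K.indicator fun _ => c) p ((riemannianVolume m).restrict U) := by
  have := isLocallyFiniteMeasure_riemannianVolume m (X := X)
  exact memLp_indicator_const p hKm c
    (.inr ((Measure.restrict_apply_le _ _).trans_lt hK.measure_lt_top).ne)

theorem memLp_of_norm_le_of_isCompact [MeasurableSpace X] [BorelSpace X] {G : Type*}
    [NormedAddCommGroup G] {f : X → G} {U K : Set X} (hK : IsCompact K) (hKm : MeasurableSet K)
    (hf : AEStronglyMeasurable f ((riemannianVolume m).restrict U)) {C : ℝ}
    (hC : ∀ x ∈ K, ‖f x‖ ≤ C) (hzero : ∀ x ∉ K, f x = 0) (p : ℝ≥0∞) :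
    MemLp f p ((riemannianVolume m).restrict U) := by
  refine (memLp_indicator_const_of_isCompact m hK hKm C p U).of_le hf (.of_forall fun x => ?_)
  by_cases hx : x ∈ K
  · simpa [hx] using (hC x hx).trans (le_abs_self C)
  · simp [hzero x hx]

end Continuous

variable [SecondCountableTopology X] [MeasurableSpace X] [BorelSpace X]

theorem differentialComponents_eq_fderiv {p x : X} (hx : x ∈ (chartAt (𝔼 m) p).source)
    (f : X → ℂ) :
    differentialComponents m f x = WithLp.toLp 2 fun i =>
      fderiv ℝ (f ∘ (chartAt (𝔼 m) p).symm) (chartAt (𝔼 m) p x)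
        (coordMapInv m p x (frame m x i)) := by
  ext i
  exact differential_apply_eq_fderiv m hx f (frame m x i)

theorem differentialComponents_congr {f g : X → ℂ} {x : X} (h : f =ᶠ[𝓝 x] g) :
    differentialComponents m f x = differentialComponents m g x := by
  rw [differentialComponents, differentialComponents, differential, differential, h.mfderiv_eq]

theorem differentialComponents_eq_zero_of_notMem_tsupport {f : X → ℂ} {x : X}
    (hx : x ∉ tsupport f) : differentialComponents m f x = 0 := by
  rw [differentialComponents_congr m (notMem_tsupport_iff_eventuallyEq.1 hx)]
  exact differentialComponents_zero m x

variable [IsContinuousRiemannianBundle (𝔼 m) (fun x : X => TangentSpace (𝓡 m) x)]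

theorem exists_norm_differentialComponents_le {p : X} {A : Set X} (hA : IsCompact A)
    (hAs : A ⊆ (chartAt (𝔼 m) p).source) :
    ∃ C : ℝ≥0, ∀ x ∈ A, ∀ f : X → ℂ, ‖differentialComponents m f x‖ ≤
      C * ‖fderiv ℝ (f ∘ (chartAt (𝔼 m) p).symm) (chartAt (𝔼 m) p x)‖ := by
  obtain ⟨C, hC⟩ := exists_forall_of_forall_exists_eventually hA
    (P := fun (C : ℝ≥0) x => ∀ v, ‖coordMapInv m p x v‖ ≤ C * ‖v‖)
    (fun x C D hCD h v => (h v).trans (by gcongr))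
    fun x hx => exists_eventually_norm_coordMapInv_le m (hAs hx)
  refine ⟨NNReal.sqrt m * C, fun x hx f => ?_⟩
  rw [NNReal.coe_mul, Real.coe_sqrt, NNReal.coe_natCast, mul_assoc]
  refine norm_covectorComponents_le m x _ (by positivity) fun v => ?_
  rw [differential_apply_eq_fderiv m (hAs hx) f v, mul_comm (C : ℝ), mul_assoc]
  exact (ContinuousLinearMap.le_opNorm _ _).trans (by gcongr; exact hC x hx v)

theorem exists_norm_differentialComponents_le_of_contMDiff {φ : X → ℂ}
    (hφ : ContMDiff (𝓡 m) 𝓘(ℝ, ℂ) ∞ φ) {K : Set X} (hK : IsCompact K) :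
    ∃ C : ℝ, ∀ x ∈ K, ‖differentialComponents m φ x‖ ≤ C := by
  have := ChartedSpace.locallyCompactSpace (𝔼 m) X
  refine exists_forall_of_forall_exists_eventually hK
    (fun x C D hCD h => h.trans hCD) fun p _ => ?_
  set e := chartAt (𝔼 m) p
  obtain ⟨A, hA, hAs, hAc⟩ := local_compact_nhds (chart_source_mem_nhds (𝔼 m) p)
  obtain ⟨C, hC⟩ := exists_norm_differentialComponents_le m hAc hAs
  have hcont : ContinuousOn (fun x => fderiv ℝ (φ ∘ e.symm) (e x)) A := by
    have hsmooth : ContDiffOn ℝ ∞ (φ ∘ e.symm) e.target :=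
      (hφ.comp_contMDiffOn (contMDiffOn_chart_symm (I := 𝓡 m) (x := p))).contDiffOn
    exact (hsmooth.continuousOn_fderiv_of_isOpen e.open_target (by simp)).comp
      (e.continuousOn.mono hAs) fun x hx => e.map_source (hAs hx)
  obtain ⟨D, hD⟩ := hAc.exists_bound_of_continuousOn hcont
  refine ⟨C * D, mem_of_superset hA fun x hx => (hC x hx φ).trans ?_⟩
  gcongr
  exact hD x hx

end DifferentialBound

section SobolevZero

variable {X : Type*} [TopologicalSpace X] [ChartedSpace (𝔼 m) X]
  [IsManifold (𝓡 m) ∞ X] [RiemannianBundle (fun x : X => TangentSpace (𝓡 m) x)]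
  [SecondCountableTopology X] [MeasurableSpace X] [BorelSpace X] {U : Set X}

/-- The functions `u` and `w` represent an element of `H¹₀(U)` and its differential. -/
def MemSobolevZero (U : Set X) (u : X → ℂ) (w : X → EuclideanSpace ℂ (Fin m)) : Prop :=
  ∃ z ∈ sobolevZero m U, z.fst =ᵐ[(riemannianVolume m).restrict U] u ∧
    z.snd =ᵐ[(riemannianVolume m).restrict U] w

theorem memSobolevZero_zero : MemSobolevZero m U 0 0 :=
  ⟨0, zero_mem _, Lp.coeFn_zero _ _ _, Lp.coeFn_zero _ _ _⟩

variable {m} {u u' : X → ℂ} {w w' : X → EuclideanSpace ℂ (Fin m)}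

theorem MemSobolevZero.toLp_mem {a : L2 m U} {b : L2Form m U} (h : MemSobolevZero m U u w)
    (ha : a =ᵐ[(riemannianVolume m).restrict U] u)
    (hb : b =ᵐ[(riemannianVolume m).restrict U] w) : WithLp.toLp 2 (a, b) ∈ sobolevZero m U := by
  obtain ⟨z, hz, hzu, hzw⟩ := h
  have hza : a = z.fst := Lp.ext (ha.trans hzu.symm)
  have hzb : b = z.snd := Lp.ext (hb.trans hzw.symm)
  exact hza ▸ hzb ▸ hz

theorem MemSobolevZero.add (h : MemSobolevZero m U u w) (h' : MemSobolevZero m U u' w') :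
    MemSobolevZero m U (u + u') (w + w') := by
  obtain ⟨z, hz, hzu, hzw⟩ := h
  obtain ⟨z', hz', hzu', hzw'⟩ := h'
  exact ⟨z + z', add_mem hz hz', (Lp.coeFn_add _ _).trans (hzu.add hzu'),
    (Lp.coeFn_add _ _).trans (hzw.add hzw')⟩

theorem MemSobolevZero.sum {ι : Type*} {s : Finset ι} {u : ι → X → ℂ}
    {w : ι → X → EuclideanSpace ℂ (Fin m)} (h : ∀ i ∈ s, MemSobolevZero m U (u i) (w i)) :
    MemSobolevZero m U (∑ i ∈ s, u i) (∑ i ∈ s, w i) := by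
  classical
  induction s using Finset.induction_on with
  | empty => simpa using memSobolevZero_zero m
  | insert i s hi ih =>
    rw [Finset.sum_insert hi, Finset.sum_insert hi]
    exact (h i (Finset.mem_insert_self i s)).add
      (ih fun j hj => h j (Finset.mem_insert_of_mem hj))

theorem MemSobolevZero.congr (h : MemSobolevZero m U u w)
    (hu : u =ᵐ[(riemannianVolume m).restrict U] u')
    (hw : w =ᵐ[(riemannianVolume m).restrict U] w') : MemSobolevZero m U u' w' := by
  obtain ⟨z, hz, hzu, hzw⟩ := h
  exact ⟨z, hz, hzu.trans hu, hzw.trans hw⟩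

theorem MemSobolevZero.of_tendsto {u : ℕ → X → ℂ} {w : ℕ → X → EuclideanSpace ℂ (Fin m)}
    {u₀ : X → ℂ} {w₀ : X → EuclideanSpace ℂ (Fin m)} {b : X → ℝ}
    (hb : MemLp b 2 ((riemannianVolume m).restrict U))
    (h : ∀ n, MemSobolevZero m U (u n) (w n))
    (hub : ∀ n, ∀ᵐ x ∂(riemannianVolume m).restrict U, ‖u n x‖ ≤ b x)
    (hwb : ∀ n, ∀ᵐ x ∂(riemannianVolume m).restrict U, ‖w n x‖ ≤ b x)
    (hu : ∀ᵐ x ∂(riemannianVolume m).restrict U, Tendsto (fun n => u n x) atTop (𝓝 (u₀ x)))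
    (hw : ∀ᵐ x ∂(riemannianVolume m).restrict U, Tendsto (fun n => w n x) atTop (𝓝 (w₀ x))) :
    MemSobolevZero m U u₀ w₀ := by
  choose z hz hzu hzw using h
  have hum n := (Lp.aestronglyMeasurable (z n).fst).congr (hzu n)
  have hwm n := (Lp.aestronglyMeasurable (z n).snd).congr (hzw n)
  have hu₀ := memLp_of_tendsto_of_dominated hb hum hub hu
  have hw₀ := memLp_of_tendsto_of_dominated hb hwm hwb hw
  have hfst : Tendsto (fun n => (z n).fst) atTop (𝓝 (hu₀.toLp u₀)) := by
    rw [Lp.tendsto_Lp_iff_tendsto_eLpNorm']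
    exact (tendsto_eLpNorm_sub_of_dominated two_ne_zero ENNReal.ofNat_ne_top hb hum hub hu).congr
      fun n => eLpNorm_congr_ae ((hzu n).sub hu₀.coeFn_toLp).symm
  have hsnd : Tendsto (fun n => (z n).snd) atTop (𝓝 (hw₀.toLp w₀)) := by
    rw [Lp.tendsto_Lp_iff_tendsto_eLpNorm']
    exact (tendsto_eLpNorm_sub_of_dominated two_ne_zero ENNReal.ofNat_ne_top hb hwm hwb hw).congr
      fun n => eLpNorm_congr_ae ((hzw n).sub hw₀.coeFn_toLp).symm
  have hlim : Tendsto z atTop (𝓝 (WithLp.toLp 2 (hu₀.toLp u₀, hw₀.toLp w₀))) :=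
    ((WithLp.prod_continuous_toLp 2 _ _).tendsto _).comp (hfst.prodMk_nhds hsnd)
  exact ⟨_, (Submodule.isClosed_topologicalClosure _).mem_of_tendsto hlim (.of_forall hz),
    hu₀.coeFn_toLp, hw₀.coeFn_toLp⟩

variable [IsContinuousRiemannianBundle (𝔼 m) (fun x : X => TangentSpace (𝓡 m) x)]

theorem IsTestFunction.memSobolevZero {φ : X → ℂ} (hφ : IsTestFunction m U φ) :
    MemSobolevZero m U φ (differentialComponents m φ) := by
  obtain ⟨C, hC⟩ := exists_norm_differentialComponents_le_of_contMDiff m hφ.smooth hφ.compact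
  obtain ⟨M, hM⟩ := hφ.compact.exists_bound_of_continuous hφ.smooth.continuous
  have hmeas : MeasurableSet (tsupport φ) := (isClosed_tsupport φ).measurableSet
  have hφLp : MemLp φ 2 ((riemannianVolume m).restrict U) :=
    memLp_of_norm_le_of_isCompact m hφ.compact hmeas
      hφ.smooth.continuous.aestronglyMeasurable (fun x _ => hM x)
      (fun x => image_eq_zero_of_notMem_tsupport) 2
  have hdφLp : MemLp (differentialComponents m φ) 2 ((riemannianVolume m).restrict U) :=
    memLp_of_norm_le_of_isCompact m hφ.compact hmeas
      (measurable_differentialComponents m φ).aestronglyMeasurable hC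
      (fun x => differentialComponents_eq_zero_of_notMem_tsupport m) 2
  exact ⟨WithLp.toLp 2 (hφLp.toLp φ, hdφLp.toLp _), Submodule.le_topologicalClosure _
    ⟨φ, hφ, hφLp.coeFn_toLp, hdφLp.coeFn_toLp⟩, hφLp.coeFn_toLp, hdφLp.coeFn_toLp⟩

end SobolevZero

section Localization

theorem locallyLipschitz_indicator {α G : Type*} [PseudoEMetricSpace α] [PseudoEMetricSpace G]
    [Zero G] {s : Set α} (hs : IsOpen s) {g : α → G} (hg : LocallyLipschitzOn s g)
    (hsupport : tsupport (s.indicator g) ⊆ s) : LocallyLipschitz (s.indicator g) := by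
  intro y
  by_cases hy : y ∈ s
  · obtain ⟨K, t, ht, hK⟩ := hg hy
    rw [hs.nhdsWithin_eq hy] at ht
    refine ⟨K, t ∩ s, inter_mem ht (hs.mem_nhds hy), fun z hz z' hz' => ?_⟩
    simpa only [indicator_of_mem hz.2, indicator_of_mem hz'.2] using hK hz.1 hz'.1
  · refine ⟨0, (tsupport (s.indicator g))ᶜ,
      (isClosed_tsupport _).isOpen_compl.mem_nhds fun h => hy (hsupport h), fun z hz z' hz' => ?_⟩
    simp [image_eq_zero_of_notMem_tsupport hz, image_eq_zero_of_notMem_tsupport hz']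

theorem indicator_comp_comp_symm_eventuallyEq {X Y G : Type*} [TopologicalSpace X]
    [TopologicalSpace Y] [Zero G] (e : OpenPartialHomeomorph X Y) (h : Y → G) {y : Y}
    (hy : y ∈ e.target) : e.source.indicator (h ∘ e) ∘ e.symm =ᶠ[𝓝 y] h := by
  filter_upwards [e.open_target.mem_nhds hy] with z hz
  simp [e.map_target hz, e.right_inv hz]

theorem tsupport_indicator_comp_subset {X Y G : Type*} [TopologicalSpace X] [TopologicalSpace Y]
    [T2Space X] [Zero G] (e : OpenPartialHomeomorph X Y) {h : Y → G} (hc : HasCompactSupport h)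
    (hs : tsupport h ⊆ e.target) :
    tsupport (e.source.indicator (h ∘ e)) ⊆ e.symm '' tsupport h := by
  refine closure_minimal (fun x hx => ?_)
    (hc.isCompact.image_of_continuousOn (e.continuousOn_symm.mono hs)).isClosed
  obtain ⟨hxs, hhx⟩ := indicator_apply_ne_zero.1 hx
  exact ⟨e x, subset_tsupport h hhx, e.left_inv hxs⟩

theorem tendsto_differentialComponents {X : Type*} [TopologicalSpace X] [ChartedSpace (𝔼 m) X]
    [IsManifold (𝓡 m) ∞ X] [RiemannianBundle (fun x : X => TangentSpace (𝓡 m) x)]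
    [SecondCountableTopology X] [MeasurableSpace X] [BorelSpace X] {ι : Type*} {l : Filter ι}
    {p x : X} (hx : x ∈ (chartAt (𝔼 m) p).source) {φ : ι → X → ℂ} {u : X → ℂ}
    (h : Tendsto (fun n => fderiv ℝ (φ n ∘ (chartAt (𝔼 m) p).symm) (chartAt (𝔼 m) p x)) l
      (𝓝 (fderiv ℝ (u ∘ (chartAt (𝔼 m) p).symm) (chartAt (𝔼 m) p x)))) :
    Tendsto (fun n => differentialComponents m (φ n) x) l (𝓝 (differentialComponents m u x)) := by
  simp only [differentialComponents_eq_fderiv m hx]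
  exact ((PiLp.continuous_toLp 2 _).tendsto _).comp (tendsto_pi_nhds.2 fun i =>
    ((ContinuousLinearMap.apply ℝ ℂ _).continuous.tendsto _).comp h)

variable {X : Type*} [TopologicalSpace X] [T2Space X] [ChartedSpace (𝔼 m) X]
  [IsManifold (𝓡 m) ∞ X] {U : Set X}

theorem isTestFunction_indicator_comp_chartAt {p : X} {h : 𝔼 m → ℂ} (hh : ContDiff ℝ ∞ h)
    (hc : HasCompactSupport h)
    (hs : tsupport h ⊆ (chartAt (𝔼 m) p).target ∩ (chartAt (𝔼 m) p).symm ⁻¹' U) :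
    IsTestFunction m U ((chartAt (𝔼 m) p).source.indicator (h ∘ chartAt (𝔼 m) p)) := by
  set e := chartAt (𝔼 m) p
  set φ := e.source.indicator (h ∘ e)
  have htarget : tsupport h ⊆ e.target := hs.trans inter_subset_left
  have hφ : tsupport φ ⊆ e.symm '' tsupport h := tsupport_indicator_comp_subset e hc htarget
  have hsource : tsupport φ ⊆ e.source :=
    hφ.trans (image_subset_iff.2 fun y hy => e.map_target (htarget hy))
  refine ⟨contMDiff_of_tsupport fun x hx => ?_,
    (hc.isCompact.image_of_continuousOn (e.continuousOn_symm.mono htarget)).of_isClosed_subset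
      (isClosed_tsupport φ) hφ, hφ.trans (image_subset_iff.2 fun y hy => (hs hy).2)⟩
  have hx := e.open_source.mem_nhds (hsource hx)
  refine (hh.contMDiff.contMDiffAt.comp x
    ((contMDiffOn_chart (I := 𝓡 m)).contMDiffAt hx)).congr_of_eventuallyEq ?_
  filter_upwards [hx] with z hz using indicator_of_mem hz _

theorem exists_isTestFunction_approx {p : X} (hU : IsOpen U) {u : X → ℂ}
    (hc : HasCompactSupport u) (hs : tsupport u ⊆ (chartAt (𝔼 m) p).source) (hsU : tsupport u ⊆ U)
    (hu : LocallyLipschitzInCharts m u) :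
    ∃ φ : ℕ → X → ℂ, (∀ n, IsTestFunction m U (φ n)) ∧
      (∃ K ⊆ (chartAt (𝔼 m) p).source, IsCompact K ∧ ∀ n, tsupport (φ n) ⊆ K) ∧
      (∀ x, Tendsto (fun n => φ n x) atTop (𝓝 (u x))) ∧
      (∀ᵐ y ∂volume.restrict (chartAt (𝔼 m) p).target,
        Tendsto (fun n => fderiv ℝ (φ n ∘ (chartAt (𝔼 m) p).symm) y) atTop
          (𝓝 (fderiv ℝ (u ∘ (chartAt (𝔼 m) p).symm) y))) ∧
      (∃ L : ℝ, ∀ n, ∀ y ∈ (chartAt (𝔼 m) p).target,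
        ‖fderiv ℝ (φ n ∘ (chartAt (𝔼 m) p).symm) y‖ ≤ L) ∧ ∃ M, ∀ n x, ‖φ n x‖ ≤ M := by
  set e := chartAt (𝔼 m) p
  set g : 𝔼 m → ℂ := e.target.indicator (u ∘ e.symm)
  have himage : IsCompact (e '' tsupport u) :=
    hc.isCompact.image_of_continuousOn (e.continuousOn.mono hs)
  have hV : e '' tsupport u ⊆ e.target ∩ e.symm ⁻¹' U := image_subset_iff.2 fun x hx =>
    ⟨e.map_source (hs hx), by simpa only [mem_preimage, e.left_inv (hs hx)] using hsU hx⟩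
  have hgs : tsupport g ⊆ e '' tsupport u := tsupport_indicator_comp_subset e.symm hc hs
  have hgc : HasCompactSupport g := himage.of_isClosed_subset (isClosed_tsupport g) hgs
  have hgl : LocallyLipschitz g :=
    locallyLipschitz_indicator e.open_target (hu p) (hgs.trans (hV.trans inter_subset_left))
  obtain ⟨K, hKV, hKc, h, hsmooth, hsupport, hlim, hdlim, ⟨L, hL⟩, M, hM⟩ :=
    exists_contDiff_approx_of_locallyLipschitz volume hgl hgc
      (e.isOpen_inter_preimage_symm hU) (hgs.trans hV)
  have hK : K ⊆ e.target := hKV.trans inter_subset_left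
  have hhc n : HasCompactSupport (h n) := hKc.of_isClosed_subset (isClosed_tsupport _) (hsupport n)
  have hgu : e.source.indicator (g ∘ e) = u := by
    ext x
    by_cases hx : x ∈ e.source
    · simp [g, hx]
    · simp [hx, image_eq_zero_of_notMem_tsupport fun h => hx (hs h)]
  refine ⟨fun n => e.source.indicator (h n ∘ e),
    fun n => isTestFunction_indicator_comp_chartAt m (hsmooth n) (hhc n) ((hsupport n).trans hKV),
    ⟨e.symm '' K, image_subset_iff.2 fun y hy => e.map_target (hK hy),
      hKc.image_of_continuousOn (e.continuousOn_symm.mono hK), fun n =>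
      (tsupport_indicator_comp_subset e (hhc n) ((hsupport n).trans hK)).trans
        (image_mono (hsupport n))⟩, fun x => ?_, ?_, ⟨L, fun n y hy => ?_⟩, M, fun n x => ?_⟩
  · rw [← hgu]
    by_cases hx : x ∈ e.source
    · simp only [indicator_of_mem hx]
      exact hlim (e x)
    · simp [hx]
  · filter_upwards [ae_restrict_of_ae hdlim, ae_restrict_mem e.open_target.measurableSet]
      with y hy hyt
    have hgy := (indicator_comp_comp_symm_eventuallyEq e g hyt).fderiv_eq (𝕜 := ℝ)
    rw [hgu] at hgy
    simpa only [hgy, (indicator_comp_comp_symm_eventuallyEq e _ hyt).fderiv_eq] using hy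
  · rw [(indicator_comp_comp_symm_eventuallyEq e _ hy).fderiv_eq]
    exact hL n y
  · exact (norm_indicator_le_norm_self _ _).trans (hM n _)

variable [RiemannianBundle (fun x : X => TangentSpace (𝓡 m) x)]
  [IsContinuousRiemannianBundle (𝔼 m) (fun x : X => TangentSpace (𝓡 m) x)]
  [SecondCountableTopology X] [MeasurableSpace X] [BorelSpace X]

theorem memSobolevZero_of_tsupport_subset_source {p : X} (hU : IsOpen U) {u : X → ℂ}
    (hc : HasCompactSupport u) (hs : tsupport u ⊆ (chartAt (𝔼 m) p).source) (hsU : tsupport u ⊆ U)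
    (hu : LocallyLipschitzInCharts m u) : MemSobolevZero m U u (differentialComponents m u) := by
  obtain ⟨φ, hφ, ⟨K, hKs, hK, hφK⟩, hlim, hdlim, ⟨L, hL⟩, M, hM⟩ :=
    exists_isTestFunction_approx m hU hc hs hsU hu
  set e := chartAt (𝔼 m) p
  obtain ⟨C, hC⟩ := exists_norm_differentialComponents_le m hK hKs
  have hdφ : ∀ᵐ x ∂(riemannianVolume m).restrict e.source,
      Tendsto (fun n => differentialComponents m (φ n) x) atTop
        (𝓝 (differentialComponents m u x)) := by
    refine ae_restrict_source_of_chart m p ?_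
    filter_upwards [hdlim, ae_restrict_mem e.open_target.measurableSet] with y hy hyt
    refine tendsto_differentialComponents m (e.map_target hyt) ?_
    rwa [e.right_inv hyt]
  refine MemSobolevZero.of_tendsto
    (memLp_indicator_const_of_isCompact m hK hK.measurableSet (max M (C * L)) 2 U)
    (fun n => (hφ n).memSobolevZero) (fun n => .of_forall fun x => ?_)
    (fun n => .of_forall fun x => ?_) (.of_forall hlim) (ae_restrict_of_ae ?_)
  · by_cases hx : x ∈ K
    · simpa [hx] using .inl (hM n x)
    · simp [hx, image_eq_zero_of_notMem_tsupport fun h => hx (hφK n h)]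
  · by_cases hx : x ∈ K
    · rw [indicator_of_mem hx]
      refine le_max_of_le_right ((hC x hx _).trans ?_)
      gcongr
      exact hL n _ (e.map_source (hKs hx))
    · simp [hx, differentialComponents_eq_zero_of_notMem_tsupport m fun h => hx (hφK n h)]
  · filter_upwards [(ae_restrict_iff' e.open_source.measurableSet).1 hdφ] with x hx
    by_cases hxs : x ∈ e.source
    · exact hx hxs
    · simp [differentialComponents_eq_zero_of_notMem_tsupport m fun h => hxs (hs h),
        differentialComponents_eq_zero_of_notMem_tsupport m fun h => hxs (hKs (hφK _ h))]

end Localization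

section Leibniz

variable {X : Type*} [TopologicalSpace X] [ChartedSpace (𝔼 m) X] [IsManifold (𝓡 m) ∞ X]
  [RiemannianBundle (fun x : X => TangentSpace (𝓡 m) x)]
  [SecondCountableTopology X] [MeasurableSpace X] [BorelSpace X]

theorem differentialComponents_mul {f g : X → ℂ} {x : X}
    (hf : MDifferentiableAt (𝓡 m) 𝓘(ℝ, ℂ) f x) (hg : MDifferentiableAt (𝓡 m) 𝓘(ℝ, ℂ) g x) :
    differentialComponents m (f * g) x =
      f x • differentialComponents m g x + g x • differentialComponents m f x := by
  ext i
  simp only [differentialComponents, covectorComponents, differential,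
    (hf.hasMFDerivAt.mul hg.hasMFDerivAt).mfderiv]
  rfl

theorem differentialComponents_sub_const (f : X → ℂ) (c : ℂ) (x : X) :
    differentialComponents m (fun y => f y - c) x = differentialComponents m f x := by
  have hx := mem_chart_source (𝔼 m) x
  rw [differentialComponents_eq_fderiv m hx, differentialComponents_eq_fderiv m hx,
    show (fun y => f y - c) ∘ (chartAt (𝔼 m) x).symm =
      fun y => (f ∘ (chartAt (𝔼 m) x).symm) y - c from rfl, fderiv_sub_const]

theorem differentialComponents_sum {ι : Type*} (s : Finset ι) {f : ι → X → ℂ} {x : X}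
    (hf : ∀ i ∈ s, MDifferentiableAt (𝓡 m) 𝓘(ℝ, ℂ) (f i) x) :
    differentialComponents m (∑ i ∈ s, f i) x = ∑ i ∈ s, differentialComponents m (f i) x := by
  classical
  induction s using Finset.induction_on with
  | empty => exact differentialComponents_zero m x
  | insert i s hi ih =>
    have hs j (hj : j ∈ s) := hf j (Finset.mem_insert_of_mem hj)
    rw [Finset.sum_insert hi, Finset.sum_insert hi, ← ih hs]
    exact differentialComponents_add m (hf i (Finset.mem_insert_self i s))
      (Finset.sum_induction f (MDifferentiableAt (𝓡 m) 𝓘(ℝ, ℂ) · x) (fun _ _ => .add)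
        mdifferentiableAt_const hs)

theorem realDifferential_eq_zero_of_isLocalMin {χ : X → ℝ} {x : X} (h : IsLocalMin χ x) :
    realDifferential m χ x = 0 := by
  have hx := mem_chart_source (𝔼 m) x
  set e := chartAt (𝔼 m) x
  have hmin : IsLocalMin (χ ∘ e.symm) (e x) := by
    have hlim : Tendsto e.symm (𝓝 (e x)) (𝓝 x) := by
      simpa only [ContinuousAt, e.left_inv hx] using e.continuousAt_symm (e.map_source hx)
    simpa [IsLocalMin, IsMinFilter, e.left_inv hx] using hlim.eventually h
  have hzero : fderiv ℝ ((fun x => (χ x : ℂ)) ∘ e.symm) (e x) = 0 := by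
    by_cases hd : DifferentiableAt ℝ ((fun x => (χ x : ℂ)) ∘ e.symm) (e x)
    · have hreal : DifferentiableAt ℝ (χ ∘ e.symm) (e x) :=
        Complex.reCLM.differentiableAt.comp (e x) hd
      have hcomp := Complex.ofRealCLM.hasFDerivAt.comp (e x) hreal.hasFDerivAt
      rw [hmin.fderiv_eq_zero, ContinuousLinearMap.comp_zero] at hcomp
      exact hcomp.fderiv
    · exact fderiv_zero_of_not_differentiableAt hd
  rw [realDifferential, differentialComponents_eq_fderiv m hx]
  ext i
  simp [e, hzero]

end Leibniz

section Globalization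

variable {X : Type*} [TopologicalSpace X] [T2Space X] [ChartedSpace (𝔼 m) X]
  [IsManifold (𝓡 m) ∞ X] [SecondCountableTopology X]

theorem exists_smooth_decomposition_subset_source {u : X → ℂ} (hc : HasCompactSupport u) :
    ∃ (s : Finset X) (f : X → X → ℂ), (∀ p, ContMDiff (𝓡 m) 𝓘(ℝ, ℂ) ∞ (f p)) ∧
      (∀ p, tsupport (f p) ⊆ (chartAt (𝔼 m) p).source) ∧ ∑ p ∈ s, f p * u = u := by
  have := ChartedSpace.locallyCompactSpace (𝔼 m) X
  have : SigmaCompactSpace X := inferInstance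
  obtain ⟨f, hf⟩ := SmoothPartitionOfUnity.exists_isSubordinate_chartAt_source (I := 𝓡 m) X
  refine ⟨(f.locallyFinite.finite_nonempty_inter_compact hc).toFinset, fun p x => f p x,
    fun p => Complex.ofRealCLM.contDiff.contMDiff.comp (f p).contMDiff,
    fun p => (closure_mono fun x hx => by simpa using hx).trans (hf p), ?_⟩
  ext x
  by_cases hx : u x = 0
  · simp [hx]
  have hsum : ∑ p ∈ (f.locallyFinite.finite_nonempty_inter_compact hc).toFinset, f p x = 1 := by
    rw [← f.sum_eq_one (mem_univ x)]
    refine (finsum_eq_sum_of_support_subset _ fun p hp => ?_).symm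
    rw [Finite.coe_toFinset]
    exact ⟨x, hp, subset_tsupport _ hx⟩
  simp only [Finset.sum_apply, Pi.mul_apply, ← Finset.sum_mul, ← Complex.ofReal_sum, hsum,
    Complex.ofReal_one, one_mul]

variable [RiemannianBundle (fun x : X => TangentSpace (𝓡 m) x)]
  [IsContinuousRiemannianBundle (𝔼 m) (fun x : X => TangentSpace (𝓡 m) x)]
  [MeasurableSpace X] [BorelSpace X] {U : Set X}

theorem memSobolevZero_of_hasCompactSupport (hU : IsOpen U) {u : X → ℂ} (hc : HasCompactSupport u)
    (hsU : tsupport u ⊆ U) (hu : LocallyLipschitzInCharts m u) :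
    MemSobolevZero m U u (differentialComponents m u) := by
  obtain ⟨s, f, hf, hfs, hsum⟩ := exists_smooth_decomposition_subset_source m hc
  have hfu p : LocallyLipschitzInCharts m (f p * u) :=
    (LocallyLipschitzInCharts.of_contMDiff ((hf p).of_le (by simp))).mul hu
  have hpiece p : MemSobolevZero m U (f p * u) (differentialComponents m (f p * u)) :=
    memSobolevZero_of_tsupport_subset_source m (p := p) hU hc.mul_left
      (tsupport_mul_subset_left.trans (hfs p)) (tsupport_mul_subset_right.trans hsU) (hfu p)
  refine (MemSobolevZero.sum (s := s) fun p _ => hpiece p).congr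
    (.of_forall fun x => congrFun hsum x) (ae_restrict_of_ae ?_)
  have hdiff : ∀ᵐ x ∂riemannianVolume m, ∀ p ∈ s,
      MDifferentiableAt (𝓡 m) 𝓘(ℝ, ℂ) (f p * u) x :=
    (ae_ball_iff s.countable_toSet).2 fun p _ => (hfu p).ae_mdifferentiableAt
  filter_upwards [hdiff] with x hx
  rw [Finset.sum_apply, ← differentialComponents_sum m s hx, hsum]

theorem LocallyLipschitzInCharts.memSobolevZero_mul (hU : IsOpen U) {ξ φ : X → ℂ}
    (hξ : LocallyLipschitzInCharts m ξ) (hξU : tsupport ξ ⊆ U)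
    (hφ : ContMDiff (𝓡 m) 𝓘(ℝ, ℂ) ∞ φ) (hc : HasCompactSupport φ) :
    MemSobolevZero m U (ξ * φ)
      (fun x => ξ x • differentialComponents m φ x + φ x • differentialComponents m ξ x) := by
  refine (memSobolevZero_of_hasCompactSupport m hU hc.mul_left
    (tsupport_mul_subset_left.trans hξU)
    (hξ.mul (.of_contMDiff (hφ.of_le (by simp))))).congr .rfl (ae_restrict_of_ae ?_)
  filter_upwards [hξ.ae_mdifferentiableAt] with x hx
  exact differentialComponents_mul m hx (hφ.mdifferentiableAt (by simp))

end Globalization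

section Truncation

theorem lipschitzWith_ofReal_max_sub_zero {α : Type*} [PseudoEMetricSpace α] {χ : α → ℝ} {K : ℝ≥0}
    (hχ : LipschitzWith K χ) (η : ℝ) : LipschitzWith K fun x => ((max (χ x - η) 0 : ℝ) : ℂ) := by
  have hsub : LipschitzWith K fun x => χ x - η := by simpa using hχ.sub (LipschitzWith.const η)
  simpa [Function.comp_def] using Complex.isometry_ofReal.lipschitz.comp (hsub.max_const 0)

theorem tsupport_ofReal_max_sub_zero_subset {α : Type*} [TopologicalSpace α] {χ : α → ℝ}
    (hχ : Continuous χ) (η : ℝ) :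
    (tsupport fun x => ((max (χ x - η) 0 : ℝ) : ℂ)) ⊆ {x | η ≤ χ x} := by
  refine closure_minimal (fun x hx => ?_) (isClosed_le continuous_const hχ)
  by_contra h
  have hlt : χ x < η := not_le.1 h
  exact hx (by simp [max_eq_right (sub_nonpos.2 hlt.le)])

variable {X : Type*} [TopologicalSpace X] [ChartedSpace (𝔼 m) X] [IsManifold (𝓡 m) ∞ X]
  [RiemannianBundle (fun x : X => TangentSpace (𝓡 m) x)]
  [SecondCountableTopology X] [MeasurableSpace X] [BorelSpace X]

theorem tendsto_realDifferential_max_sub_zero {χ : X → ℝ} (hχ : Continuous χ) (hχ0 : ∀ x, 0 ≤ χ x)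
    {ι : Type*} {l : Filter ι} {η : ι → ℝ} (hη : ∀ n, 0 < η n) (hη0 : Tendsto η l (𝓝 0)) (x : X) :
    Tendsto (fun n => realDifferential m (fun y => max (χ y - η n) 0) x) l
      (𝓝 (realDifferential m χ x)) := by
  rcases (hχ0 x).eq_or_lt with hx | hx
  · rw [realDifferential_eq_zero_of_isLocalMin m (.of_forall fun y => hx ▸ hχ0 y)]
    refine tendsto_const_nhds.congr fun n => ?_
    rw [← differentialComponents_zero m x]
    refine differentialComponents_congr m ?_
    filter_upwards [hχ.continuousAt.eventually (gt_mem_nhds (hx ▸ hη n))] with y hy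
    rw [max_eq_right (sub_nonpos.2 hy.le), Complex.ofReal_zero]
  · refine tendsto_const_nhds.congr' ?_
    filter_upwards [hη0.eventually (gt_mem_nhds hx)] with n hn
    rw [realDifferential, ← differentialComponents_sub_const m _ (η n : ℂ)]
    refine differentialComponents_congr m ?_
    filter_upwards [hχ.continuousAt.eventually (lt_mem_nhds hn)] with y hy
    rw [max_eq_left (sub_nonneg.2 hy.le), Complex.ofReal_sub]

end Truncation

section Cutoff

variable {X : Type*} [EMetricSpace X] [ChartedSpace (𝔼 m) X]
  [IsManifold (𝓡 m) ∞ X] [RiemannianBundle (fun x : X => TangentSpace (𝓡 m) x)]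
  [IsContinuousRiemannianBundle (𝔼 m) (fun x : X => TangentSpace (𝓡 m) x)]
  [IsRiemannianManifold (𝓡 m) X] [SecondCountableTopology X] [MeasurableSpace X] [BorelSpace X]

/-- The truncations `max (χ - η) 0` are Lipschitz and supported away from the zero set of `χ`, and
their differentials stay bounded, so dominated convergence applies as `η → 0`. -/
theorem memSobolevZero_cutoff_mul {S : Set X} (hS : IsClosed S) {χ : X → ℝ} {K : ℝ≥0}
    (hχ : LipschitzWith K χ) (hχ01 : ∀ x, χ x ∈ Icc (0 : ℝ) 1) (hχS : ∀ x ∈ S, χ x = 0)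
    {φ : X → ℂ} (hφ : ContMDiff (𝓡 m) 𝓘(ℝ, ℂ) ∞ φ) (hc : HasCompactSupport φ) :
    MemSobolevZero m Sᶜ (fun x => χ x * φ x)
      (fun x => (χ x : ℂ) • differentialComponents m φ x + φ x • realDifferential m χ x) := by
  set η : ℕ → ℝ := fun n => 1 / ((n : ℝ) + 1)
  have hη n : 0 < η n := by positivity
  have hη0 : Tendsto η atTop (𝓝 0) := tendsto_one_div_add_atTop_nhds_zero_nat
  set ξ : ℕ → X → ℂ := fun n x => ((max (χ x - η n) 0 : ℝ) : ℂ)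
  have hξ n : LipschitzWith K (ξ n) := lipschitzWith_ofReal_max_sub_zero hχ (η n)
  have hξ1 n x : ‖ξ n x‖ ≤ 1 := by
    rw [Complex.norm_real, Real.norm_of_nonneg (le_max_right _ _)]
    exact max_le (by linarith [(hχ01 x).2, hη n]) zero_le_one
  have hξS n : tsupport (ξ n) ⊆ Sᶜ := fun x hx hxS => (hη n).not_ge <|
    (tsupport_ofReal_max_sub_zero_subset hχ.continuous (η n) hx).trans (hχS x hxS).le
  have hξlim x : Tendsto (fun n => ξ n x) atTop (𝓝 (χ x : ℂ)) := by
    refine (Complex.continuous_ofReal.tendsto _).comp ?_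
    simpa [max_eq_left (hχ01 x).1] using
      ((tendsto_const_nhds (x := χ x)).sub hη0).max (tendsto_const_nhds (x := (0 : ℝ)))
  obtain ⟨M, hM⟩ := hc.exists_bound_of_continuous hφ.continuous
  obtain ⟨D, hD⟩ := exists_norm_differentialComponents_le_of_contMDiff m hφ hc
  have hzero {x} (hx : x ∉ tsupport φ) : φ x = 0 ∧ differentialComponents m φ x = 0 :=
    ⟨image_eq_zero_of_notMem_tsupport hx, differentialComponents_eq_zero_of_notMem_tsupport m hx⟩
  refine MemSobolevZero.of_tendsto
    (memLp_indicator_const_of_isCompact m hc (isClosed_tsupport φ).measurableSet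
      (max M (D + M * (√m * K))) 2 Sᶜ)
    (fun n => (locallyLipschitzInCharts_of_lipschitzWith m (hξ n)).memSobolevZero_mul m
      hS.isOpen_compl (hξS n) hφ hc)
    (fun n => .of_forall fun x => ?_) (fun n => .of_forall fun x => ?_)
    (.of_forall fun x => (hξlim x).mul_const _) (.of_forall fun x => ((hξlim x).smul_const _).add
      ((tendsto_realDifferential_max_sub_zero m hχ.continuous (fun y => (hχ01 y).1) hη hη0
        x).const_smul _))
  · by_cases hx : x ∈ tsupport φ
    · rw [indicator_of_mem hx, Pi.mul_apply, norm_mul]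
      exact le_max_of_le_left ((mul_le_of_le_one_left (norm_nonneg _) (hξ1 n x)).trans (hM x))
    · simp [hzero hx, hx]
  · by_cases hx : x ∈ tsupport φ
    · rw [indicator_of_mem hx]
      refine le_max_of_le_right ((norm_add_le _ _).trans ?_)
      rw [norm_smul, norm_smul]
      exact add_le_add ((mul_le_of_le_one_left (norm_nonneg _) (hξ1 n x)).trans (hD x hx))
        (mul_le_mul (hM x) (norm_differentialComponents_le_of_lipschitzWith m (hξ n) x)
          (norm_nonneg _) ((norm_nonneg _).trans (hM x)))
    · simp [hzero hx, hx]

end Cutoff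

section LpMaps

variable {α β G H : Type*} [MeasurableSpace α] [MeasurableSpace β] {μ : Measure α} {ν : Measure β}
  [NormedAddCommGroup G] [NormedSpace ℂ G] [NormedAddCommGroup H] [NormedSpace ℂ H]
  {p q : ℝ≥0∞} [Fact (1 ≤ q)]

theorem ae_eq_map_of_eLpNorm_le (T : (α → G) →ₗ[ℂ] (β → H)) {c : ℝ≥0}
    (hT : ∀ f, MemLp f p μ → MemLp (T f) q ν ∧ eLpNorm (T f) q ν ≤ c * eLpNorm f p μ)
    {f g : α → G} (hfg : f =ᵐ[μ] g) : T f =ᵐ[ν] T g := by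
  have hzero : f - g =ᵐ[μ] 0 := by
    filter_upwards [hfg] with x hx
    simp [hx]
  obtain ⟨hmem, hle⟩ := hT (f - g) ((memLp_congr_ae hzero).2 MemLp.zero)
  rw [eLpNorm_congr_ae hzero, eLpNorm_zero, mul_zero, nonpos_iff_eq_zero,
    eLpNorm_eq_zero_iff hmem.1 (zero_lt_one.trans_le Fact.out).ne', map_sub] at hle
  filter_upwards [hle] with x hx
  exact sub_eq_zero.1 hx

variable [Fact (1 ≤ p)]

/-- The bounded operator between Lebesgue spaces induced by a linear map `T` between spaces of
functions. That `T` respects almost everywhere equality is part of the norm bound. -/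
def lpMapOfBound (T : (α → G) →ₗ[ℂ] (β → H)) (c : ℝ≥0)
    (hT : ∀ f, MemLp f p μ → MemLp (T f) q ν ∧ eLpNorm (T f) q ν ≤ c * eLpNorm f p μ) :
    Lp G p μ →L[ℂ] Lp H q ν :=
  LinearMap.mkContinuous
    { toFun := fun f => (hT f (Lp.memLp f)).1.toLp (T f)
      map_add' := fun f g => by
        rw [← MemLp.toLp_add, MemLp.toLp_eq_toLp_iff, ← map_add]
        exact ae_eq_map_of_eLpNorm_le T hT (Lp.coeFn_add f g)
      map_smul' := fun a f => by
        rw [RingHom.id_apply, ← MemLp.toLp_const_smul, MemLp.toLp_eq_toLp_iff, ← map_smul]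
        exact ae_eq_map_of_eLpNorm_le T hT (Lp.coeFn_smul a f) } c fun f => by
    simp only [LinearMap.coe_mk, AddHom.coe_mk]
    rw [Lp.norm_toLp, Lp.norm_def, ← ENNReal.coe_toReal, ← ENNReal.toReal_mul]
    exact ENNReal.toReal_mono (ENNReal.mul_ne_top (by simp) (Lp.eLpNorm_ne_top f))
      (hT f (Lp.memLp f)).2

theorem coeFn_lpMapOfBound (T : (α → G) →ₗ[ℂ] (β → H)) (c : ℝ≥0)
    (hT : ∀ f, MemLp f p μ → MemLp (T f) q ν ∧ eLpNorm (T f) q ν ≤ c * eLpNorm f p μ)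
    (f : Lp G p μ) : lpMapOfBound T c hT f =ᵐ[ν] T f :=
  MemLp.coeFn_toLp (hT f (Lp.memLp f)).1

end LpMaps

section Pullback

variable {X : Type*} [TopologicalSpace X] [ChartedSpace (𝔼 m) X]
  [IsManifold (𝓡 m) ∞ X] [RiemannianBundle (fun x : X => TangentSpace (𝓡 m) x)]
  [IsContinuousRiemannianBundle (𝔼 m) (fun x : X => TangentSpace (𝓡 m) x)]
  [MeasurableSpace X] [BorelSpace X] {U : Set X} {G : Type*} [NormedAddCommGroup G]

theorem exists_eLpNorm_comp_chartAt_symm_le (p : X) {K : Set (𝔼 m)} (hK : IsCompact K)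
    (hKU : K ⊆ (chartAt (𝔼 m) p).target ∩ (chartAt (𝔼 m) p).symm ⁻¹' U) :
    ∃ c : ℝ≥0, ∀ f : X → G, MemLp f 2 ((riemannianVolume m).restrict U) →
      MemLp (f ∘ (chartAt (𝔼 m) p).symm) 2 (volume.restrict K) ∧
      eLpNorm (f ∘ (chartAt (𝔼 m) p).symm) 2 (volume.restrict K) ≤
        c * eLpNorm f 2 ((riemannianVolume m).restrict U) := by
  set e := chartAt (𝔼 m) p
  have hKt : K ⊆ e.target := fun y hy => (hKU hy).1
  obtain ⟨c, hc, hcK⟩ := exists_restrict_le_smul_withDensity volume hK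
    ((continuousOn_chartDensity m p).mono hKt) fun y hy => chartDensity_pos m (hKt hy)
  set ν := (volume.restrict K).withDensity fun y => ENNReal.ofReal (chartDensity m p y)
  have hmap : ν.map e.symm ≤ (riemannianVolume m).restrict U := by
    rw [← riemannianVolume_restrict_preimage m p hK.measurableSet hKt]
    refine Measure.restrict_mono (fun x hx => ?_) le_rfl
    have := (hKU hx.2).2
    rwa [mem_preimage, e.left_inv hx.1] at this
  have hae : AEMeasurable e.symm ν := aemeasurable_chartAt_symm m p hKt _
  refine ⟨(c ^ (1 / (2 : ℝ≥0∞)).toReal).toNNReal, fun f hf => ?_⟩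
  have hν : MemLp (f ∘ e.symm) 2 ν :=
    (memLp_map_measure_iff (hf.1.mono_measure hmap) hae).1 (hf.mono_measure hmap)
  refine ⟨hν.of_measure_le_smul hc hcK, ?_⟩
  rw [ENNReal.coe_toNNReal (ENNReal.rpow_ne_top_of_nonneg (by simp) hc)]
  calc eLpNorm (f ∘ e.symm) 2 (volume.restrict K) ≤ eLpNorm (f ∘ e.symm) 2 (c • ν) :=
        eLpNorm_mono_measure _ hcK
    _ = c ^ (1 / (2 : ℝ≥0∞)).toReal • eLpNorm (f ∘ e.symm) 2 ν :=
        eLpNorm_smul_measure_of_ne_top (by simp) _ _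
    _ ≤ _ := by
        rw [smul_eq_mul, ← eLpNorm_map_measure (hf.1.mono_measure hmap) hae]
        gcongr

theorem exists_eLpNorm_one_le_of_norm_le_comp_chartAt_symm (p : X) {K : Set (𝔼 m)}
    (hK : IsCompact K) (hKU : K ⊆ (chartAt (𝔼 m) p).target ∩ (chartAt (𝔼 m) p).symm ⁻¹' U)
    {T : (X → G) → 𝔼 m → ℂ}
    (hTm : ∀ f, AEStronglyMeasurable (f ∘ (chartAt (𝔼 m) p).symm) (volume.restrict K) →
      AEStronglyMeasurable (T f) (volume.restrict K))
    {C : ℝ} (hTC : ∀ f, ∀ y ∈ K, ‖T f y‖ ≤ C * ‖f ((chartAt (𝔼 m) p).symm y)‖) :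
    ∃ c : ℝ≥0, ∀ f, MemLp f 2 ((riemannianVolume m).restrict U) →
      MemLp (T f) 1 (volume.restrict K) ∧
      eLpNorm (T f) 1 (volume.restrict K) ≤ c * eLpNorm f 2 ((riemannianVolume m).restrict U) := by
  set e := chartAt (𝔼 m) p
  obtain ⟨c, hc⟩ := exists_eLpNorm_comp_chartAt_symm_le m (G := G) p hK hKU
  have hfin : volume K ^ (1 / 2 : ℝ) ≠ ⊤ :=
    ENNReal.rpow_ne_top_of_nonneg (by norm_num) hK.measure_lt_top.ne
  set A : ℝ≥0 := C.toNNReal * (c * (volume K ^ (1 / 2 : ℝ)).toNNReal)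
  refine ⟨A, fun f hf => ?_⟩
  obtain ⟨hmem, hle⟩ := hc f hf
  have hT : eLpNorm (T f) 1 (volume.restrict K) ≤
      A * eLpNorm f 2 ((riemannianVolume m).restrict U) := by
    refine (eLpNorm_le_mul_eLpNorm_of_ae_le_mul (g := f ∘ e.symm)
      ((ae_restrict_mem hK.measurableSet).mono fun y hy => hTC f y hy) 1).trans ?_
    rw [ENNReal.coe_mul, mul_assoc]
    refine mul_le_mul_right ?_ _
    refine (eLpNorm_le_eLpNorm_mul_rpow_measure_univ (q := 2) (by norm_num) hmem.1).trans ?_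
    rw [Measure.restrict_apply_univ, ENNReal.coe_mul, ENNReal.coe_toNNReal hfin, mul_right_comm]
    norm_num
    gcongr
  exact ⟨⟨hTm f hmem.1, hT.trans_lt (ENNReal.mul_lt_top ENNReal.coe_lt_top hf.2)⟩, hT⟩

end Pullback

section LpMaps

variable {α β G H : Type*} [MeasurableSpace α] [MeasurableSpace β] {μ : Measure α} {ν : Measure β}
  [NormedAddCommGroup G] [NormedSpace ℂ G] [NormedAddCommGroup H] [NormedSpace ℂ H]
  [NormedSpace ℝ H] {p : ℝ≥0∞} [Fact (1 ≤ p)]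

theorem continuous_integral_of_eLpNorm_one_le (T : (α → G) →ₗ[ℂ] (β → H)) {c : ℝ≥0}
    (hT : ∀ f, MemLp f p μ → MemLp (T f) 1 ν ∧ eLpNorm (T f) 1 ν ≤ c * eLpNorm f p μ) :
    Continuous fun f : Lp G p μ => ∫ y, T f y ∂ν :=
  (continuous_integral.comp (lpMapOfBound T c hT).continuous).congr fun f =>
    integral_congr_ae (coeFn_lpMapOfBound T c hT f)

end LpMaps

section CoordComponent

variable {X : Type*} [TopologicalSpace X] [ChartedSpace (𝔼 m) X]
  [IsManifold (𝓡 m) ∞ X] [RiemannianBundle (fun x : X => TangentSpace (𝓡 m) x)]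
  [SecondCountableTopology X] [MeasurableSpace X] [BorelSpace X]

/-- The `i`-th component, in the chart centred at `p` and as a function of the coordinates, of the
complex `1`-form with components `F` in the orthonormal frame. -/
def coordComponent (p : X) (i : Fin m) : (X → EuclideanSpace ℂ (Fin m)) →ₗ[ℂ] (𝔼 m → ℂ) where
  toFun F y := ∑ k, (inner ℝ (frame m ((chartAt (𝔼 m) p).symm y) k)
    (coordVec m p ((chartAt (𝔼 m) p).symm y) i) : ℂ) * F ((chartAt (𝔼 m) p).symm y) k
  map_add' F F' := by
    ext y
    simp [mul_add, Finset.sum_add_distrib]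
  map_smul' c F := by
    ext y
    simp [Finset.mul_sum, mul_left_comm]

theorem coordComponent_apply (p : X) (i : Fin m) (F : X → EuclideanSpace ℂ (Fin m)) (y : 𝔼 m) :
    coordComponent m p i F y = ∑ k, (inner ℝ (frame m ((chartAt (𝔼 m) p).symm y) k)
      (coordVec m p ((chartAt (𝔼 m) p).symm y) i) : ℂ) * F ((chartAt (𝔼 m) p).symm y) k :=
  rfl

theorem coordComponent_covectorComponents (p : X) (i : Fin m)
    (w : ∀ x : X, TangentSpace (𝓡 m) x →L[ℝ] ℂ) (y : 𝔼 m) :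
    coordComponent m p i (fun x => covectorComponents m x (w x)) y =
      w ((chartAt (𝔼 m) p).symm y) (coordVec m p ((chartAt (𝔼 m) p).symm y) i) :=
  (apply_eq_sum_frame m _ _ _).symm

theorem coordComponent_differentialComponents {p : X} {y : 𝔼 m}
    (hy : y ∈ (chartAt (𝔼 m) p).target) (i : Fin m) (φ : X → ℂ) :
    coordComponent m p i (differentialComponents m φ) y =
      fderiv ℝ (φ ∘ (chartAt (𝔼 m) p).symm) y (EuclideanSpace.single i 1) := by
  rw [← mfderiv_coordMap m hy, coordMap_single]
  exact coordComponent_covectorComponents m p i (differential m φ) y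

theorem covectorComponents_sum_inner_smul (x : X) (z : EuclideanSpace ℂ (Fin m)) :
    covectorComponents m x (∑ k, (innerSL ℝ (frame m x k)).smulRight (z k)) = z := by
  ext i
  simp [covectorComponents, orthonormal_iff_ite.1 (orthonormal_frame m x)]

theorem eq_of_forall_coordComponent_eq {p : X} {y : 𝔼 m} (hy : y ∈ (chartAt (𝔼 m) p).target)
    {F F' : X → EuclideanSpace ℂ (Fin m)}
    (h : ∀ i, coordComponent m p i F y = coordComponent m p i F' y) :
    F ((chartAt (𝔼 m) p).symm y) = F' ((chartAt (𝔼 m) p).symm y) := by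
  rw [← covectorComponents_sum_inner_smul m ((chartAt (𝔼 m) p).symm y) (F _),
    ← covectorComponents_sum_inner_smul m ((chartAt (𝔼 m) p).symm y) (F' _)]
  congr 1
  refine eq_of_forall_coordVec_eq m ((chartAt (𝔼 m) p).map_target hy) fun i => ?_
  simpa [coordComponent_apply] using h i

theorem norm_coordComponent_le (p : X) (i : Fin m) (F : X → EuclideanSpace ℂ (Fin m)) (y : 𝔼 m) :
    ‖coordComponent m p i F y‖ ≤
      ‖coordVec m p ((chartAt (𝔼 m) p).symm y) i‖ * ‖F ((chartAt (𝔼 m) p).symm y)‖ := by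
  set x := (chartAt (𝔼 m) p).symm y
  calc ‖coordComponent m p i F y‖
      ≤ ∑ k, ‖inner ℝ (frame m x k) (coordVec m p x i)‖ * ‖F x k‖ := by
        rw [coordComponent_apply]
        exact (norm_sum_le _ _).trans (Finset.sum_le_sum fun k _ => by simp [x])
    _ ≤ √(∑ k, ‖inner ℝ (frame m x k) (coordVec m p x i)‖ ^ 2) * √(∑ k, ‖F x k‖ ^ 2) :=
        Real.sum_mul_le_sqrt_mul_sqrt _ _ _
    _ ≤ ‖coordVec m p x i‖ * ‖F x‖ := by
        rw [EuclideanSpace.norm_eq (F x)]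
        gcongr
        exact Real.sqrt_le_left (norm_nonneg _) |>.2
          ((orthonormal_frame m x).sum_inner_products_le _)

variable [IsContinuousRiemannianBundle (𝔼 m) (fun x : X => TangentSpace (𝓡 m) x)]

theorem exists_norm_coordComponent_le (p : X) (i : Fin m) {K : Set (𝔼 m)} (hK : IsCompact K)
    (hKt : K ⊆ (chartAt (𝔼 m) p).target) :
    ∃ C : ℝ, ∀ F, ∀ y ∈ K,
      ‖coordComponent m p i F y‖ ≤ C * ‖F ((chartAt (𝔼 m) p).symm y)‖ := by
  obtain ⟨C, hC⟩ := hK.exists_bound_of_continuousOn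
    ((continuousOn_norm_coordMap_chartAt_symm m p (EuclideanSpace.single i 1)).mono hKt)
  simp only [norm_norm, coordMap_single] at hC
  exact ⟨C, fun F y hy => (norm_coordComponent_le m p i F y).trans
    (mul_le_mul_of_nonneg_right (hC y hy) (norm_nonneg _))⟩

theorem aestronglyMeasurable_coordComponent (p : X) (i : Fin m) {K : Set (𝔼 m)}
    (hK : MeasurableSet K) (hKt : K ⊆ (chartAt (𝔼 m) p).target)
    {F : X → EuclideanSpace ℂ (Fin m)}
    (hF : AEStronglyMeasurable (F ∘ (chartAt (𝔼 m) p).symm) (volume.restrict K)) :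
    AEStronglyMeasurable (coordComponent m p i F) (volume.restrict K) := by
  have hsymm := ((chartAt (𝔼 m) p).continuousOn_symm.mono hKt).aemeasurable (μ := volume) hK
  have hF' : AEMeasurable (fun y => F ((chartAt (𝔼 m) p).symm y)) (volume.restrict K) :=
    hF.aemeasurable
  rw [funext (coordComponent_apply m p i F)]
  refine (Finset.aemeasurable_fun_sum _ fun k _ => ?_).aestronglyMeasurable
  exact (Complex.measurable_ofReal.comp_aemeasurable
    ((measurable_inner_frame_coordVec m p k i).comp_aemeasurable hsymm)).mul
      ((EuclideanSpace.proj k).continuous.measurable.comp_aemeasurable hF')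

theorem locallyIntegrableOn_coordComponent (p : X) (i : Fin m) {U : Set X} (hU : IsOpen U)
    (F : L2Form m U) :
    LocallyIntegrableOn (coordComponent m p i F)
      ((chartAt (𝔼 m) p).target ∩ (chartAt (𝔼 m) p).symm ⁻¹' U) := by
  refine (locallyIntegrableOn_iff ((chartAt (𝔼 m) p).isOpen_inter_preimage_symm
    hU).isLocallyClosed).2 fun K hKU hK => ?_
  have hKt := hKU.trans inter_subset_left
  obtain ⟨C, hC⟩ := exists_norm_coordComponent_le m p i hK hKt
  obtain ⟨c, hc⟩ := exists_eLpNorm_one_le_of_norm_le_comp_chartAt_symm m p hK hKU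
    (fun F => aestronglyMeasurable_coordComponent m p i hK.measurableSet hKt (F := F)) hC
  exact memLp_one_iff_integrable.1 (hc F (Lp.memLp F)).1

end CoordComponent

section WeakDifferential

variable {X : Type*} [TopologicalSpace X] [ChartedSpace (𝔼 m) X] [IsManifold (𝓡 m) ∞ X]

theorem integral_smul_fderiv_comp_chartAt_symm (p : X) (v : 𝔼 m) {φ : X → ℂ}
    (hφ : ContMDiff (𝓡 m) 𝓘(ℝ, ℂ) 1 φ) {ψ : 𝔼 m → ℝ} (hψ : ContDiff ℝ 1 ψ)
    (hc : HasCompactSupport ψ) (hs : tsupport ψ ⊆ (chartAt (𝔼 m) p).target) :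
    ∫ y, ψ y • fderiv ℝ (φ ∘ (chartAt (𝔼 m) p).symm) y v =
      -∫ y, fderiv ℝ ψ y v • φ ((chartAt (𝔼 m) p).symm y) := by
  set e := chartAt (𝔼 m) p
  have hg : ContDiffOn ℝ 1 (φ ∘ e.symm) e.target :=
    (hφ.contMDiffOn.comp ((contMDiffOn_chart_symm (I := 𝓡 m) (n := ∞)).of_le (by simp))
      (t := univ) (mapsTo_univ _ _)).contDiffOn
  have hg' : ContinuousOn (fun y => fderiv ℝ (φ ∘ e.symm) y v) e.target :=
    (hg.continuousOn_fderiv_of_isOpen e.open_target le_rfl).clm_apply continuousOn_const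
  have hψ' : Continuous fun y => fderiv ℝ ψ y v :=
    (hψ.continuous_fderiv one_ne_zero).clm_apply continuous_const
  have hint : ∀ {a : 𝔼 m → ℝ} {b : 𝔼 m → ℂ}, Continuous a → tsupport a ⊆ tsupport ψ →
      ContinuousOn b e.target → Integrable fun y => a y • b y := by
    intro a b ha hsa hb
    refine (integrableOn_iff_integrable_of_support_subset ?_).1
      ((ha.continuousOn.smul (hb.mono hs)).integrableOn_compact hc)
    exact (Function.support_smul_subset_left a b).trans ((subset_tsupport a).trans hsa)
  exact integral_smul_fderiv_eq_neg_fderiv_smul_of_integrable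
    (hint hψ' (tsupport_fderiv_apply_subset ℝ v) hg.continuousOn)
    (hint hψ.continuous Subset.rfl hg') (hint hψ.continuous Subset.rfl hg.continuousOn)
    (fun y _ => hψ.differentiable one_ne_zero y)
    fun y hy => (hg.contDiffAt (e.open_target.mem_nhds (hs hy))).differentiableAt one_ne_zero

variable [RiemannianBundle (fun x : X => TangentSpace (𝓡 m) x)]
  [IsContinuousRiemannianBundle (𝔼 m) (fun x : X => TangentSpace (𝓡 m) x)]
  [MeasurableSpace X] [BorelSpace X] {U : Set X}

theorem continuous_integral_smul_of_norm_le_comp_chartAt_symm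
    {G : Type*} [NormedAddCommGroup G] [NormedSpace ℂ G] (p : X) {θ : 𝔼 m → ℝ}
    (hθ : Continuous θ) (hc : HasCompactSupport θ)
    (hs : tsupport θ ⊆ (chartAt (𝔼 m) p).target ∩ (chartAt (𝔼 m) p).symm ⁻¹' U)
    (T : (X → G) →ₗ[ℂ] (𝔼 m → ℂ))
    (hTm : ∀ f, AEStronglyMeasurable (f ∘ (chartAt (𝔼 m) p).symm)
      (volume.restrict (tsupport θ)) → AEStronglyMeasurable (T f) (volume.restrict (tsupport θ)))
    {C : ℝ} (hTC : ∀ f, ∀ y ∈ tsupport θ, ‖T f y‖ ≤ C * ‖f ((chartAt (𝔼 m) p).symm y)‖) :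
    Continuous fun F : Lp G 2 ((riemannianVolume m).restrict U) => ∫ y, θ y • T F y := by
  obtain ⟨D, hD⟩ := hc.isCompact.exists_bound_of_continuousOn hθ.continuousOn
  let S : (X → G) →ₗ[ℂ] (𝔼 m → ℂ) := (LinearMap.mulLeft ℂ fun y => (θ y : ℂ)).comp T
  have hS : ∀ f y, S f y = θ y • T f y := fun f y => by simp [S]
  have hSm : ∀ f, AEStronglyMeasurable (f ∘ (chartAt (𝔼 m) p).symm)
      (volume.restrict (tsupport θ)) → AEStronglyMeasurable (S f) (volume.restrict (tsupport θ)) :=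
    fun f hf => (Complex.continuous_ofReal.comp hθ).aestronglyMeasurable.mul (hTm f hf)
  have hSC : ∀ f, ∀ y ∈ tsupport θ,
      ‖S f y‖ ≤ D * C * ‖f ((chartAt (𝔼 m) p).symm y)‖ := fun f y hy => by
    rw [hS, norm_smul, mul_assoc]
    exact mul_le_mul (hD y hy) (hTC f y hy) (norm_nonneg _) ((norm_nonneg _).trans (hD y hy))
  obtain ⟨c, hcS⟩ :=
    exists_eLpNorm_one_le_of_norm_le_comp_chartAt_symm m p hc.isCompact hs hSm hSC
  refine (continuous_integral_of_eLpNorm_one_le S hcS).congr fun F => ?_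
  simp only [hS]
  refine setIntegral_eq_integral_of_forall_compl_eq_zero fun y hy => ?_
  rw [image_eq_zero_of_notMem_tsupport hy, zero_smul]

variable [SecondCountableTopology X]

theorem continuous_integral_smul_coordComponent (p : X) (i : Fin m) {θ : 𝔼 m → ℝ}
    (hθ : Continuous θ) (hc : HasCompactSupport θ)
    (hs : tsupport θ ⊆ (chartAt (𝔼 m) p).target ∩ (chartAt (𝔼 m) p).symm ⁻¹' U) :
    Continuous fun F : L2Form m U => ∫ y, θ y • coordComponent m p i F y := by
  have hst := hs.trans inter_subset_left
  obtain ⟨C, hC⟩ := exists_norm_coordComponent_le m p i hc.isCompact hst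
  exact continuous_integral_smul_of_norm_le_comp_chartAt_symm m p hθ hc hs (coordComponent m p i)
    (fun _ => aestronglyMeasurable_coordComponent m p i hc.isCompact.measurableSet hst) hC

/-- Both sides are continuous in the pair `z`, so that integration by parts extends from test
functions to their closure. -/
theorem integral_smul_coordComponent_of_mem_sobolevZero (p : X) (i : Fin m) {z : L2Pair m U}
    (hU : IsOpen U) (hz : z ∈ sobolevZero m U) {ψ : 𝔼 m → ℝ} (hψ : ContDiff ℝ 1 ψ)
    (hc : HasCompactSupport ψ)
    (hs : tsupport ψ ⊆ (chartAt (𝔼 m) p).target ∩ (chartAt (𝔼 m) p).symm ⁻¹' U) :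
    ∫ y, ψ y • coordComponent m p i z.snd y =
      -∫ y, fderiv ℝ ψ y (EuclideanSpace.single i 1) • z.fst ((chartAt (𝔼 m) p).symm y) := by
  set e := chartAt (𝔼 m) p
  set v : 𝔼 m := EuclideanSpace.single i 1
  have hψ's : tsupport (fun y => fderiv ℝ ψ y v) ⊆ tsupport ψ := tsupport_fderiv_apply_subset ℝ v
  have hfst : Continuous fun u : L2 m U => ∫ y, fderiv ℝ ψ y v • u (e.symm y) :=
    continuous_integral_smul_of_norm_le_comp_chartAt_symm m p
      ((hψ.continuous_fderiv one_ne_zero).clm_apply continuous_const) (hc.fderiv_apply ℝ v)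
      (hψ's.trans hs) (LinearMap.funLeft ℂ ℂ e.symm) (fun _ => id) (C := 1)
      fun f y _ => (one_mul _).ge
  have hclosed : IsClosed {z : L2Pair m U | ∫ y, ψ y • coordComponent m p i z.snd y =
      -∫ y, fderiv ℝ ψ y v • z.fst (e.symm y)} :=
    isClosed_eq ((continuous_integral_smul_coordComponent m p i hψ.continuous hc hs).comp
      (WithLp.sndL 2 ℂ (L2 m U) (L2Form m U)).continuous)
      (hfst.comp (WithLp.fstL 2 ℂ (L2 m U) (L2Form m U)).continuous).neg
  refine closure_minimal (s := (testPairs m U : Set (L2Pair m U))) ?_ hclosed hz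
  rintro z ⟨φ, hφ, hz₁, hz₂⟩
  have hintegral {a : 𝔼 m → ℝ} {b b' : 𝔼 m → ℂ} (ha : tsupport a ⊆ tsupport ψ)
      (hb : ∀ᵐ y ∂volume.restrict (e.target ∩ e.symm ⁻¹' U), b y = b' y) :
      ∫ y, a y • b y = ∫ y, a y • b' y := by
    refine integral_congr_ae ?_
    filter_upwards [(ae_restrict_iff' (e.isOpen_inter_preimage_symm hU).measurableSet).1 hb]
      with y hy
    by_cases hya : y ∈ tsupport a
    · rw [hy (hs (ha hya))]
    · rw [image_eq_zero_of_notMem_tsupport hya, zero_smul, zero_smul]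
  have hz₁' := ae_chart_of_ae_restrict m p hU.measurableSet hz₁
  have hz₂' : ∀ᵐ y ∂volume.restrict (e.target ∩ e.symm ⁻¹' U),
      coordComponent m p i z.snd y = fderiv ℝ (φ ∘ e.symm) y v := by
    filter_upwards [ae_chart_of_ae_restrict m p hU.measurableSet hz₂,
      ae_restrict_mem (e.isOpen_inter_preimage_symm hU).measurableSet] with y hy hyV
    rw [← coordComponent_differentialComponents m hyV.1, coordComponent_apply, hy,
      coordComponent_apply]
  rw [mem_ofPred_eq, hintegral Subset.rfl hz₂', hintegral hψ's hz₁']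
  exact integral_smul_fderiv_comp_chartAt_symm m p v (hφ.smooth.of_le (by simp)) hψ hc
    (hs.trans inter_subset_left)

theorem ae_coordComponent_eq_of_hasWeakPartial (hU : IsOpen U) {z : L2Pair m U}
    (hz : z ∈ sobolevZero m U) {p : X} {i : Fin m} {v : 𝔼 m → ℂ}
    (hv : HasWeakPartial m ((chartAt (𝔼 m) p).target ∩ (chartAt (𝔼 m) p).symm ⁻¹' U) i
      (fun y => z.fst ((chartAt (𝔼 m) p).symm y)) v) :
    ∀ᵐ y, y ∈ (chartAt (𝔼 m) p).target ∩ (chartAt (𝔼 m) p).symm ⁻¹' U →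
      coordComponent m p i z.snd y = v y := by
  have hV := (chartAt (𝔼 m) p).isOpen_inter_preimage_symm hU
  have hloc := locallyIntegrableOn_coordComponent m p i hU z.snd
  have hzero := hV.ae_eq_zero_of_integral_contDiff_smul_eq_zero (hloc.sub hv.2.1)
    fun ψ hψ hc hs => ?_
  · filter_upwards [hzero] with y hy hyV
    exact sub_eq_zero.1 (hy hyV)
  have hint : ∀ {b : 𝔼 m → ℂ}, LocallyIntegrableOn b
      ((chartAt (𝔼 m) p).target ∩ (chartAt (𝔼 m) p).symm ⁻¹' U) →
      Integrable fun y => ψ y • b y := fun {b} hb => by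
    refine (integrableOn_iff_integrable_of_support_subset (s := tsupport ψ) ?_).1
      ((hb.integrableOn_compact_subset hs hc).continuousOn_smul hψ.continuous.continuousOn hc)
    exact (Function.support_smul_subset_left ψ b).trans (subset_tsupport ψ)
  have hparts := integral_smul_coordComponent_of_mem_sobolevZero m p i hU hz
    (hψ.of_le (by simp)) hc hs
  simp only [Pi.sub_apply, smul_sub]
  rw [integral_sub (hint hloc) (hint hv.2.1), hparts, hv.2.2 ψ hψ hc hs, neg_neg, sub_self]

theorem snd_eq_covectorComponents_of_hasWeakPartial (hU : IsOpen U) {z : L2Pair m U}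
    (hz : z ∈ sobolevZero m U) {w : ∀ x : X, TangentSpace (𝓡 m) x →L[ℝ] ℂ}
    (hw : ∀ (p : X) (i : Fin m), HasWeakPartial m
      ((chartAt (𝔼 m) p).target ∩ (chartAt (𝔼 m) p).symm ⁻¹' U) i
      (fun y => z.fst ((chartAt (𝔼 m) p).symm y))
      (fun y => w ((chartAt (𝔼 m) p).symm y) (coordVec m p ((chartAt (𝔼 m) p).symm y) i))) :
    z.snd =ᵐ[(riemannianVolume m).restrict U] fun x => covectorComponents m x (w x) := by
  refine (ae_restrict_iff' hU.measurableSet).2 (ae_riemannianVolume_of_chart m fun p => ?_)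
  rw [ae_restrict_iff' (chartAt (𝔼 m) p).open_target.measurableSet]
  filter_upwards [ae_all_iff.2 fun i => ae_coordComponent_eq_of_hasWeakPartial m hU hz (hw p i)]
    with y hy hyt hyU
  refine eq_of_forall_coordComponent_eq m hyt
    (F' := fun x => covectorComponents m x (w x)) fun i => ?_
  rw [hy i ⟨hyt, hyU⟩, coordComponent_covectorComponents]

end WeakDifferential

section RestrictExtend

variable {α G : Type*} [MeasurableSpace α] {μ ν : Measure α} {s t : Set α}
  [NormedAddCommGroup G] {p : ℝ≥0∞}

theorem norm_le_of_ae_eq_of_eLpNorm_le {f : Lp G p μ} {g : α → G} {c : ℝ} (hfg : f =ᵐ[μ] g)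
    (hc : 0 ≤ c) (h : eLpNorm g p μ ≤ ENNReal.ofReal c) : ‖f‖ ≤ c := by
  rw [Lp.norm_def, eLpNorm_congr_ae hfg]
  exact ENNReal.toReal_le_of_le_ofReal hc h

theorem eLpNorm_indicator_restrict_of_subset (hs : MeasurableSet s) (hst : s ⊆ t) (f : α → G) :
    eLpNorm (s.indicator f) p (μ.restrict t) = eLpNorm f p (μ.restrict s) := by
  rw [eLpNorm_indicator_eq_eLpNorm_restrict hs, Measure.restrict_restrict hs, inter_eq_left.2 hst]

variable [NormedSpace ℂ G] [Fact (1 ≤ p)]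

/-- The passage from `Lᵖ(μ)` to `Lᵖ(ν)` for a smaller measure `ν`; for `μ.restrict t` and
`μ.restrict s` with `s ⊆ t`, the restriction of functions from `t` to `s`. -/
def lpRestrict (hνμ : ν ≤ μ) : Lp G p μ →L[ℂ] Lp G p ν :=
  lpMapOfBound LinearMap.id 1 fun f hf =>
    ⟨hf.mono_measure hνμ, by simpa using eLpNorm_mono_measure f hνμ⟩

theorem coeFn_lpRestrict (hνμ : ν ≤ μ) (f : Lp G p μ) : lpRestrict hνμ f =ᵐ[ν] f :=
  coeFn_lpMapOfBound _ _ _ f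

/-- Extension by zero from `s` to `t`. -/
def lpExtend (hs : MeasurableSet s) (hst : s ⊆ t) :
    Lp G p (μ.restrict s) →L[ℂ] Lp G p (μ.restrict t) :=
  lpMapOfBound
    { toFun := fun f => s.indicator f
      map_add' := fun f g => indicator_add s f g
      map_smul' := fun c f => indicator_const_smul s c f } 1 fun f hf => by
    refine ⟨(memLp_indicator_iff_restrict hs).2 ?_, ?_⟩
    · rwa [Measure.restrict_restrict hs, inter_eq_left.2 hst]
    · rw [ENNReal.coe_one, one_mul]
      exact (eLpNorm_indicator_restrict_of_subset hs hst f).le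

theorem coeFn_lpExtend (hs : MeasurableSet s) (hst : s ⊆ t) {f : Lp G p (μ.restrict s)}
    {g : α → G} (hfg : f =ᵐ[μ.restrict s] g) :
    lpExtend hs hst f =ᵐ[μ.restrict t] s.indicator g := by
  refine (coeFn_lpMapOfBound _ _ _ f).trans (ae_restrict_of_ae ?_)
  filter_upwards [(ae_restrict_iff' hs).1 hfg] with x hx
  by_cases hxs : x ∈ s <;> simp [hxs, hx]

theorem norm_lpExtend (hs : MeasurableSet s) (hst : s ⊆ t) (f : Lp G p (μ.restrict s)) :
    ‖lpExtend hs hst f‖ = ‖f‖ := by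
  rw [Lp.norm_def, Lp.norm_def, eLpNorm_congr_ae (coeFn_lpExtend hs hst EventuallyEq.rfl),
    eLpNorm_indicator_restrict_of_subset hs hst]

theorem lpRestrict_lpExtend (hs : MeasurableSet s) (hst : s ⊆ t) (f : Lp G p (μ.restrict s)) :
    lpRestrict (Measure.restrict_mono_set μ hst) (lpExtend hs hst f) = f := by
  refine Lp.ext ((coeFn_lpRestrict _ _).trans ?_)
  filter_upwards [ae_restrict_of_ae_restrict_of_subset hst
    (coeFn_lpExtend hs hst (EventuallyEq.refl _ f)), ae_restrict_mem hs] with x hx hxs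
  rw [hx, indicator_of_mem hxs]

theorem lpExtend_lpRestrict (hs : MeasurableSet s) (hst : s ⊆ t) {f : Lp G p (μ.restrict t)}
    (hf : ∀ᵐ x ∂(μ.restrict t), x ∉ s → f x = 0) :
    lpExtend hs hst (lpRestrict (Measure.restrict_mono_set μ hst) f) = f := by
  refine Lp.ext ((coeFn_lpExtend hs hst (coeFn_lpRestrict _ f)).trans ?_)
  filter_upwards [hf] with x hx
  by_cases hxs : x ∈ s <;> simp [hxs, hx]

theorem norm_sub_lpExtend_lpRestrict_le (hs : MeasurableSet s) (hst : s ⊆ t)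
    (f : Lp G p (μ.restrict t)) {c : ℝ} (hc : 0 ≤ c)
    (h : eLpNorm f p (μ.restrict (t \ s)) ≤ ENNReal.ofReal c) :
    ‖f - lpExtend hs hst (lpRestrict (Measure.restrict_mono_set μ hst) f)‖ ≤ c := by
  refine norm_le_of_ae_eq_of_eLpNorm_le (g := sᶜ.indicator f) ?_ hc ?_
  · filter_upwards [Lp.coeFn_sub f (lpExtend hs hst (lpRestrict _ f)),
      coeFn_lpExtend hs hst (coeFn_lpRestrict (Measure.restrict_mono_set μ hst) f)] with x hx hx'
    rw [hx, Pi.sub_apply, hx']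
    by_cases hxs : x ∈ s <;> simp [hxs]
  · rwa [eLpNorm_indicator_eq_eLpNorm_restrict hs.compl, Measure.restrict_restrict hs.compl,
      inter_comm, ← sdiff_eq]

theorem norm_ofReal_smul_le {t : ℝ}
    (ht : t ∈ Icc (0 : ℝ) 1) (v : G) : ‖(t : ℂ) • v‖ ≤ ‖v‖ := by
  rw [norm_smul, Complex.norm_real, Real.norm_of_nonneg ht.1]
  exact mul_le_of_le_one_left (norm_nonneg v) ht.2

theorem norm_sub_lpRestrict_le_of_ae_eq_smul (hs : MeasurableSet s) (hst : s ⊆ t) {A : Set α}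
    (hA : MeasurableSet A) (hAs : A ⊆ s) {χ : α → ℝ} (hχ : ∀ x, χ x ∈ Icc (0 : ℝ) 1)
    (hχ1 : ∀ x ∈ s, x ∉ A → χ x = 1) (f : Lp G p (μ.restrict t)) {g : Lp G p (μ.restrict s)}
    (hg : g =ᵐ[μ.restrict s] fun x => (χ x : ℂ) • f x) {c : ℝ} (hc : 0 ≤ c)
    (h : eLpNorm f p (μ.restrict A) ≤ ENNReal.ofReal c) :
    ‖g - lpRestrict (Measure.restrict_mono_set μ hst) f‖ ≤ c := by
  refine norm_le_of_ae_eq_of_eLpNorm_le EventuallyEq.rfl hc (le_trans ?_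
    ((eLpNorm_indicator_restrict_of_subset hA hAs f).trans_le h))
  refine eLpNorm_mono_ae ?_
  filter_upwards [Lp.coeFn_sub g (lpRestrict _ f), hg,
    coeFn_lpRestrict (Measure.restrict_mono_set μ hst) f, ae_restrict_mem hs] with x hx hgx hfx hxs
  have hsub : (χ x : ℂ) • f x - f x = -(((1 - χ x : ℝ) : ℂ) • f x) := by
    rw [Complex.ofReal_sub, Complex.ofReal_one, sub_smul, one_smul, neg_sub]
  rw [hx, Pi.sub_apply, hgx, hfx, hsub, norm_neg]
  by_cases hxA : x ∈ A
  · rw [indicator_of_mem hxA]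
    exact norm_ofReal_smul_le (Icc.mem_iff_one_sub_mem.1 (hχ x)) (f x)
  · simp [hχ1 x hxs hxA]

end RestrictExtend

section InnerRestrict

variable {α E : Type*} [MeasurableSpace α] {μ : Measure α} {s t : Set α}
  [NormedAddCommGroup E] [InnerProductSpace ℂ E]

theorem inner_lpExtend_left (hs : MeasurableSet s) (hst : s ⊆ t) (f : Lp E 2 (μ.restrict s))
    (g : Lp E 2 (μ.restrict t)) :
    inner ℂ (lpExtend hs hst f) g =
      inner ℂ f (lpRestrict (Measure.restrict_mono_set μ hst) g) := by
  rw [L2.inner_def, L2.inner_def]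
  calc ∫ x, inner ℂ (lpExtend hs hst f x) (g x) ∂(μ.restrict t)
      = ∫ x, s.indicator (fun x => inner ℂ (f x) (g x)) x ∂(μ.restrict t) := by
        refine integral_congr_ae ?_
        filter_upwards [coeFn_lpExtend hs hst (EventuallyEq.refl _ f)] with x hx
        rw [hx]
        by_cases hxs : x ∈ s <;> simp [hxs]
    _ = ∫ x, inner ℂ (f x) (g x) ∂(μ.restrict s) := by
        rw [integral_indicator hs, Measure.restrict_restrict hs, inter_eq_left.2 hst]
    _ = _ := by
        refine integral_congr_ae ?_
        filter_upwards [coeFn_lpRestrict (Measure.restrict_mono_set μ hst) g] with x hx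
        rw [hx]

theorem norm_inner_le_of_ae_eq_zero (hs : MeasurableSet s) (hst : s ⊆ t)
    (f g : Lp E 2 (μ.restrict t)) (hg : ∀ᵐ x ∂(μ.restrict t), x ∉ s → g x = 0) :
    ‖inner ℂ f g‖ ≤ (eLpNorm f 2 (μ.restrict s)).toReal * (eLpNorm g 2 (μ.restrict s)).toReal := by
  have hle : μ.restrict s ≤ μ.restrict t := Measure.restrict_mono_set μ hst
  rw [← lpExtend_lpRestrict hs hst hg, ← inner_conj_symm, RCLike.norm_conj, inner_lpExtend_left]
  refine (norm_inner_le_norm _ _).trans_eq ?_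
  rw [mul_comm, Lp.norm_def, Lp.norm_def, eLpNorm_congr_ae (coeFn_lpRestrict hle f),
    eLpNorm_congr_ae (coeFn_lpRestrict hle g), lpExtend_lpRestrict hs hst hg]

end InnerRestrict

section BilinearMultiplication

variable {α E G H : Type*} [MeasurableSpace α] {μ ν : Measure α} {p : ℝ≥0∞} [Fact (1 ≤ p)]
  [NormedAddCommGroup E] [NormedSpace ℂ E] [NormedAddCommGroup G] [NormedSpace ℂ G]
  [NormedAddCommGroup H] [NormedSpace ℂ H]

/-- The pointwise product `f ↦ B(a, f)` with a fixed essentially bounded function `a`, as an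
operator from `Lᵖ(μ)` to `Lᵖ(ν)` for a smaller measure `ν`. -/
def lpBilinearMul (B : E →L[ℂ] G →L[ℂ] H) (hνμ : ν ≤ μ) {a : α → E} (ha : MemLp a ⊤ ν) :
    Lp G p μ →L[ℂ] Lp H p ν :=
  (B.holderL ν ⊤ p p (ha.toLp a)).comp (lpRestrict hνμ)

theorem coeFn_lpBilinearMul (B : E →L[ℂ] G →L[ℂ] H) (hνμ : ν ≤ μ) {a : α → E}
    (ha : MemLp a ⊤ ν) (f : Lp G p μ) :
    lpBilinearMul B hνμ ha f =ᵐ[ν] fun x => B (a x) (f x) := by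
  filter_upwards [B.coeFn_holder (r := p) (ha.toLp a) (lpRestrict hνμ f), ha.coeFn_toLp,
    coeFn_lpRestrict hνμ f] with x hx hax hfx
  exact hx.trans (by rw [hax, hfx])

theorem memLp_top_ofReal_of_mem_Icc {Y : Type*} [TopologicalSpace Y] [MeasurableSpace Y]
    [OpensMeasurableSpace Y] {χ : Y → ℝ} (hχ : Continuous χ) (hχ01 : ∀ x, χ x ∈ Icc (0 : ℝ) 1)
    (μ : Measure Y) :
    MemLp (fun x => (χ x : ℂ)) ⊤ μ :=
  memLp_top_of_bound (Complex.measurable_ofReal.comp hχ.measurable).aestronglyMeasurable 1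
    (.of_forall fun x => by
      rw [Complex.norm_real, Real.norm_of_nonneg (hχ01 x).1]
      exact (hχ01 x).2)

end BilinearMultiplication

section TopologicalClosure

variable {E F G : Type*} [NormedAddCommGroup E] [NormedSpace ℂ E] [NormedAddCommGroup F]
  [NormedSpace ℂ F] [NormedAddCommGroup G] [NormedSpace ℂ G]

/-- The operator into a Hilbert space sum with the given components. -/
def hilbertSumLift (A : E →L[ℂ] F) (D : E →L[ℂ] G) : E →L[ℂ] WithLp 2 (F × G) :=
  (WithLp.prodContinuousLinearEquiv 2 ℂ F G).symm.toContinuousLinearMap.comp (A.prod D)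

/-- The operator between closures of subspaces `s` and `t` induced by an operator which maps `s`
into the closure of `t`. -/
def mapTopologicalClosure (T : E →L[ℂ] F) (s : Submodule ℂ E) (t : Submodule ℂ F)
    (h : ∀ z ∈ s, T z ∈ t.topologicalClosure) :
    s.topologicalClosure →L[ℂ] t.topologicalClosure :=
  (T.comp s.topologicalClosure.subtypeL).codRestrict t.topologicalClosure fun z =>
    closure_minimal (s := (s : Set E)) h
      (t.isClosed_topologicalClosure.preimage T.continuous) z.2

end TopologicalClosure

section SobolevMaps

variable {m} {X : Type*} [TopologicalSpace X] [ChartedSpace (𝔼 m) X] [IsManifold (𝓡 m) ∞ X]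
  [RiemannianBundle (fun x : X => TangentSpace (𝓡 m) x)]
  [SecondCountableTopology X] [MeasurableSpace X] [BorelSpace X] {U V : Set X}

theorem norm_sobolevDifferential_le (u : sobolevZero m U) :
    ‖sobolevDifferential m U u‖ ≤ ‖u‖ :=
  WithLp.norm_snd_le _ (u : L2Pair m U)

/-- The operator from `H¹₀(U)` to `H¹₀(V)` induced by operators `A` and `D` on pairs, which give the
function and its differential. -/
def sobolevMap (A : L2Pair m U →L[ℂ] L2 m V) (D : L2Pair m U →L[ℂ] L2Form m V)
    (h : ∀ z ∈ testPairs m U, WithLp.toLp 2 (A z, D z) ∈ sobolevZero m V) :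
    sobolevZero m U →L[ℂ] sobolevZero m V :=
  mapTopologicalClosure (hilbertSumLift A D) (testPairs m U) (testPairs m V) h

variable (m) in
/-- Extension by zero, from `H¹₀(U)` to `H¹₀(V)`. -/
def sobolevExtend (hU : MeasurableSet U) (hUV : U ⊆ V) : sobolevZero m U →L[ℂ] sobolevZero m V :=
  sobolevMap ((lpExtend hU hUV).comp (WithLp.fstL 2 ℂ _ _))
    ((lpExtend hU hUV).comp (WithLp.sndL 2 ℂ _ _)) fun z ⟨φ, hφ, hfst, hsnd⟩ => by
    refine Submodule.le_topologicalClosure _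
      ⟨φ, ⟨hφ.smooth, hφ.compact, hφ.supp.trans hUV⟩, ?_, ?_⟩
    · refine (coeFn_lpExtend hU hUV hfst).trans (EventuallyEq.of_eq ?_)
      exact indicator_eq_self.2 ((subset_tsupport φ).trans hφ.supp)
    · refine (coeFn_lpExtend hU hUV hsnd).trans (EventuallyEq.of_eq ?_)
      exact indicator_eq_self.2 fun x hx => hφ.supp (not_imp_comm.1
        (differentialComponents_eq_zero_of_notMem_tsupport m) hx)

theorem dirichletForm_sobolevExtend_sub (hU : MeasurableSet U) (hUV : U ⊆ V)
    (f v : sobolevZero m U) (u : sobolevZero m V) :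
    (dirichletForm m V).form (sobolevExtend m hU hUV f) u - (dirichletForm m U).form f v =
      inner ℂ (sobolevDifferential m U f)
        (lpRestrict (Measure.restrict_mono_set _ hUV) (sobolevDifferential m V u) -
          sobolevDifferential m U v) := by
  have hext : (dirichletForm m V).form (sobolevExtend m hU hUV f) u =
      inner ℂ (lpExtend hU hUV (sobolevDifferential m U f)) (sobolevDifferential m V u) := rfl
  have hform : (dirichletForm m U).form f v =
      inner ℂ (sobolevDifferential m U f) (sobolevDifferential m U v) := rfl
  rw [hext, hform, inner_lpExtend_left, ← inner_sub_right]

end SobolevMaps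

section ProductRule

variable {m} {X : Type*} [TopologicalSpace X] [ChartedSpace (𝔼 m) X] [IsManifold (𝓡 m) ∞ X]
  [RiemannianBundle (fun x : X => TangentSpace (𝓡 m) x)] [MeasurableSpace X] {U V : Set X}
  {χ : X → ℝ}

/-- Multiplication of the function `u` of a pair `(u, du)` by a bounded function `χ`. -/
def cutoffFunction (hUV : U ⊆ V)
    (hχ : MemLp (fun x => (χ x : ℂ)) ⊤ ((riemannianVolume m).restrict U)) :
    L2Pair m V →L[ℂ] L2 m U :=
  (lpBilinearMul (.lsmul ℂ ℂ) (Measure.restrict_mono_set _ hUV) hχ).comp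
    (WithLp.fstL 2 ℂ (L2 m V) (L2Form m V))

theorem coeFn_cutoffFunction (hUV : U ⊆ V)
    (hχ : MemLp (fun x => (χ x : ℂ)) ⊤ ((riemannianVolume m).restrict U)) (z : L2Pair m V) :
    cutoffFunction hUV hχ z =ᵐ[(riemannianVolume m).restrict U] fun x => (χ x : ℂ) • z.fst x :=
  coeFn_lpBilinearMul _ _ hχ z.fst

variable [SecondCountableTopology X] [BorelSpace X]

/-- The differential of `χ u` by the product rule, in terms of the pair `(u, du)`. -/
def cutoffDifferential (hUV : U ⊆ V)
    (hχ : MemLp (fun x => (χ x : ℂ)) ⊤ ((riemannianVolume m).restrict U))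
    (hdχ : MemLp (realDifferential m χ) ⊤ ((riemannianVolume m).restrict U)) :
    L2Pair m V →L[ℂ] L2Form m U :=
  (lpBilinearMul (.lsmul ℂ ℂ) (Measure.restrict_mono_set _ hUV) hχ).comp
      (WithLp.sndL 2 ℂ (L2 m V) (L2Form m V)) +
    (lpBilinearMul (ContinuousLinearMap.lsmul ℂ ℂ).flip (Measure.restrict_mono_set _ hUV) hdχ).comp
      (WithLp.fstL 2 ℂ (L2 m V) (L2Form m V))

theorem coeFn_cutoffDifferential (hUV : U ⊆ V)
    (hχ : MemLp (fun x => (χ x : ℂ)) ⊤ ((riemannianVolume m).restrict U))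
    (hdχ : MemLp (realDifferential m χ) ⊤ ((riemannianVolume m).restrict U)) (z : L2Pair m V) :
    cutoffDifferential hUV hχ hdχ z =ᵐ[(riemannianVolume m).restrict U]
      fun x => (χ x : ℂ) • z.snd x + z.fst x • realDifferential m χ x :=
  (Lp.coeFn_add _ _).trans
    ((coeFn_lpBilinearMul _ _ hχ z.snd).add (coeFn_lpBilinearMul _ _ hdχ z.fst))

end ProductRule

section SobolevCutoff

variable {m} {X : Type*} [EMetricSpace X] [ChartedSpace (𝔼 m) X]
  [IsManifold (𝓡 m) ∞ X] [RiemannianBundle (fun x : X => TangentSpace (𝓡 m) x)]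
  [IsContinuousRiemannianBundle (𝔼 m) (fun x : X => TangentSpace (𝓡 m) x)]
  [IsRiemannianManifold (𝓡 m) X] [SecondCountableTopology X] [MeasurableSpace X] [BorelSpace X]
  {S V : Set X} {χ : X → ℝ} {K : ℝ≥0}

theorem norm_realDifferential_le_of_lipschitzWith (hχ : LipschitzWith K χ) (x : X) :
    ‖realDifferential m χ x‖ ≤ √m * K :=
  norm_differentialComponents_le_of_lipschitzWith m
    (by simpa [Function.comp_def] using Complex.isometry_ofReal.lipschitz.comp hχ) x

theorem memLp_top_realDifferential (hχ : LipschitzWith K χ) (μ : Measure X) :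
    MemLp (realDifferential m χ) ⊤ μ :=
  memLp_top_of_bound (measurable_differentialComponents m _).aestronglyMeasurable _
    (.of_forall (norm_realDifferential_le_of_lipschitzWith hχ))

theorem toLp_cutoff_mem_sobolevZero (hS : IsClosed S) (hχ : LipschitzWith K χ)
    (hχ01 : ∀ x, χ x ∈ Icc (0 : ℝ) 1) (hχS : ∀ x ∈ S, χ x = 0) (hSV : Sᶜ ⊆ V)
    (hχmem : MemLp (fun x => (χ x : ℂ)) ⊤ ((riemannianVolume m).restrict Sᶜ))
    (hdχmem : MemLp (realDifferential m χ) ⊤ ((riemannianVolume m).restrict Sᶜ))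
    {z : L2Pair m V} (hz : z ∈ testPairs m V) :
    WithLp.toLp 2 (cutoffFunction hSV hχmem z, cutoffDifferential hSV hχmem hdχmem z) ∈
      sobolevZero m Sᶜ := by
  obtain ⟨φ, hφ, hfst, hsnd⟩ := hz
  have hfst := ae_restrict_of_ae_restrict_of_subset hSV hfst
  have hsnd := ae_restrict_of_ae_restrict_of_subset hSV hsnd
  refine (memSobolevZero_cutoff_mul m hS hχ hχ01 hχS hφ.smooth hφ.compact).toLp_mem ?_ ?_
  · filter_upwards [coeFn_cutoffFunction hSV hχmem z, hfst] with x hx hφx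
    rw [hx, hφx, smul_eq_mul]
  · filter_upwards [coeFn_cutoffDifferential hSV hχmem hdχmem z, hfst, hsnd] with x hx hφx hdφx
    rw [hx, hφx, hdφx]

/-- Multiplication by a Lipschitz cut-off function `χ` which vanishes on `S`, followed by the
restriction to the complement of `S`, as an operator from `H¹₀(V)` to `H¹₀(X ∖ S)`. -/
def sobolevCutoff (hS : IsClosed S) (hχ : LipschitzWith K χ) (hχ01 : ∀ x, χ x ∈ Icc (0 : ℝ) 1)
    (hχS : ∀ x ∈ S, χ x = 0) (hSV : Sᶜ ⊆ V) : sobolevZero m V →L[ℂ] sobolevZero m Sᶜ :=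
  have hχmem := memLp_top_ofReal_of_mem_Icc hχ.continuous hχ01 ((riemannianVolume m).restrict Sᶜ)
  have hdχmem := memLp_top_realDifferential hχ ((riemannianVolume m).restrict Sᶜ)
  sobolevMap (cutoffFunction hSV hχmem) (cutoffDifferential hSV hχmem hdχmem) fun _ hz =>
    toLp_cutoff_mem_sobolevZero hS hχ hχ01 hχS hSV hχmem hdχmem hz

theorem coeFn_sobolevInclusion_sobolevCutoff (hS : IsClosed S) (hχ : LipschitzWith K χ)
    (hχ01 : ∀ x, χ x ∈ Icc (0 : ℝ) 1) (hχS : ∀ x ∈ S, χ x = 0) (hSV : Sᶜ ⊆ V)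
    (u : sobolevZero m V) :
    sobolevInclusion m Sᶜ (sobolevCutoff hS hχ hχ01 hχS hSV u)
      =ᵐ[(riemannianVolume m).restrict Sᶜ] fun x => (χ x : ℂ) • sobolevInclusion m V u x :=
  coeFn_cutoffFunction hSV _ (u : L2Pair m V)

theorem coeFn_sobolevDifferential_sobolevCutoff (hS : IsClosed S) (hχ : LipschitzWith K χ)
    (hχ01 : ∀ x, χ x ∈ Icc (0 : ℝ) 1) (hχS : ∀ x ∈ S, χ x = 0) (hSV : Sᶜ ⊆ V)
    (u : sobolevZero m V) :
    sobolevDifferential m Sᶜ (sobolevCutoff hS hχ hχ01 hχS hSV u)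
      =ᵐ[(riemannianVolume m).restrict Sᶜ] fun x => (χ x : ℂ) • sobolevDifferential m V u x +
        sobolevInclusion m V u x • realDifferential m χ x :=
  coeFn_cutoffDifferential hSV _ _ (u : L2Pair m V)

end SobolevCutoff

theorem sdiff_ae_eq_interior_sdiff {X : Type*} [TopologicalSpace X] [MeasurableSpace X]
    {μ : Measure X} {S B : Set X} (h : μ (frontier S \ B) = 0) :
    (S \ B : Set X) =ᵐ[μ] (interior S \ B : Set X) := by
  refine ae_eq_set.2 ⟨measure_mono_null ?_ h, ?_⟩
  · rintro x ⟨⟨hxS, hxB⟩, hx⟩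
    exact ⟨⟨subset_closure hxS, fun hi => hx ⟨hi, hxB⟩⟩, hxB⟩
  · rw [sdiff_eq_empty.2 (sdiff_subset_sdiff_left interior_subset), measure_empty]

section Rates

variable {m} {X : Type*} [TopologicalSpace X] [ChartedSpace (𝔼 m) X] [IsManifold (𝓡 m) ∞ X]
  [RiemannianBundle (fun x : X => TangentSpace (𝓡 m) x)]
  [SecondCountableTopology X] [MeasurableSpace X] [BorelSpace X] {A S B U : Set X} {δ C : ℝ}

theorem measurableSet_annulus {χ : X → ℝ} (hS : IsClosed S) : MeasurableSet (annulus m S χ) :=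
  Measure.isClosed_support.measurableSet.diff hS.measurableSet

theorem eLpNorm_sobolevDifferential_restrict_le (hAU : A ⊆ U) (u : sobolevZero m U) :
    eLpNorm (sobolevDifferential m U u) 2 ((riemannianVolume m).restrict A) ≤
      ENNReal.ofReal ‖u‖ := by
  refine (eLpNorm_mono_measure _ (Measure.restrict_mono_set _ hAU)).trans ?_
  rw [← Lp.enorm_def, ← ofReal_norm]
  exact ENNReal.ofReal_le_ofReal (norm_sobolevDifferential_le u)

theorem NonConcentrating.of_interior_sdiff (h : NonConcentrating m (interior S \ B) U δ)
    (hnull : riemannianVolume m (frontier S \ B) = 0) : NonConcentrating m (S \ B) U δ := by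
  unfold NonConcentrating
  rwa [Measure.restrict_congr_set (sdiff_ae_eq_interior_sdiff hnull)]

theorem EllipticallyRegular.eLpNorm_sobolevDifferential_le
    [IsContinuousRiemannianBundle (𝔼 m) (fun x : X => TangentSpace (𝓡 m) x)]
    (hreg : EllipticallyRegular m U C) (hU : IsOpen U) (hAU : A ⊆ U)
    (hA : NonConcentratingOfOrderTwo m A U δ) (hδ : 0 ≤ δ) {f : sobolevZero m U} {h : L2 m U}
    (hf : (dirichletForm m U).IsOperatorValue f h) :
    eLpNorm (sobolevDifferential m U f) 2 ((riemannianVolume m).restrict A) ≤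
      ENNReal.ofReal (δ * (C * ‖h + sobolevInclusion m U f‖)) := by
  obtain ⟨w, t, hwt, hle⟩ := hreg f h hf
  have hdf : sobolevDifferential m U f =ᵐ[(riemannianVolume m).restrict U]
      fun x => covectorComponents m x (w x) :=
    snd_eq_covectorComponents_of_hasWeakPartial m hU f.2 fun p => (hwt.1 p).1
  rw [eLpNorm_congr_ae (ae_restrict_of_ae_restrict_of_subset hAU hdf), ENNReal.ofReal_mul hδ]
  exact (hA _ w t hwt).trans (by gcongr)

theorem ae_realDifferential_eq_zero (χ : X → ℝ) :
    ∀ᵐ x ∂(riemannianVolume m), x ∉ differentialSupport m χ → realDifferential m χ x = 0 := by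
  have hnull : ((riemannianVolume m).restrict {x | realDifferential m χ x ≠ 0})
      (differentialSupport m χ)ᶜ = 0 := Measure.measure_compl_support
  have hmeas : MeasurableSet (differentialSupport m χ) :=
    Measure.isClosed_support.measurableSet
  rw [Measure.restrict_apply hmeas.compl] at hnull
  refine measure_mono_null (fun x hx => ?_) hnull
  simpa using hx

end Rates

section Remainder

variable {m} {X : Type*} [EMetricSpace X] [ChartedSpace (𝔼 m) X]
  [IsManifold (𝓡 m) ∞ X] [RiemannianBundle (fun x : X => TangentSpace (𝓡 m) x)]
  [IsContinuousRiemannianBundle (𝔼 m) (fun x : X => TangentSpace (𝓡 m) x)]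
  [IsRiemannianManifold (𝓡 m) X] [SecondCountableTopology X] [MeasurableSpace X] [BorelSpace X]
  {S V : Set X} {χ : X → ℝ} {K : ℝ≥0}

theorem ae_norm_realDifferential_le (hχ : LipschitzWith K χ) :
    ∀ᵐ x ∂(riemannianVolume m), ‖realDifferential m χ x‖ ≤ differentialSupNorm m χ := by
  filter_upwards [ae_le_eLpNormEssSup (f := realDifferential m χ) (μ := riemannianVolume m)]
    with x hx
  rw [differentialSupNorm, ← toReal_enorm]
  exact ENNReal.toReal_mono (memLp_top_realDifferential hχ _).2.ne
    (by rwa [eLpNorm_exponent_top])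

theorem eLpNorm_smul_realDifferential_le (hχ : LipschitzWith K χ) (v : X → ℂ) (p : ℝ≥0∞)
    (A : Set X) :
    eLpNorm (fun x => v x • realDifferential m χ x) p ((riemannianVolume m).restrict A) ≤
      ENNReal.ofReal (differentialSupNorm m χ) *
        eLpNorm v p ((riemannianVolume m).restrict A) := by
  refine eLpNorm_le_mul_eLpNorm_of_ae_le_mul ?_ p
  filter_upwards [ae_restrict_of_ae (ae_norm_realDifferential_le hχ)] with x hx
  rw [norm_smul, mul_comm]
  gcongr

/-- The difference `du - d(χ u)` on the complement of `S`, for `u ∈ H¹₀(V)`. -/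
def cutoffRemainder (hS : IsClosed S) (hχ : LipschitzWith K χ) (hχ01 : ∀ x, χ x ∈ Icc (0 : ℝ) 1)
    (hχS : ∀ x ∈ S, χ x = 0) (hSV : Sᶜ ⊆ V) (u : sobolevZero m V) : L2Form m Sᶜ :=
  lpRestrict (Measure.restrict_mono_set _ hSV) (sobolevDifferential m V u) -
    sobolevDifferential m Sᶜ (sobolevCutoff hS hχ hχ01 hχS hSV u)

variable (hS : IsClosed S) (hχ : LipschitzWith K χ) (hχ01 : ∀ x, χ x ∈ Icc (0 : ℝ) 1)
  (hχS : ∀ x ∈ S, χ x = 0) (hSV : Sᶜ ⊆ V) (u : sobolevZero m V)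

theorem coeFn_cutoffRemainder :
    cutoffRemainder hS hχ hχ01 hχS hSV u =ᵐ[(riemannianVolume m).restrict Sᶜ]
      fun x => ((1 - χ x : ℝ) : ℂ) • sobolevDifferential m V u x -
        sobolevInclusion m V u x • realDifferential m χ x := by
  filter_upwards [Lp.coeFn_sub (lpRestrict (Measure.restrict_mono_set _ hSV)
      (sobolevDifferential m V u)) (sobolevDifferential m Sᶜ (sobolevCutoff hS hχ hχ01 hχS hSV u)),
    coeFn_sobolevDifferential_sobolevCutoff hS hχ hχ01 hχS hSV u,
    coeFn_lpRestrict (Measure.restrict_mono_set _ hSV) (sobolevDifferential m V u)]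
    with x hsub hcut hrestr
  rw [cutoffRemainder, hsub, Pi.sub_apply, hrestr, hcut, Complex.ofReal_sub, sub_smul,
    Complex.ofReal_one, one_smul, sub_sub]

theorem cutoffRemainder_ae_eq_zero (hχ1 : ∀ x ∉ S, x ∉ annulus m S χ → χ x = 1) :
    ∀ᵐ x ∂((riemannianVolume m).restrict Sᶜ),
      x ∉ annulus m S χ → cutoffRemainder hS hχ hχ01 hχS hSV u x = 0 := by
  filter_upwards [coeFn_cutoffRemainder hS hχ hχ01 hχS hSV u,
    ae_restrict_mem hS.measurableSet.compl,
    ae_restrict_of_ae (ae_realDifferential_eq_zero χ)] with x hx hxS hdχ hxA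
  simp [hx, hχ1 x hxS hxA, hdχ fun hsupp => hxA ⟨hsupp, hxS⟩]

theorem eLpNorm_cutoffRemainder_le {A : Set X} {δ : ℝ} (hδ : 0 ≤ δ) (hAS : A ⊆ Sᶜ)
    (hA : NonConcentrating m A V δ) :
    eLpNorm (cutoffRemainder hS hχ hχ01 hχS hSV u) 2 ((riemannianVolume m).restrict A) ≤
      ENNReal.ofReal ((1 + δ * differentialSupNorm m χ) * ‖u‖) := by
  set μ := (riemannianVolume m (X := X)).restrict A
  set N := differentialSupNorm m χ
  have hN : 0 ≤ N := ENNReal.toReal_nonneg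
  set v := sobolevInclusion m V u
  set du := sobolevDifferential m V u
  have hAV : A ⊆ V := hAS.trans hSV
  have hle : μ ≤ (riemannianVolume m).restrict V := Measure.restrict_mono_set _ hAV
  have hmeas_du : AEStronglyMeasurable (fun x => ((1 - χ x : ℝ) : ℂ) • du x) μ :=
    (Complex.continuous_ofReal.comp (continuous_const.sub hχ.continuous)).aestronglyMeasurable.smul
      ((Lp.aestronglyMeasurable du).mono_measure hle)
  have hmeas_dχ : AEStronglyMeasurable (fun x => v x • realDifferential m χ x) μ :=
    ((Lp.aestronglyMeasurable v).mono_measure hle).smul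
      (measurable_differentialComponents m _).aestronglyMeasurable
  calc eLpNorm (cutoffRemainder hS hχ hχ01 hχS hSV u) 2 μ
      = eLpNorm (fun x => ((1 - χ x : ℝ) : ℂ) • du x - v x • realDifferential m χ x) 2 μ :=
        eLpNorm_congr_ae (ae_restrict_of_ae_restrict_of_subset hAS
          (coeFn_cutoffRemainder hS hχ hχ01 hχS hSV u))
    _ ≤ eLpNorm (fun x => ((1 - χ x : ℝ) : ℂ) • du x) 2 μ +
          eLpNorm (fun x => v x • realDifferential m χ x) 2 μ :=
        eLpNorm_sub_le hmeas_du hmeas_dχ one_le_two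
    _ ≤ eLpNorm du 2 μ + ENNReal.ofReal N * eLpNorm v 2 μ :=
        add_le_add (eLpNorm_mono fun x =>
            norm_ofReal_smul_le (Icc.mem_iff_one_sub_mem.1 (hχ01 x)) (du x))
          (eLpNorm_smul_realDifferential_le hχ (v : X → ℂ) 2 A)
    _ ≤ ENNReal.ofReal ‖u‖ + ENNReal.ofReal N * ENNReal.ofReal (δ * ‖u‖) := by
        gcongr
        exacts [eLpNorm_sobolevDifferential_restrict_le hAV u, hA u]
    _ = ENNReal.ofReal ((1 + δ * N) * ‖u‖) := by
        rw [← ENNReal.ofReal_mul hN, ← ENNReal.ofReal_add (norm_nonneg u) (by positivity)]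
        ring_nf

theorem norm_dirichletForm_sub_le {δ' δ'' C : ℝ} (hδ' : 0 ≤ δ') (hδ'' : 0 ≤ δ'') (hC : 0 ≤ C)
    (hχ1 : ∀ x ∉ S, x ∉ annulus m S χ → χ x = 1) (hreg : EllipticallyRegular m Sᶜ C)
    (hA : NonConcentrating m (annulus m S χ) V δ')
    (hA₂ : NonConcentratingOfOrderTwo m (annulus m S χ) Sᶜ δ'')
    {f : sobolevZero m Sᶜ} {h : L2 m Sᶜ} (hf : (dirichletForm m Sᶜ).IsOperatorValue f h) :
    ‖(dirichletForm m V).form (sobolevExtend m hS.measurableSet.compl hSV f) u -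
        (dirichletForm m Sᶜ).form f (sobolevCutoff hS hχ hχ01 hχS hSV u)‖ ≤
      C * (δ'' + δ' * δ'' * differentialSupNorm m χ) * ‖h + sobolevInclusion m Sᶜ f‖ * ‖u‖ := by
  have hAS : annulus m S χ ⊆ Sᶜ := fun x hx => hx.2
  have hN : 0 ≤ differentialSupNorm m χ := ENNReal.toReal_nonneg
  have hdf := ENNReal.toReal_le_of_le_ofReal (by positivity)
    (hreg.eLpNorm_sobolevDifferential_le hS.isOpen_compl hAS hA₂ hδ'' hf)
  have hR := ENNReal.toReal_le_of_le_ofReal (by positivity)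
    (eLpNorm_cutoffRemainder_le hS hχ hχ01 hχS hSV u hδ' hAS hA)
  rw [dirichletForm_sobolevExtend_sub]
  calc ‖inner ℂ (sobolevDifferential m Sᶜ f) (cutoffRemainder hS hχ hχ01 hχS hSV u)‖
      ≤ _ := norm_inner_le_of_ae_eq_zero (measurableSet_annulus hS) hAS _ _
        (cutoffRemainder_ae_eq_zero hS hχ hχ01 hχS hSV u hχ1)
    _ ≤ (δ'' * (C * ‖h + sobolevInclusion m Sᶜ f‖)) *
          ((1 + δ' * differentialSupNorm m χ) * ‖u‖) :=
        mul_le_mul hdf hR ENNReal.toReal_nonneg (by positivity)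
    _ = _ := by ring

end Remainder

theorem isContinuousRiemannianBundle_of_isContMDiffRiemannianBundle {EB HB M F : Type*}
    [NormedAddCommGroup EB] [NormedSpace ℝ EB] [TopologicalSpace HB]
    (I : ModelWithCorners ℝ EB HB) (n : ℕ∞ω) [TopologicalSpace M] [ChartedSpace HB M]
    [NormedAddCommGroup F] [NormedSpace ℝ F] {E : M → Type*} [TopologicalSpace (TotalSpace F E)]
    [∀ x, NormedAddCommGroup (E x)] [∀ x, InnerProductSpace ℝ (E x)] [FiberBundle F E]
    [VectorBundle ℝ F E] [IsContMDiffRiemannianBundle I n F E] :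
    IsContinuousRiemannianBundle F E := by
  obtain ⟨g, hg, hgi⟩ := IsContMDiffRiemannianBundle.exists_contMDiff (IB := I) (n := n)
    (F := F) (E := E)
  exact ⟨g, hg.continuous, hgi⟩

theorem mainTheorem3_general {X : Type*} [EMetricSpace X] [ChartedSpace (𝔼 m) X]
    [IsManifold (𝓡 m) ∞ X] [RiemannianBundle (fun x : X => TangentSpace (𝓡 m) x)]
    [IsContMDiffRiemannianBundle (𝓡 m) 1 (𝔼 m) (fun x : X => TangentSpace (𝓡 m) x)]
    [IsRiemannianManifold (𝓡 m) X] [SecondCountableTopology X] [MeasurableSpace X] [BorelSpace X]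
    {B S : Set X} {χ : X → ℝ} {K : ℝ≥0} {δ' δ'' δbar C : ℝ}
    (hS : IsClosed S) (hBS : B ⊆ S) (hnull : riemannianVolume m (frontier S \ B) = 0)
    (hχ : LipschitzWith K χ) (hχ01 : ∀ x, χ x ∈ Icc (0 : ℝ) 1) (hχS : ∀ x ∈ S, χ x = 0)
    (hχ1 : ∀ x ∉ S, x ∉ annulus m S χ → χ x = 1)
    (hδ' : 0 ≤ δ') (hδ'' : 0 ≤ δ'') (hC : 0 ≤ C)
    (hA : NonConcentrating m (annulus m S χ) Bᶜ δ')
    (hA₂ : NonConcentratingOfOrderTwo m (annulus m S χ) Sᶜ δ'')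
    (hreg : EllipticallyRegular m Sᶜ C)
    (hspec : NonConcentrating m (interior S \ B) Bᶜ δbar) :
    QuasiUnitarilyEquivalentOfOrderTwo (dirichletForm m Sᶜ) (dirichletForm m Bᶜ)
      (max δbar (max δ' (C * (δ'' + δ' * δ'' * differentialSupNorm m χ)))) := by
  have : IsContinuousRiemannianBundle (𝔼 m) (fun x : X => TangentSpace (𝓡 m) x) :=
    isContinuousRiemannianBundle_of_isContMDiffRiemannianBundle (𝓡 m) 1
  set δ := max δbar (max δ' (C * (δ'' + δ' * δ'' * differentialSupNorm m χ)))
  have hδbarδ : δbar ≤ δ := le_max_left _ _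
  have hδ'δ : δ' ≤ δ := (le_max_left _ _).trans (le_max_right _ _)
  have hδ''δ : C * (δ'' + δ' * δ'' * differentialSupNorm m χ) ≤ δ :=
    (le_max_right _ _).trans (le_max_right _ _)
  have hδ : 0 ≤ δ := hδ'.trans hδ'δ
  have hU : MeasurableSet Sᶜ := hS.measurableSet.compl
  have hUV : Sᶜ ⊆ Bᶜ := compl_subset_compl.2 hBS
  refine ⟨hδ, lpExtend hU hUV, lpRestrict (Measure.restrict_mono_set _ hUV),
    sobolevExtend m hU hUV, sobolevCutoff hS hχ hχ01 hχS hUV, fun f => ?_, fun f u => ?_,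
    fun f => ?_, fun u => ?_, fun f => ?_, fun u => ?_, fun f h hf u => ?_⟩
  · rw [norm_lpExtend]
    exact le_mul_of_one_le_left (norm_nonneg f) (le_add_of_nonneg_right hδ)
  · rw [inner_lpExtend_left, sub_self, norm_zero]
    positivity
  · rw [lpRestrict_lpExtend, sub_self, norm_zero]
    positivity
  · refine norm_sub_lpExtend_lpRestrict_le hU hUV _ (by positivity) ?_
    rw [compl_sdiff_compl]
    exact (hspec.of_interior_sdiff hnull u).trans (by gcongr)
  · have hcomm : (dirichletForm m Bᶜ).ι (sobolevExtend m hU hUV f) =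
        lpExtend hU hUV ((dirichletForm m Sᶜ).ι f) := rfl
    rw [hcomm, sub_self, norm_zero]
    positivity
  · exact norm_sub_lpRestrict_le_of_ae_eq_smul hU hUV (measurableSet_annulus hS)
      (fun x hx => hx.2) hχ01 hχ1 _ (coeFn_sobolevInclusion_sobolevCutoff hS hχ hχ01 hχS hUV u)
      (by positivity) ((hA u).trans (by gcongr))
  · refine (norm_dirichletForm_sub_le hS hχ hχ01 hχS hUV u hδ' hδ'' hC hχ1 hreg hA hA₂ hf).trans ?_
    gcongr
    rfl

end

theorem mainTheorem3 (m : ℕ) {X : Type*} [EMetricSpace X]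
    [ChartedSpace (EuclideanSpace ℝ (Fin m)) X] [IsManifold (𝓡 m) ∞ X]
    [RiemannianBundle (fun x : X => TangentSpace (𝓡 m) x)]
    [IsContMDiffRiemannianBundle (𝓡 m) ∞ (EuclideanSpace ℝ (Fin m))
      (fun x : X => TangentSpace (𝓡 m) x)]
    [IsRiemannianManifold (𝓡 m) X] [SecondCountableTopology X] [MeasurableSpace X] [BorelSpace X]
    (ε₀ : ℝ) (B : ℝ → Set X) (S : Set X) (χ : ℝ → X → ℝ) (δ' δ'' δbar : ℝ → ℝ) (C : ℝ)
    (hB : IsDirichletSolidifying m ε₀ B S χ δ' δ'' δbar C) :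
    ∀ ε ∈ Set.Ioc 0 ε₀,
      QuasiUnitarilyEquivalentOfOrderTwo (dirichletForm m Sᶜ) (dirichletForm m (B ε)ᶜ)
        (max (δbar ε) (max (δ' ε)
          (C * (δ'' ε + δ' ε * δ'' ε * differentialSupNorm m (χ ε))))) := by
  intro ε hε
  have := IsContMDiffRiemannianBundle.of_le (n := ∞) (n' := 1) (IB := 𝓡 m)
    (F := EuclideanSpace ℝ (Fin m)) (E := fun x : X => TangentSpace (𝓡 m) x) (by norm_cast)
  obtain ⟨K, hχ⟩ := hB.lipschitz ε hε
  obtain ⟨hδ', hδ''⟩ := hB.rate_nonneg ε hε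
  exact mainTheorem3_general m hB.isClosed_limit (hB.obstacle_subset ε hε) (hB.null_boundary ε hε)
    hχ (hB.range_cutoff ε hε) (hB.cutoff_eq_zero ε hε) (hB.cutoff_eq_one ε hε) hδ' hδ''
    (zero_le_one.trans hB.one_le_const) (hB.nonConcentrating ε hε)
    (hB.nonConcentrating_two ε hε) hB.ellipticallyRegular (hB.spectral ε hε)
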